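/- **Hypergraphs.** A hypergraph $\mathbb H$ consists of a finite totally ordered set $H$ of vertices and a set $\mathbb H$ of non-empty subsets of $H$ (hyperedges) containing all singletons $\{x\}$, $x\in H$. For $X\subseteq H$ put $\mathbb H_X=\{Z\in\mathbb H: Z\subseteq X\}$, a hypergraph on $X$. $\mathbb H$ is connected if $H\neq\emptyset$ and there is no partition $H=A\sqcup B$ into non-empty parts with $\mathbb H=\mathbb H_A\cup\mathbb H_B$. A subset $X\subseteq H$ is connected if $\mathbb H_X$ is; the connected components of $\mathbb H_X$ are the maximal connected subsets of $X$. The reconnected restriction of $\mathbb H$ to $X$ is $\mathbb H_{\cap X}=\{Z\cap X: Z\subseteq H \text{ connected},\ Z\cap X\ne\emptyset\}$, a hypergraph on $X$. **Constructs and faces.** A construct of a connected hypergraph $\mathbb L$ with vertex set $L$ is a non-planar tree $X(T_1,\dots,T_n)$ with root decorated by some $\emptyset\ne X\subseteq L$ and with one construct $T_i$ of $\mathbb L_{L_i}$ for every connected component $L_i$ of $\mathbb L_{L\setminus X}$. Its dimension is the sum of $|Z|-1$ over its nodes $Z$. Write $S\prec T$ if $T$ arises from $S$ by contracting an edge between a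 node $Z$ and a son $Z'$, the new node being $Z\cup Z'$. $S$ is a face of $T$ if $S\prec^* T$. The maximal face is the one-node tree $L$. Constructs of dimension $0$ are called constructions, or vertices. A construct $E$ of dimension $1$ is called an edge; it has one non-singleton node $\{x,y\}$, with $x<y$ say, and it is oriented from the vertex in which this node is replaced by $x(y)$ to the one in which it is replaced by $y(x)$. An *oriented boundary* of a construct $F$ of dimension $2$ is a pair $(P,Q)$ of paths of oriented edges of $F$, with the same first vertex and the same last vertex, such that every edge of $F$ lies on exactly one of $P$, $Q$. **The rewriting system.** Let $\mathbb H$ be a connected hypergraph. In the many-sorted system $(\Sigma^c_{\mathbb H},R^c_{\mathbb H})$ the sorts are the connected subsets of $H$. Every sort $Y$ has exactly one variable, also written $Y$. The function symbols are the pairs $(x,Y)$ with $x\in Y$ and $Y$ connected. The output sort of $(x,Y)$ is $Y$, and it has one argument of sort $C$ for every connected component $C$ of $\mathbb H_{Y\setminus\{x\}}$. For $K$ connected and $x\ne y$ in $K$, let $l_K(x,y)$ be the term with root symbol $(x,K)$ whose argument at the component $K_y$ of $\mathbb H_{K\setminus\{x\}}$ containing $y$ is $(y,K_y)$ applied to variables,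 and whose other arguments are variables. The rules are $l_K(x,y)\to l_K(y,x)$ for all connected $K$ and all $x<y$ in $K$. Rewriting steps are the instances of rules in contexts. A *critical pair* is a minimal overlapping. It is a pair of steps $s\to t_1$, $s\to t_2$ that are not the same rule applied at the same place and whose rule left sides match a common function symbol of $s$. Moreover, there are no steps $s'\to t_1'$, $s'\to t_2'$ from which both steps are obtained by one non-trivial context, or by one substitution that does more than rename the variables of $s'$. A *critical confluence diagram* is a pair of reduction sequences $s\to t_1\to\cdots\to t$ and $s\to t_2\to\cdots\to t$ with a common end $t$, where $(s\to t_1,\ s\to t_2)$ is a critical pair. For $X\subseteq Y\subseteq H$ with $Y$ connected and $X\neq\emptyset$, a construction $S$ of $(\mathbb H_Y)_{\cap X}$ determines a term $\chi^{-1}(S)$ of sort $Y$ over $\Sigma^c_{\mathbb H}$. Its function symbols are $(x,K)$ for the nodes $x$ of $S$, with the same tree structure and with $K$ the sort required at the place of $x$. Every argument place whose sort is disjoint from $X$ is filled with the variable of that sort. **Proposition.** Let $\mathbb H$ be an ordered connected hypergraph. The critical confluence diagrams of $(\Sigma^c_{\mathbb H},R^c_{\mathbb H})$ are exactly those given by the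 maximal faces of the reconnected restrictions $(\mathbb H_Y)_{\cap X}$, where $Y$ ranges over the connected subsets of $H$ and $X$ over the 3-element subsets of $Y$. Precisely: 1. For all such $X\subseteq Y$, the maximal face of $(\mathbb H_Y)_{\cap X}$ has an oriented boundary $(P,Q)$, unique up to exchanging $P$ and $Q$. 2. For every such $(P,Q)$, the pair $(\chi^{-1}(P),\chi^{-1}(Q))$ is a critical confluence diagram of terms of sort $Y$. 3. Every critical confluence diagram of terms of sort $Y$ is of the form $(\chi^{-1}(P),\chi^{-1}(Q))$ for exactly one 3-element subset $X\subseteq Y$ and some oriented boundary $(P,Q)$ of the maximal face of $(\mathbb H_Y)_{\cap X}$. 4. For every critical pair $s\to t_1$, $s\to t_2$ there is exactly one pair of reduction sequences $s\to t_1\to\cdots\to t$, $s\to t_2\to\cdots\to t$ with a common end. -/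

import Mathlib

universe u

/-! ## Many-sorted term rewriting -/

namespace TermRewriting

/-- A many-sorted signature.  The argument places of a function symbol `f` form a finite type
`Pos f`; the arity of `f` is the cardinality of this type. -/
structure Signature where
  /-- variables -/
  V : Type u
  /-- function symbols -/
  F : Type u
  /-- sorts -/
  S : Type u
  /-- argument places -/
  Pos : F → Type u
  finite_pos : ∀ f, Finite (Pos f)
  /-- sort of a variable -/
  outV : V → S
  /-- output sort of a function symbol -/
  outF : F → S
  /-- input sorts of a function symbol -/
  inF : ∀ f, Pos f → S

variable {Sg : Signature.{u}}

/-- Terms, indexed by their sort. -/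
inductive Term (Sg : Signature.{u}) : Sg.S → Type u
  | var (v : Sg.V) : Term Sg (Sg.outV v)
  | app (f : Sg.F) (ts : ∀ i : Sg.Pos f, Term Sg (Sg.inF f i)) : Term Sg (Sg.outF f)

/-- The set of variables of a term. -/
def Term.vars : ∀ {a : Sg.S}, Term Sg a → Set Sg.V
  | _, .var v => {v}
  | _, .app _ ts => ⋃ i, (ts i).vars

/-- The term is a variable. -/
def Term.IsVar : ∀ {a : Sg.S}, Term Sg a → Prop
  | _, .var _ => True
  | _, .app _ _ => False

/-- The positions of the function symbols of a term.  A position is the list of the argument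
places that lead from the root of the term to the symbol. -/
def Term.symbolPos : ∀ {a : Sg.S}, Term Sg a → Set (List (Σ f : Sg.F, Sg.Pos f))
  | _, .var _ => ∅
  | _, .app f ts => {p | p = [] ∨ ∃ i, ∃ q ∈ (ts i).symbolPos, p = ⟨f, i⟩ :: q}

/-- A substitution, given by its values on the variables. -/
abbrev Subst (Sg : Signature.{u}) : Type u := ∀ v : Sg.V, Term Sg (Sg.outV v)

/-- The action of a substitution on terms. -/
def Term.subst (σ : Subst Sg) : ∀ {a : Sg.S}, Term Sg a → Term Sg a
  | _, .var v => σ v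
  | _, .app f ts => .app f (fun i => (ts i).subst σ)

/-- `σ` only renames the variables in `W`. -/
def Subst.IsRenamingOn (σ : Subst Sg) (W : Set Sg.V) : Prop :=
  (∀ v ∈ W, (σ v).IsVar) ∧
    Set.InjOn (fun v => (⟨Sg.outV v, σ v⟩ : Σ a : Sg.S, Term Sg a)) W

/-- Contexts with one hole: `Context Sg a b` has a hole of sort `a` and output sort `b`. -/
inductive Context (Sg : Signature.{u}) (a : Sg.S) : Sg.S → Type u
  | hole : Context Sg a a
  | app (f : Sg.F) (i : Sg.Pos f) (ts : ∀ j : Sg.Pos f, j ≠ i → Term Sg (Sg.inF f j))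
      (C : Context Sg a (Sg.inF f i)) : Context Sg a (Sg.outF f)

open Classical in
/-- The term `C[t]`. -/
noncomputable def Context.fill {a : Sg.S} : ∀ {b : Sg.S}, Context Sg a b → Term Sg a → Term Sg b
  | _, .hole, t => t
  | _, .app f i ts C, t =>
      .app f (fun j => if h : j = i then h ▸ C.fill t else ts j h)

/-- The position of the hole. -/
def Context.holePos {a : Sg.S} : ∀ {b : Sg.S}, Context Sg a b → List (Σ f : Sg.F, Sg.Pos f)
  | _, .hole => []
  | _, .app f i _ C => ⟨f, i⟩ :: C.holePos

/-- A many-sorted term rewriting system over `Sg`: a set of rewriting rules `l → r`. -/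
structure TRS (Sg : Signature.{u}) where
  /-- `Rule l r` means that `l → r` is a rewriting rule -/
  Rule : ∀ {a : Sg.S}, Term Sg a → Term Sg a → Prop
  lhs_not_var : ∀ {a : Sg.S} {l r : Term Sg a}, Rule l r → ¬ l.IsVar
  vars_subset : ∀ {a : Sg.S} {l r : Term Sg a}, Rule l r → r.vars ⊆ l.vars

namespace TRS

variable (R : TRS Sg)

/-- A presentation of `s → t` as an instance in context of a rewriting rule. -/
structure Redex {b : Sg.S} (s t : Term Sg b) where
  /-- sort of the rule -/
  a : Sg.S
  /-- left side of the rule -/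
  l : Term Sg a
  /-- right side of the rule -/
  r : Term Sg a
  rule : R.Rule l r
  /-- context -/
  C : Context Sg a b
  /-- substitution -/
  σ : Subst Sg
  source_eq : s = C.fill (l.subst σ)
  target_eq : t = C.fill (r.subst σ)

/-- `s → t` is a rewriting step. -/
def Step {b : Sg.S} (s t : Term Sg b) : Prop := Nonempty (R.Redex s t)

variable {R}

/-- The positions of those function symbols of `s` that the left side of the rule matches. -/
def Redex.pattern {b : Sg.S} {s t : Term Sg b} (o : R.Redex s t) :
    Set (List (Σ f : Sg.F, Sg.Pos f)) :=
  {p | ∃ q ∈ o.l.symbolPos, p = o.C.holePos ++ q}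

/-- Two redexes of the same term overlap: they have a function symbol of the term in common,
and they are not the same rule applied at the same place. -/
def Redex.Overlaps {b : Sg.S} {s t₁ t₂ : Term Sg b} (o₁ : R.Redex s t₁) (o₂ : R.Redex s t₂) :
    Prop :=
  (o₁.pattern ∩ o₂.pattern).Nonempty ∧
    ¬ (o₁.C.holePos = o₂.C.holePos ∧
      (⟨o₁.a, o₁.l, o₁.r⟩ : Σ a : Sg.S, Term Sg a × Term Sg a) = ⟨o₂.a, o₂.l, o₂.r⟩)

variable (R)

/-- A critical pair is a minimal overlapping: two overlapping steps `s → t₁` and `s → t₂` that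
are not both obtained from two steps `s' → t₁'`, `s' → t₂'` by one non-trivial context, nor by
one substitution that does more than rename the variables of `s'`. -/
def IsCriticalPair {b : Sg.S} (s t₁ t₂ : Term Sg b) : Prop :=
  (∃ (o₁ : R.Redex s t₁) (o₂ : R.Redex s t₂), o₁.Overlaps o₂) ∧
  (¬ ∃ (a : Sg.S) (C : Context Sg a b) (s' t₁' t₂' : Term Sg a), C.holePos ≠ [] ∧
    R.Step s' t₁' ∧ R.Step s' t₂' ∧ s = C.fill s' ∧ t₁ = C.fill t₁' ∧ t₂ = C.fill t₂') ∧
  (¬ ∃ (σ : Subst Sg) (s' t₁' t₂' : Term Sg b), ¬ σ.IsRenamingOn s'.vars ∧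
    R.Step s' t₁' ∧ R.Step s' t₂' ∧ s = s'.subst σ ∧ t₁ = t₁'.subst σ ∧ t₂ = t₂'.subst σ)

/-- A local confluence diagram for the pair of steps `s → t₁`, `s → t₂`: two reduction
sequences `p = (s → t₁ → ⋯ → t)` and `q = (s → t₂ → ⋯ → t)` with the same end `t`. -/
def IsLocalConfluenceDiagram {b : Sg.S} (s t₁ t₂ : Term Sg b) (p q : List (Term Sg b)) : Prop :=
  [s, t₁] <+: p ∧ [s, t₂] <+: q ∧ p.IsChain R.Step ∧ q.IsChain R.Step ∧
    p.getLast? = q.getLast?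

/-- A critical confluence diagram: a local confluence diagram for a critical pair. -/
def IsCriticalConfluenceDiagram {b : Sg.S} (p q : List (Term Sg b)) : Prop :=
  ∃ s t₁ t₂, R.IsCriticalPair s t₁ t₂ ∧ R.IsLocalConfluenceDiagram s t₁ t₂ p q

end TRS

end TermRewriting

/-! ## Hypergraphs, constructs and faces -/

namespace Nestohedra

variable {α : Type u} [LinearOrder α]

/-- Finite atomic hypergraphs on vertices taken from `α`: the hyperedges are non-empty sets of
vertices, among them all singletons (so their union is the set of vertices).  The vertices are
totally ordered by the order of `α`. -/
structure AtomicHypergraph (α : Type u) [LinearOrder α] where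
  /-- vertices -/
  verts : Finset α
  /-- hyperedges -/
  edges : Finset (Finset α)
  nonempty_of_mem : ∀ Z ∈ edges, Z.Nonempty
  subset_of_mem : ∀ Z ∈ edges, Z ⊆ verts
  atomic : ∀ x ∈ verts, {x} ∈ edges

namespace AtomicHypergraph

variable (H : AtomicHypergraph α)

/-- The plain restriction `H_X`. -/
def restrict (X : Finset α) : AtomicHypergraph α where
  verts := H.verts ∩ X
  edges := H.edges.filter (· ⊆ X)
  nonempty_of_mem Z hZ := H.nonempty_of_mem Z (Finset.mem_filter.1 hZ).1
  subset_of_mem Z hZ :=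
    Finset.subset_inter (H.subset_of_mem Z (Finset.mem_filter.1 hZ).1) (Finset.mem_filter.1 hZ).2
  atomic x hx := Finset.mem_filter.2
    ⟨H.atomic x (Finset.mem_inter.1 hx).1, Finset.singleton_subset_iff.2 (Finset.mem_inter.1 hx).2⟩

/-- Connected hypergraphs (non-empty by convention). -/
def Connected : Prop :=
  H.verts.Nonempty ∧ ∀ A B : Finset α, A ∪ B = H.verts → Disjoint A B →
    H.edges = (H.restrict A).edges ∪ (H.restrict B).edges → A = ∅ ∨ B = ∅

/-- Connected subsets of the set of vertices. -/
def IsConn (X : Finset α) : Prop := X ⊆ H.verts ∧ (H.restrict X).Connected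

open Classical in
/-- The saturation: all connected subsets. -/
noncomputable def sat : Finset (Finset α) := H.verts.powerset.filter H.IsConn

open Classical in
/-- The connected components of `H_D`. -/
noncomputable def comps (D : Finset α) : Finset (Finset α) :=
  D.powerset.filter fun C => Maximal (fun C' => C' ⊆ D ∧ H.IsConn C') C

theorem mem_sat {Z : Finset α} : Z ∈ H.sat ↔ H.IsConn Z := by
  classical
  rw [sat, Finset.mem_filter, Finset.mem_powerset]
  exact ⟨fun h => h.2, fun h => ⟨h.1, h⟩⟩

theorem isConn_iff (X : Finset α) : H.IsConn X ↔ X ⊆ H.verts ∧ X.Nonempty ∧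
    ∀ A B : Finset α, A ∪ B = X → Disjoint A B →
      (∀ Z ∈ H.edges, Z ⊆ X → Z ⊆ A ∨ Z ⊆ B) → A = ∅ ∨ B = ∅ := by
  unfold IsConn Connected
  refine and_congr_right fun hX => ?_
  have e : H.verts ∩ X = X := Finset.inter_eq_right.2 hX
  simp only [restrict, e]
  refine and_congr_right fun _ => ?_
  refine forall₂_congr fun A B => ?_
  refine forall_congr' fun hAB => forall_congr' fun _ => ?_
  refine imp_congr_left ?_
  subst hAB
  constructor
  · intro h Z hZ hZX
    have : Z ∈ H.edges.filter (· ⊆ A ∪ B) := Finset.mem_filter.2 ⟨hZ, hZX⟩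
    rw [h] at this
    simp only [Finset.mem_union, Finset.mem_filter] at this
    tauto
  · intro h
    ext Z
    simp only [Finset.mem_union, Finset.mem_filter]
    constructor
    · rintro ⟨h1, h2⟩
      rcases h Z h1 h2 with h3 | h3
      · exact Or.inl ⟨⟨h1, h2⟩, h3⟩
      · exact Or.inr ⟨⟨h1, h2⟩, h3⟩
    · tauto

theorem isConn_singleton {x : α} (hx : x ∈ H.verts) : H.IsConn {x} := by
  rw [isConn_iff]
  refine ⟨by simpa using hx, by simp, ?_⟩
  intro A B hAB hd _
  have hxm : x ∈ A ∪ B := by simp [hAB]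
  have hA : A ⊆ {x} := hAB ▸ Finset.subset_union_left
  have hB : B ⊆ {x} := hAB ▸ Finset.subset_union_right
  rcases Finset.subset_singleton_iff.1 hA with h | h
  · exact Or.inl h
  rcases Finset.subset_singleton_iff.1 hB with h' | h'
  · exact Or.inr h'
  · subst h h'
    simp at hd

theorem IsConn.union {A B : Finset α} (hA : H.IsConn A) (hB : H.IsConn B)
    (hAB : (A ∩ B).Nonempty) : H.IsConn (A ∪ B) := by
  rw [isConn_iff] at *
  refine ⟨Finset.union_subset hA.1 hB.1, hA.2.1.mono Finset.subset_union_left, ?_⟩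
  intro P Q hPQ hd hZ
  have key : ∀ D : Finset α, D ⊆ A ∪ B → (∀ P Q : Finset α, P ∪ Q = D → Disjoint P Q →
      (∀ Z ∈ H.edges, Z ⊆ D → Z ⊆ P ∨ Z ⊆ Q) → P = ∅ ∨ Q = ∅) → D ∩ P = ∅ ∨ D ∩ Q = ∅ := by
    intro D hD h
    refine h (D ∩ P) (D ∩ Q) ?_ ?_ ?_
    · rw [← Finset.inter_union_distrib_left, hPQ]
      exact Finset.inter_eq_left.2 hD
    · exact hd.mono Finset.inter_subset_right Finset.inter_subset_right
    · intro Z h1 h2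
      rcases hZ Z h1 (h2.trans hD) with h3 | h3
      · exact Or.inl (Finset.subset_inter h2 h3)
      · exact Or.inr (Finset.subset_inter h2 h3)
  have kA := key A Finset.subset_union_left hA.2.2
  have kB := key B Finset.subset_union_right hB.2.2
  obtain ⟨x, hx⟩ := hAB
  have hxP : x ∈ P ∪ Q := by
    rw [hPQ]
    exact Finset.mem_union_left _ (Finset.mem_inter.1 hx).1
  simp only [Finset.eq_empty_iff_forall_notMem, Finset.mem_inter, not_and] at kA kB ⊢
  simp only [Finset.ext_iff, Finset.mem_union, Finset.mem_inter] at hPQ hx hxP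
  have hd' : ∀ z, z ∈ P → z ∉ Q := fun z hz => Finset.disjoint_left.1 hd hz
  grind

theorem mem_comps {D C : Finset α} : C ∈ H.comps D ↔
    C ⊆ D ∧ H.IsConn C ∧ ∀ C', C' ⊆ D → H.IsConn C' → C ⊆ C' → C' = C := by
  classical
  rw [comps, Finset.mem_filter, Finset.mem_powerset]
  constructor
  · rintro ⟨h1, ⟨_, h2⟩, h3⟩
    exact ⟨h1, h2, fun C' a b c => Finset.Subset.antisymm (h3 ⟨a, b⟩ c) c⟩
  · rintro ⟨h1, h2, h3⟩
    exact ⟨h1, ⟨h1, h2⟩, fun C' a b => (h3 C' a.1 a.2 b).le⟩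

theorem isConn_of_mem_comps {D C : Finset α} (h : C ∈ H.comps D) : H.IsConn C :=
  (H.mem_comps.1 h).2.1

theorem comps_self_sdiff (D : Finset α) : H.comps (D \ D) = ∅ := by
  refine Finset.eq_empty_of_forall_notMem fun C hC => ?_
  rw [mem_comps, isConn_iff] at hC
  have h := hC.1
  rw [sdiff_self] at h
  exact hC.2.1.2.1.ne_empty (Finset.subset_empty.1 h)

theorem exists_comps {D C : Finset α} (hC : H.IsConn C) (hCD : C ⊆ D) :
    ∃ E ∈ H.comps D, C ⊆ E := by
  classical
  obtain ⟨E, hE, hm⟩ := Finset.exists_le_maximal (D.powerset.filter H.IsConn)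
    (Finset.mem_filter.2 ⟨Finset.mem_powerset.2 hCD, hC⟩)
  refine ⟨E, ?_, hE⟩
  have h1 := Finset.mem_filter.1 hm.1
  refine H.mem_comps.2 ⟨Finset.mem_powerset.1 h1.1, h1.2, fun C' a b c => ?_⟩
  exact Finset.Subset.antisymm (hm.2 (Finset.mem_filter.2 ⟨Finset.mem_powerset.2 a, b⟩) c) c

/-- The reconnected restriction of `H` to `X`, with hyperedges `Z ∩ X ≠ ∅` for `Z` in the
saturation of `H`. -/
noncomputable def reconnected (X : Finset α) : AtomicHypergraph α where
  verts := H.verts ∩ X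
  edges := (H.sat.image (· ∩ X)).filter (·.Nonempty)
  nonempty_of_mem Z hZ := (Finset.mem_filter.1 hZ).2
  subset_of_mem Z hZ := by
    obtain ⟨W, hW, rfl⟩ := Finset.mem_image.1 (Finset.mem_filter.1 hZ).1
    exact Finset.inter_subset_inter_right
      (H.mem_sat.1 hW).1
  atomic x hx := by
    have hx' := Finset.mem_inter.1 hx
    refine Finset.mem_filter.2 ⟨Finset.mem_image.2 ⟨{x}, ?_, ?_⟩, by simp⟩
    · exact H.mem_sat.2 (H.isConn_singleton hx'.1)
    · exact Finset.inter_eq_left.2 (by simpa using hx'.2)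

end AtomicHypergraph

variable {L : AtomicHypergraph α}

/-- `Construct L D` is the type of constructs of `L_D` (for `D` connected): non-planar trees
`X(T₁, …, Tₙ)` with `∅ ≠ X ⊆ D` and one construct `Tᵢ` of `L_{Dᵢ}` for each connected component
`Dᵢ` of `L_D \ X`. -/
inductive Construct (L : AtomicHypergraph α) : Finset α → Type u
  | node {D : Finset α} (X : Finset α) (hX : X.Nonempty) (hXD : X ⊆ D)
      (ts : ∀ C : L.comps (D \ X), Construct L C.1) : Construct L D

namespace Construct

/-- The decoration of the root. -/
def root : ∀ {D : Finset α}, Construct L D → Finset α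
  | _, .node X _ _ _ => X

/-- `T.IsNode Z`: `Z` is (the decoration of) a node of `T`. -/
def IsNode : ∀ {D : Finset α}, Construct L D → Finset α → Prop
  | _, .node X _ _ ts, Z => Z = X ∨ ∃ C, (ts C).IsNode Z

/-- `T.Son A B`: the node `B` of `T` is a son of the node `A`. -/
def Son : ∀ {D : Finset α}, Construct L D → Finset α → Finset α → Prop
  | _, .node X _ _ ts, A, B => (A = X ∧ ∃ C, B = (ts C).root) ∨ ∃ C, (ts C).Son A B

/-- The dimension: the sum of `|X| - 1` over all nodes `X`. -/
noncomputable def dim : ∀ {D : Finset α}, Construct L D → ℕ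
  | _, .node X _ _ ts => (X.card - 1) + ∑ C, (ts C).dim

/-- The covering relation `S ≺ T`: `T` is obtained from `S` by contracting an edge between a
node and one of its sons and labelling the new node with the union of the two labels. -/
inductive Covers : ∀ {D : Finset α}, Construct L D → Construct L D → Prop
  | contract {D X Y Z : Finset α} {hX : X.Nonempty} {hXD : X ⊆ D} {hZ : Z.Nonempty}
      {hZD : Z ⊆ D} {ts : ∀ C : L.comps (D \ X), Construct L C.1}
      {us : ∀ C : L.comps (D \ Z), Construct L C.1}
      (C : L.comps (D \ X)) {hY : Y.Nonempty} {hYC : Y ⊆ C.1}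
      {vs : ∀ E : L.comps (C.1 \ Y), Construct L E.1}
      (hC : ts C = .node Y hY hYC vs) (hZXY : Z = X ∪ Y)
      (h₁ : ∀ (E : Finset α) (h : E ∈ L.comps (C.1 \ Y)) (h' : E ∈ L.comps (D \ Z)),
        us ⟨E, h'⟩ = vs ⟨E, h⟩)
      (h₂ : ∀ (E : Finset α) (h : E ∈ L.comps (D \ X)) (h' : E ∈ L.comps (D \ Z)),
        E ≠ C.1 → us ⟨E, h'⟩ = ts ⟨E, h⟩) :
      Covers (.node X hX hXD ts) (.node Z hZ hZD us)
  | sub {D X : Finset α} {hX : X.Nonempty} {hXD : X ⊆ D}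
      {ts us : ∀ C : L.comps (D \ X), Construct L C.1} (C : L.comps (D \ X))
      (hC : Covers (ts C) (us C)) (h : ∀ E, E ≠ C → us E = ts E) :
      Covers (.node X hX hXD ts) (.node X hX hXD us)

/-- The face order: `S.IsFace T` means that `S` is a face of `T`. -/
def IsFace {D : Finset α} (S T : Construct L D) : Prop := Relation.ReflTransGen Covers S T

/-- The maximal face: the one-node construct decorated by `D`. -/
def maxFace (L : AtomicHypergraph α) (D : Finset α) (hD : D.Nonempty) : Construct L D :=
  .node D hD (Finset.Subset.refl D)
    (fun C => absurd (L.comps_self_sdiff D ▸ C.2 : C.1 ∈ (∅ : Finset (Finset α)))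
      (Finset.notMem_empty _))

end Construct

/-- `Construction L D` is the type of constructions of `L_D`: constructs all of whose nodes are
singletons. -/
inductive Construction (L : AtomicHypergraph α) : Finset α → Type u
  | node {D : Finset α} (x : α) (hx : x ∈ D)
      (ts : ∀ C : L.comps (D \ {x}), Construction L C.1) : Construction L D

/-- A construction as a construct. -/
def Construction.toConstruct : ∀ {D : Finset α}, Construction L D → Construct L D
  | _, .node x hx ts =>
      .node {x} (Finset.singleton_nonempty x) (Finset.singleton_subset_iff.2 hx)
        (fun C => (ts C).toConstruct)

/-- `E` is an edge with vertices `S` and `T`, oriented from `S` to `T`: the non-singleton node of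
`E` is `{x, y}` with `x < y`, and it is replaced by `x(y)` in `S` and by `y(x)` in `T`. -/
def IsOrientedEdge {D : Finset α} (E : Construct L D) (S T : Construction L D) : Prop :=
  ∃ x y : α, x < y ∧ E.IsNode {x, y} ∧
    S.toConstruct.Covers E ∧ T.toConstruct.Covers E ∧
    S.toConstruct.Son {x} {y} ∧ T.toConstruct.Son {y} {x}

/-- The path `P` runs through the edge `E`. -/
def Traverses {D : Finset α} (P : List (Construction L D)) (E : Construct L D) : Prop :=
  ∃ S T, [S, T] <:+: P ∧ IsOrientedEdge E S T

/-- `P` and `Q` form the oriented boundary of the 2-face `F`: they are oriented paths of edges of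
`F` with the same first and the same last vertex, and every edge of `F` lies on exactly one of
them. -/
def IsBoundary {D : Finset α} (F : Construct L D) (P Q : List (Construction L D)) : Prop :=
  (∃ S T, P.head? = some S ∧ Q.head? = some S ∧ P.getLast? = some T ∧ Q.getLast? = some T) ∧
  P.IsChain (fun S T => ∃ E : Construct L D, E.IsFace F ∧ IsOrientedEdge E S T) ∧
  Q.IsChain (fun S T => ∃ E : Construct L D, E.IsFace F ∧ IsOrientedEdge E S T) ∧
  ∀ E : Construct L D, E.dim = 1 → E.IsFace F → Xor (Traverses P E) (Traverses Q E)

/-! ## The rewriting system on constructions -/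

open TermRewriting

variable (H : AtomicHypergraph α)

/-- The connected subsets of the vertex set: the sorts, and also the variables. -/
abbrev ConnSet : Type u := {Y : Finset α // H.IsConn Y}

/-- The function symbols `(x, Y)` with `x ∈ Y` and `Y` connected. -/
structure Symbol where
  /-- the vertex `x` -/
  x : α
  /-- the connected set `Y` -/
  Y : ConnSet H
  mem : x ∈ Y.1

/-- The constructions signature.  The argument places of `(x, Y)` are the connected components of
`H_Y \ x`, each of which is the input sort of its place. -/
noncomputable abbrev constructionsSig : Signature.{u} where
  V := ConnSet H
  F := Symbol H
  S := ConnSet H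
  Pos f := H.comps (f.Y.1 \ {f.x})
  finite_pos _ := inferInstance
  outV Y := Y
  outF f := f.Y
  inF _ C := ⟨C.1, H.isConn_of_mem_comps C.2⟩

/-- Terms of sort `Y` over the constructions signature. -/
abbrev CTerm (Y : ConnSet H) : Type u := Term (constructionsSig H) Y

variable {H}

/-- The variable `Y`, of sort `Y`. -/
def cvar (Y : ConnSet H) : CTerm H Y := Term.var (Sg := constructionsSig H) Y

/-- The term `(x, Y)(ts)`. -/
def capp (x : α) (Y : ConnSet H) (hx : x ∈ Y.1)
    (ts : ∀ C : H.comps (Y.1 \ {x}), CTerm H ⟨C.1, H.isConn_of_mem_comps C.2⟩) : CTerm H Y :=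
  Term.app (Sg := constructionsSig H) ⟨x, Y, hx⟩ ts

theorem vars_cvar (Y : ConnSet H) : Term.vars (cvar Y) = {Y} := rfl

theorem vars_capp (x : α) (Y : ConnSet H) (hx : x ∈ Y.1)
    (ts : ∀ C : H.comps (Y.1 \ {x}), CTerm H ⟨C.1, H.isConn_of_mem_comps C.2⟩) :
    Term.vars (capp x Y hx ts) = ⋃ C, Term.vars (ts C) := rfl

/-- The term `(x, K)(U₁, …, (y, K_y)(W₁, …, Wₙ))`, where the `Uᵢ` are the connected components of
`H_K \ x` that do not contain `y`, `K_y` is the one that contains `y`, and the `Wⱼ` are the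
connected components of `K_y \ y`. -/
noncomputable def pairTerm (K : ConnSet H) (x y : α) (hx : x ∈ K.1) : CTerm H K :=
  capp x K hx fun C =>
    if hy : y ∈ C.1 then
      capp y ⟨C.1, H.isConn_of_mem_comps C.2⟩ hy fun E => cvar ⟨E.1, H.isConn_of_mem_comps E.2⟩
    else cvar ⟨C.1, H.isConn_of_mem_comps C.2⟩

theorem vars_pairTerm (K : ConnSet H) (x y : α) (hx : x ∈ K.1) :
    Term.vars (pairTerm K x y hx) = {U : ConnSet H | U.1 ∈ H.comps (K.1 \ {x, y})} := by
  ext (U : ConnSet H)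
  have hU : U ∈ Term.vars (pairTerm K x y hx) ↔ ∃ C ∈ H.comps (K.1 \ {x}),
      (y ∈ C ∧ U.1 ∈ H.comps (C \ {y})) ∨ (y ∉ C ∧ U.1 = C) := by
    rw [pairTerm, vars_capp, Set.mem_iUnion]
    constructor
    · rintro ⟨C, hC⟩
      refine ⟨C.1, C.2, ?_⟩
      by_cases hy : y ∈ C.1
      · rw [dif_pos hy, vars_capp, Set.mem_iUnion] at hC
        obtain ⟨E, hE⟩ := hC
        rw [vars_cvar, Set.mem_singleton_iff] at hE
        subst hE
        exact Or.inl ⟨hy, E.2⟩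
      · rw [dif_neg hy, vars_cvar, Set.mem_singleton_iff] at hC
        subst hC
        exact Or.inr ⟨hy, rfl⟩
    · rintro ⟨C, hC, h⟩
      refine ⟨⟨C, hC⟩, ?_⟩
      rcases h with ⟨hy, h⟩ | ⟨hy, h⟩
      · rw [dif_pos hy, vars_capp, Set.mem_iUnion]
        exact ⟨⟨U.1, h⟩, by rw [vars_cvar]; exact rfl⟩
      · rw [dif_neg hy, vars_cvar]
        exact Subtype.ext h
  refine hU.trans ?_
  change _ ↔ U.1 ∈ H.comps (K.1 \ {x, y})
  have hsd : ∀ A : Finset α, A ⊆ K.1 \ {x, y} ↔ A ⊆ K.1 ∧ x ∉ A ∧ y ∉ A := by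
    intro A
    simp only [Finset.subset_iff, Finset.mem_sdiff, Finset.mem_insert, Finset.mem_singleton]
    grind
  have hsx : ∀ (D A : Finset α) (z : α), A ⊆ D \ {z} ↔ A ⊆ D ∧ z ∉ A := by
    intro D A z
    simp only [Finset.subset_iff, Finset.mem_sdiff, Finset.mem_singleton]
    grind
  constructor
  · rintro ⟨C, hC, h⟩
    rw [H.mem_comps, hsx] at hC
    obtain ⟨⟨hC1, hC2⟩, hC3, hC4⟩ := hC
    rcases h with ⟨hy, h⟩ | ⟨hy, h⟩
    · rw [H.mem_comps, hsx] at h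
      rw [H.mem_comps, hsd]
      refine ⟨⟨h.1.1.trans hC1, fun hh => hC2 (h.1.1 hh), h.1.2⟩, h.2.1, ?_⟩
      intro C' h1 h2 h3
      rw [hsd] at h1
      refine h.2.2 C' ?_ h2 h3
      rw [hsx]
      refine ⟨?_, h1.2.2⟩
      obtain ⟨u, hu⟩ := ((H.isConn_iff _).1 h.2.1).2.1
      have hc : H.IsConn (C' ∪ C) :=
        h2.union H hC3 ⟨u, Finset.mem_inter.2 ⟨h3 hu, h.1.1 hu⟩⟩
      have := hC4 (C' ∪ C) ((hsx _ _ _).2 ⟨Finset.union_subset h1.1 hC1, by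
        rw [Finset.mem_union]; tauto⟩) hc Finset.subset_union_right
      rw [← this]
      exact Finset.subset_union_left
    · rw [h, H.mem_comps, hsd]
      refine ⟨⟨hC1, hC2, hy⟩, hC3, fun C' h1 h2 h3 => ?_⟩
      rw [hsd] at h1
      exact hC4 C' ((hsx _ _ _).2 ⟨h1.1, h1.2.1⟩) h2 h3
  · intro h
    rw [H.mem_comps, hsd] at h
    obtain ⟨⟨h1, h2, h3⟩, h4, h5⟩ := h
    obtain ⟨C, hC, hUC⟩ := H.exists_comps h4 ((hsx _ _ _).2 ⟨h1, h2⟩ : U.1 ⊆ K.1 \ {x})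
    refine ⟨C, hC, ?_⟩
    rw [H.mem_comps, hsx] at hC
    obtain ⟨⟨hC1, hC2⟩, hC3, hC4⟩ := hC
    by_cases hy : y ∈ C
    · refine Or.inl ⟨hy, ?_⟩
      rw [H.mem_comps, hsx]
      refine ⟨⟨hUC, h3⟩, h4, fun C' k1 k2 k3 => ?_⟩
      rw [hsx] at k1
      exact h5 C' ((hsd _).2 ⟨k1.1.trans hC1, fun hh => hC2 (k1.1 hh), k1.2⟩) k2 k3
    · exact Or.inr ⟨hy, (h5 C ((hsd _).2 ⟨hC1, hC2, hy⟩) hC3 hUC).symm⟩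

variable (H)

/-- The rules `(x, K)(…, (y, K_y)(…)) → (y, K)(…, (x, K_x)(…))` for `x < y`. -/
inductive CRule : ∀ {Y : ConnSet H}, CTerm H Y → CTerm H Y → Prop
  | flip (K : ConnSet H) (x y : α) (hx : x ∈ K.1) (hy : y ∈ K.1) (hxy : x < y) :
      CRule (pairTerm K x y hx) (pairTerm K y x hy)

/-- The rewriting system on constructions. -/
noncomputable def constructionsTRS : TRS (constructionsSig H) where
  Rule {_} l r := CRule H l r
  lhs_not_var := by
    rintro _ _ _ ⟨⟩
    exact fun h => h
  vars_subset := by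
    rintro _ _ _ ⟨⟩
    rw [vars_pairTerm, vars_pairTerm, Finset.pair_comm]

variable {H}

/-- The term of sort `K` that corresponds to a construction of a reconnected restriction `L` of
`H_K`: a node `x` becomes the symbol `(x, K)`, where `K` is the sort required at that place, and
the components `C` of `H_K \ x` that contain no vertex of `L` are filled with the variable `C`.
(The traces on the vertices of `L` of the other components are the components of `L_D \ x`.) -/
noncomputable def Construction.toTerm : ∀ {D : Finset α}, Construction L D →
    ∀ K : ConnSet H, D ⊆ K.1 → CTerm H K
  | _, .node (D := D) x hx ts, K, hDK =>
      capp x K (hDK hx) fun C =>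
        if h : C.1 ∩ L.verts ∈ L.comps (D \ {x}) then
          (ts ⟨C.1 ∩ L.verts, h⟩).toTerm ⟨C.1, H.isConn_of_mem_comps C.2⟩
            Finset.inter_subset_left
        else cvar ⟨C.1, H.isConn_of_mem_comps C.2⟩

/-- The hypergraph `(H_Y)_{∩X}`. -/
noncomputable abbrev shape (Y : ConnSet H) (X : Finset α) : AtomicHypergraph α :=
  (H.restrict Y.1).reconnected X

/-- `P` and `Q` form the oriented boundary of the maximal face of `(H_Y)_{∩X}`. -/
def IsMaxFaceBoundary (Y : ConnSet H) (X : Finset α) (P Q : List (Construction (shape Y X) X)) :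
    Prop :=
  ∃ hX : X.Nonempty, IsBoundary (Construct.maxFace (shape Y X) X hX) P Q

end Nestohedra

open TermRewriting Nestohedra

/-! A three-letter word `xyz` spelling the elements of `X` encodes a tree: `x` is the root, and the
remaining letters are placed, in their order, inside the connected components left after deleting
`x`. Read in `H_Y` it gives a term (`wordTerm`), read in `(H_Y)_{∩X}` a construction (`ofWord`). The
words `xyz` and `xzy` give the same tree if and only if deleting `x` separates `y` from `z`.

On both sides the arrows out of `xyz` are the same. One may pass to `yxz` if `x < y`. If `y` and `z`
stay together without `x`, one may pass to `xzy` when `y < z`; if they are separated, `z` is a son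
of `x` as well, and one may pass to `zxy` when `x < z`. This is recorded as `IsFlipGraph`, proved
for rewriting steps in `isFlipGraph_wordTerm` and for oriented edges in `isFlipGraph_ofWord`.

For `a < b < c` such a graph is a polygon: `abc` has two successors, `cba` has none, and every other
vertex has exactly one. It thus consists of two chains from `abc` to `cba` that meet only at their
ends (`IsFlipGraph.isBigon`). One passes through the trees with root `c`, the other through those
with root `b`. In a bigon no choice is left after the first step. Hence the two reduction sequences
of a critical pair are unique (`IsBigon.eq_of_prefix`), and so is the oriented boundary up to
exchange (`IsBigon.eq_or_eq_of_xor`).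

Two facts link the sides. A pair `{y, z}` is connected in the reconnected restriction exactly when
`y` and `z` lie in one component of `H_Y \ x` (`isConn_shape_iff_joined`), and `toTerm` sends the
construction of a word to its term (`toTerm_ofWord`). So the two polygons correspond vertex by
vertex.

It remains to see that critical pairs are the pairs of steps out of the words `abc`. Overlapping
rules involve three vertices in all, and minimality removes the rest of the term
(`exists_triple_of_isCriticalPair`). Conversely, two distinct steps out of one term always need
three vertices, so nothing can be stripped from a term that has only three
(`isCriticalPair_of_labels`). -/

namespace Nestohedra

/-! ## Polygons in the graph of a relation -/

section Bigon

variable {V : Type*} {R : V → V → Prop}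

/-- The list is a chain of `R` in which every entry has the next entry as its only successor, and
the last entry has no successor. -/
def IsForced (R : V → V → Prop) : List V → Prop
  -- Excluding the empty list guarantees a first and a last entry.
  | [] => False
  | [t] => ∀ u, ¬ R t u
  | t :: u :: l => (∀ v, R t v ↔ v = u) ∧ IsForced R (u :: l)

theorem IsForced.isChain : ∀ {l : List V}, IsForced R l → l.IsChain R
  | [], _ => .nil
  | [_], _ => .singleton _
  | t :: u :: l, h => by
    rw [List.isChain_cons_cons]
    exact ⟨(h.1 u).2 rfl, h.2.isChain⟩

theorem IsForced.not_rel_last : ∀ {l : List V} {z : V}, IsForced R l → l.getLast? = some z →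
    ∀ u, ¬ R z u
  | [t], z, h, hz => by
    simp only [List.getLast?_singleton, Option.some.injEq] at hz
    subst hz
    exact h
  | t :: u :: l, z, h, hz => by
    rw [List.getLast?_cons_cons] at hz
    exact h.2.not_rel_last hz

/-- A chain with the same start has no choice at any step, and cannot continue beyond the last
entry. -/
theorem IsForced.prefix : ∀ {l m : List V} {t : V}, IsForced R (t :: l) →
    (t :: m).IsChain R → t :: m <+: t :: l
  | l, [], t, _, _ => by simp
  | [], u :: m, t, h, hm => by
    rw [List.isChain_cons_cons] at hm
    exact absurd hm.1 (h u)
  | u :: l, v :: m, t, h, hm => by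
    rw [List.isChain_cons_cons] at hm
    obtain rfl := (h.1 v).1 hm.1
    rw [List.prefix_cons_inj]
    exact h.2.prefix hm.2

/-- If `m` stopped earlier, its end `z` would have a successor, but the last entry of a forced list
has none. -/
theorem IsForced.eq_of_prefix : ∀ {l m : List V} {z : V}, IsForced R l → m <+: l →
    l.getLast? = some z → m.getLast? = some z → m = l
  | _, [], z, _, _, _, hm => by simp at hm
  | [], _ :: _, _, h, _, _, _ => h.elim
  | [t], u :: m, z, h, hp, _, _ => by
    rw [List.cons_prefix_cons] at hp
    obtain ⟨rfl, hp⟩ := hp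
    rw [List.prefix_nil] at hp
    rw [hp]
  | t :: v :: l, u :: m, z, h, hp, hl, hm => by
    rw [List.cons_prefix_cons] at hp
    obtain ⟨rfl, hp⟩ := hp
    cases m with
    | nil =>
      simp only [List.getLast?_singleton, Option.some.injEq] at hm
      subst hm
      exact absurd ((h.1 v).2 rfl) (h.not_rel_last hl v)
    | cons w m =>
      rw [List.getLast?_cons_cons] at hl hm
      rw [h.2.eq_of_prefix hp hl hm]

theorem IsForced.infix_iff : ∀ {l : List V} {v w : V}, IsForced R l →
    ([v, w] <:+: l ↔ v ∈ l ∧ R v w)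
  | [t], v, w, h => by
    constructor
    · intro h'
      simpa using h'.length_le
    · rintro ⟨h1, h2⟩
      rw [List.mem_singleton] at h1
      subst h1
      exact absurd h2 (h w)
  | t :: u :: l, v, w, h => by
    rw [List.infix_cons_iff, h.2.infix_iff]
    constructor
    · rintro (h' | h')
      · rw [List.cons_prefix_cons, List.cons_prefix_cons] at h'
        obtain ⟨rfl, rfl, _⟩ := h'
        exact ⟨List.mem_cons_self, (h.1 _).2 rfl⟩
      · exact ⟨List.mem_cons_of_mem _ h'.1, h'.2⟩
    · rintro ⟨h1, h2⟩
      rcases List.mem_cons.1 h1 with rfl | h1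
      · obtain rfl := (h.1 w).1 h2
        exact Or.inl (by simp)
      · exact Or.inr ⟨h1, h2⟩

/-- Two chains `s :: l₁` and `s :: l₂` of `R` from `s` to `z` that meet only at their ends, and
from which no other chain branches off. -/
structure IsBigon (R : V → V → Prop) (s : V) (l₁ l₂ : List V) (z : V) : Prop where
  forced₁ : IsForced R l₁
  forced₂ : IsForced R l₂
  succ_iff : ∀ v, R s v ↔ l₁.head? = some v ∨ l₂.head? = some v
  head_ne : l₁.head? ≠ l₂.head?
  last₁ : l₁.getLast? = some z
  last₂ : l₂.getLast? = some z
  inter : ∀ v ∈ l₁, v ∈ l₂ → v = z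

theorem IsBigon.symm {s z : V} {l₁ l₂ : List V} (h : IsBigon R s l₁ l₂ z) :
    IsBigon R s l₂ l₁ z where
  forced₁ := h.forced₂
  forced₂ := h.forced₁
  succ_iff v := by rw [h.succ_iff, or_comm]
  head_ne := h.head_ne.symm
  last₁ := h.last₂
  last₂ := h.last₁
  inter v h₁ h₂ := h.inter v h₂ h₁

theorem IsBigon.isChain {s z : V} {l₁ l₂ : List V} (h : IsBigon R s l₁ l₂ z) :
    (s :: l₁).IsChain R := by
  rcases l₁ with _ | ⟨t, l⟩
  · exact h.forced₁.elim
  · rw [List.isChain_cons_cons]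
    exact ⟨(h.succ_iff t).2 (Or.inl rfl), h.forced₁.isChain⟩

/-- Uniqueness of confluence. After their first steps both chains are prefixes of the two sides; a
common end lies on both sides, hence is `z`, and then neither chain can be a proper prefix. -/
theorem IsBigon.eq_of_prefix {s t₁ t₂ z : V} {l₁ l₂ p q : List V} (h : IsBigon R s l₁ l₂ z)
    (h₁ : l₁.head? = some t₁) (h₂ : l₂.head? = some t₂) (hp : [s, t₁] <+: p) (hq : [s, t₂] <+: q)
    (cp : p.IsChain R) (cq : q.IsChain R) (hpq : p.getLast? = q.getLast?) :
    p = s :: l₁ ∧ q = s :: l₂ := by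
  have main : ∀ {l p : List V} {t : V}, IsForced R l → l.head? = some t → [s, t] <+: p →
      p.IsChain R → ∃ m, p = s :: t :: m ∧ t :: m <+: l := by
    intro l p t hl ht hp cp
    obtain ⟨m, rfl⟩ := hp
    refine ⟨m, rfl, ?_⟩
    obtain ⟨l', rfl⟩ := List.head?_eq_some_iff.1 ht
    have : (s :: t :: m).IsChain R := cp
    rw [List.isChain_cons_cons] at this
    exact hl.prefix this.2
  obtain ⟨m, rfl, hm⟩ := main h.forced₁ h₁ hp cp
  obtain ⟨n, rfl, hn⟩ := main h.forced₂ h₂ hq cq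
  rw [List.getLast?_cons_cons, List.getLast?_cons_cons] at hpq
  obtain ⟨w, hw⟩ : ∃ w, (t₁ :: m).getLast? = some w :=
    ⟨_, List.getLast?_eq_some_getLast (List.cons_ne_nil _ _)⟩
  have hw' := hpq ▸ hw
  obtain rfl := h.inter w (hm.subset (List.mem_of_getLast? hw))
    (hn.subset (List.mem_of_getLast? hw'))
  rw [h.forced₁.eq_of_prefix hm h.last₁ hw, h.forced₂.eq_of_prefix hn h.last₂ hw']
  exact ⟨rfl, rfl⟩

theorem IsBigon.infix_iff {s z : V} {l₁ l₂ : List V} (h : IsBigon R s l₁ l₂ z) {v w : V} :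
    [v, w] <:+: s :: l₁ ↔ (v = s ∧ l₁.head? = some w) ∨ (v ∈ l₁ ∧ R v w) := by
  rw [List.infix_cons_iff, h.forced₁.infix_iff, List.cons_prefix_cons, List.head?_eq_some_iff]
  refine or_congr (and_congr_right fun _ => ?_) Iff.rfl
  constructor
  · rintro ⟨m, rfl⟩
    exact ⟨m, rfl⟩
  · rintro ⟨m, rfl⟩
    exact ⟨m, rfl⟩

theorem IsBigon.xor_infix {s z : V} {l₁ l₂ : List V} (h : IsBigon R s l₁ l₂ z)
    (hs : ∀ v, ¬ R v s) (hR : ∀ v w, R v w → v = s ∨ v ∈ l₁ ∨ v ∈ l₂) {v w : V} (hvw : R v w) :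
    Xor ([v, w] <:+: s :: l₁) ([v, w] <:+: s :: l₂) := by
  -- A later occurrence of `s` in the chain would have a predecessor.
  have hl : ∀ {l₁ l₂ : List V}, IsBigon R s l₁ l₂ z → s ∉ l₁ := by
    intro l₁ l₂ h hm
    obtain ⟨a, b, hab⟩ := List.append_of_mem hm
    have hc := h.isChain
    rw [hab, ← List.cons_append] at hc
    rcases List.eq_nil_or_concat a with rfl | ⟨a', x, rfl⟩
    · exact hs s (List.isChain_cons_cons.1 hc).1
    · have : ([s] ++ a' ++ x :: s :: b).IsChain R := by simpa using hc
      exact hs x (List.isChain_cons_cons.1 (List.isChain_append.1 this).2.1).1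
  rw [h.infix_iff, h.symm.infix_iff]
  have h1 := hl h
  have h2 := hl h.symm
  by_cases hv : v = s
  · subst hv
    have h3 := (h.succ_iff w).1 hvw
    have h4 := h.head_ne
    rcases h3 with h3 | h3
    · refine Or.inl ⟨Or.inl ⟨rfl, h3⟩, ?_⟩
      rintro (⟨_, h5⟩ | h5)
      · exact h4 (h3.trans h5.symm)
      · exact h2 h5.1
    · refine Or.inr ⟨Or.inl ⟨rfl, h3⟩, ?_⟩
      rintro (⟨_, h5⟩ | h5)
      · exact h4 (h5.trans h3.symm)
      · exact h1 h5.1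
  · have h3 : ¬ (v ∈ l₁ ∧ v ∈ l₂) := fun h' =>
      h.forced₁.not_rel_last h.last₁ w (h.inter v h'.1 h'.2 ▸ hvw)
    have h4 := hR v w hvw
    unfold Xor
    tauto

/-- Uniqueness of boundaries. Only the two arrows out of `s` are tested: a chain through one of them
must start at `s`, since nothing leads to `s`, so no chain contains both. One arrow then lies on `p`
and the other on `q`, and everything after them is forced. -/
theorem IsBigon.eq_or_eq_of_xor {s t₁ t₂ z : V} {l₁ l₂ p q : List V} (h : IsBigon R s l₁ l₂ z)
    (hs : ∀ v, ¬ R v s) (h₁ : l₁.head? = some t₁) (h₂ : l₂.head? = some t₂)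
    (cp : p.IsChain R) (cq : q.IsChain R) (hpq : p.getLast? = q.getLast?)
    (x₁ : Xor ([s, t₁] <:+: p) ([s, t₁] <:+: q)) (x₂ : Xor ([s, t₂] <:+: p) ([s, t₂] <:+: q)) :
    (p = s :: l₁ ∧ q = s :: l₂) ∨ (p = s :: l₂ ∧ q = s :: l₁) := by
  have start : ∀ {p : List V} {t : V}, p.IsChain R → ([s, t] <:+: p ↔ [s, t] <+: p) := by
    intro p t cp
    refine ⟨?_, fun h => h.isInfix⟩
    rintro ⟨a, b, rfl⟩
    rcases List.eq_nil_or_concat a with rfl | ⟨a', x, rfl⟩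
    · exact ⟨b, by simp⟩
    · have : (a' ++ x :: s :: t :: b).IsChain R := by simpa using cp
      exact absurd (List.isChain_cons_cons.1 (List.isChain_append.1 this).2.1).1 (hs x)
  have hne : t₁ ≠ t₂ := by
    rintro rfl
    exact h.head_ne (h₁.trans h₂.symm)
  have both : ∀ {p : List V}, [s, t₁] <+: p → [s, t₂] <+: p → False := by
    rintro p ⟨a, rfl⟩ ⟨b, hb⟩
    simp only [List.cons_append, List.nil_append, List.cons.injEq] at hb
    exact hne hb.2.1.symm
  rw [start cp, start cq] at x₁ x₂
  rcases x₁ with ⟨a, _⟩ | ⟨a, _⟩ <;> rcases x₂ with ⟨b, _⟩ | ⟨b, _⟩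
  · exact (both a b).elim
  · exact Or.inl (h.eq_of_prefix h₁ h₂ a b cp cq hpq)
  · exact Or.inr (h.eq_of_prefix h₁ h₂ a b cq cp hpq.symm).symm
  · exact (both a b).elim

end Bigon

/-- `x`, `y`, `z` are the three elements of `X`. -/
structure IsTriple {α : Type*} [DecidableEq α] (X : Finset α) (x y z : α) : Prop where
  ne₁₂ : x ≠ y
  ne₁₃ : x ≠ z
  ne₂₃ : y ≠ z
  eq : X = {x, y, z}

namespace IsTriple

variable {α : Type*} [DecidableEq α] {X : Finset α} {x y z : α}

theorem swap₁₂ (h : IsTriple X x y z) : IsTriple X y x z :=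
  ⟨h.ne₁₂.symm, h.ne₂₃, h.ne₁₃, by rw [h.eq, Finset.insert_comm]⟩

theorem swap₂₃ (h : IsTriple X x y z) : IsTriple X x z y :=
  ⟨h.ne₁₃, h.ne₁₂, h.ne₂₃.symm, by rw [h.eq, Finset.pair_comm]⟩

theorem mem₁ (h : IsTriple X x y z) : x ∈ X := by simp [h.eq]

theorem mem₂ (h : IsTriple X x y z) : y ∈ X := h.swap₁₂.mem₁

theorem mem₃ (h : IsTriple X x y z) : z ∈ X := h.swap₂₃.mem₂

theorem card_eq (h : IsTriple X x y z) : X.card = 3 :=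
  Finset.card_eq_three.2 ⟨x, y, z, h.ne₁₂, h.ne₁₃, h.ne₂₃, h.eq⟩

theorem exists_lt {α : Type*} [LinearOrder α] {X : Finset α} (hX : X.card = 3) :
    ∃ a b c, IsTriple X a b c ∧ a < b ∧ b < c := by
  obtain ⟨x, y, z, h₁, h₂, h₃, rfl⟩ := Finset.card_eq_three.1 hX
  have h : IsTriple {x, y, z} x y z := ⟨h₁, h₂, h₃, rfl⟩
  rcases h₁.lt_or_gt with a | a <;> rcases h₂.lt_or_gt with b | b <;>
    rcases h₃.lt_or_gt with c | c
  · exact ⟨_, _, _, h, a, c⟩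
  · exact ⟨_, _, _, h.swap₂₃, b, c⟩
  · exact absurd (a.trans c) b.asymm
  · exact ⟨_, _, _, h.swap₂₃.swap₁₂, b, a⟩
  · exact ⟨_, _, _, h.swap₁₂, a, b⟩
  · exact absurd (b.trans c) a.asymm
  · exact ⟨_, _, _, h.swap₁₂.swap₂₃, c, b⟩
  · exact ⟨_, _, _, h.swap₂₃.swap₁₂.swap₂₃, c, a⟩

end IsTriple

/-! ### The polygon of three-letter words -/

section Paths

variable {α : Type*} {V : Type*}

open Classical in
/-- The path along which the greatest letter `c` is moved to the front first. -/
noncomputable def upperPath (v : α → α → α → V) (conn : α → α → α → Prop) (a b c : α) : List V :=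
  (if conn a b c then [v a c b] else []) ++ (if conn c a b then [v c a b] else []) ++ [v c b a]

open Classical in
/-- The path along which the middle letter `b` is moved to the front first. -/
noncomputable def lowerPath (v : α → α → α → V) (conn : α → α → α → Prop) (a b c : α) : List V :=
  (if conn b a c then [v b a c] else []) ++ [v b c a] ++ [v c b a]

theorem upperPath_head_of_conn {v : α → α → α → V} {conn : α → α → α → Prop} {a b c : α}
    (k : conn a b c) : (upperPath v conn a b c).head? = some (v a c b) := by
  simp [upperPath, k]

variable [LinearOrder α]

/-- The graph `R` on the values of `v` at the orderings of `X` is the one of the adjacent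
transpositions, where the last two letters commute unless they are connected. -/
structure IsFlipGraph (X : Finset α) (v : α → α → α → V) (conn : α → α → α → Prop)
    (R : V → V → Prop) : Prop where
  comm : ∀ {x y z}, IsTriple X x y z → conn x y z → conn x z y
  swap : ∀ {x y z}, IsTriple X x y z → ¬ conn x y z → v x y z = v x z y
  root : ∀ {x y z x' y' z'}, IsTriple X x y z → IsTriple X x' y' z' → v x y z = v x' y' z' →
    x = x'
  rel_iff : ∀ {x y z}, IsTriple X x y z → ∀ t, R (v x y z) t ↔ (x < y ∧ t = v y x z) ∨
    (x < z ∧ ¬ conn x y z ∧ t = v z x y) ∨ (y < z ∧ conn x y z ∧ t = v x z y)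

variable {X : Finset α} {v : α → α → α → V} {conn : α → α → α → Prop} {R : V → V → Prop}
  {a b c : α}

theorem IsFlipGraph.upperPath_head (h : IsFlipGraph X v conn R) (t : IsTriple X a b c)
    (k : ¬ conn a b c) : (upperPath v conn a b c).head? = some (v c a b) := by
  have s := h.swap t.swap₂₃.swap₁₂
  by_cases k' : conn c a b <;> simp [upperPath, k, k', s]

theorem IsFlipGraph.lowerPath_head (h : IsFlipGraph X v conn R) (t : IsTriple X a b c) :
    (lowerPath v conn a b c).head? = some (v b a c) := by
  have s := h.swap t.swap₁₂
  by_cases k' : conn b a c <;> simp [lowerPath, k', s]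

/-- The facts `e1`–`e6` list the successors of each word. A word left out of a path coincides, by
`swap`, with its neighbour there, so the paths stay forced in every case. They meet only at `cba`,
because before their end the words have root `a` or `c` on one path and root `b` on the other. -/
theorem IsFlipGraph.isBigon (h : IsFlipGraph X v conn R) (t : IsTriple X a b c) (hab : a < b)
    (hbc : b < c) :
    IsBigon R (v a b c) (upperPath v conn a b c) (lowerPath v conn a b c) (v c b a) := by
  have hac := hab.trans hbc
  have nba := hab.asymm
  have ncb := hbc.asymm
  have nca := hac.asymm
  have s3 := h.swap t.swap₂₃.swap₁₂
  have ne : ∀ {x y z x' y' z'}, IsTriple X x y z → IsTriple X x' y' z' → x ≠ x' →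
      v x y z ≠ v x' y' z' := fun h1 h2 h3 h4 => h3 (h.root h1 h2 h4)
  have e1 : ∀ u, R (v a b c) u ↔ u = v b a c ∨ (¬ conn a b c ∧ u = v c a b) ∨
      (conn a b c ∧ u = v a c b) := fun u => by
    simp only [h.rel_iff t, hab, hac, hbc, true_and]
  have e2 : conn a b c → ∀ u, R (v a c b) u ↔ u = v c a b := fun k u => by
    simp only [h.rel_iff t.swap₂₃, hac, hab, ncb, h.comm t k, true_and, not_true, false_and,
      or_false, and_false]
  have e3 : conn c a b → ∀ u, R (v c a b) u ↔ u = v c b a := fun k u => by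
    simp only [h.rel_iff t.swap₂₃.swap₁₂, nca, ncb, hab, k, true_and, false_and, false_or]
  have e4 : ∀ u, ¬ R (v c b a) u := fun u => by
    simp only [h.rel_iff t.swap₂₃.swap₁₂.swap₂₃, nca, ncb, nba, false_and, false_or,
      not_false_eq_true]
  have e5 : conn b a c → ∀ u, R (v b a c) u ↔ u = v b c a := fun k u => by
    simp only [h.rel_iff t.swap₁₂, nba, hac, k, true_and, not_true, false_and, false_or,
      and_false]
  have e6 : ∀ u, R (v b c a) u ↔ u = v c b a := fun u => by
    simp only [h.rel_iff t.swap₁₂.swap₂₃, nba, nca, hbc, true_and, false_and, or_false]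
  have d1 := ne t.swap₂₃ t.swap₁₂ t.ne₁₂
  have d2 := ne t.swap₂₃ t.swap₁₂.swap₂₃ t.ne₁₂
  have d4 := ne t.swap₂₃.swap₁₂ t.swap₁₂ t.ne₂₃.symm
  have d5 := ne t.swap₂₃.swap₁₂ t.swap₁₂.swap₂₃ t.ne₂₃.symm
  constructor
  · by_cases k1 : conn a b c <;> by_cases k3 : conn c a b <;>
      simp [upperPath, k1, k3, IsForced, e2, e3, e4, s3]
  · by_cases k2 : conn b a c <;> simp [lowerPath, k2, IsForced, e4, e5, e6]
  · intro u
    rw [e1, h.lowerPath_head t]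
    by_cases k1 : conn a b c
    · simp only [k1, upperPath_head_of_conn, Option.some.injEq, @eq_comm _ u, or_comm, not_true,
        false_and, true_and, false_or]
    · simp only [k1, h.upperPath_head t k1, Option.some.injEq, @eq_comm _ u, or_comm,
        not_false_eq_true, false_and, true_and, false_or]
  · rw [h.lowerPath_head t]
    by_cases k1 : conn a b c
    · rw [upperPath_head_of_conn k1]
      exact fun k => d1 (Option.some.inj k)
    · rw [h.upperPath_head t k1]
      exact fun k => d4 (Option.some.inj k)
  · simp [upperPath]
  · simp [lowerPath]
  · intro u hu hu'
    have hu₁ : u = v a c b ∨ u = v c a b ∨ u = v c b a := by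
      simp only [upperPath, List.mem_append, List.mem_singleton, List.mem_ite_nil_right] at hu
      exact or_assoc.1 (hu.imp_left (Or.imp And.right And.right))
    have hu₂ : u = v b a c ∨ u = v b c a ∨ u = v c b a := by
      simp only [lowerPath, List.mem_append, List.mem_singleton, List.mem_ite_nil_right] at hu'
      exact or_assoc.1 (hu'.imp_left (Or.imp_left And.right))
    rcases hu₁ with rfl | rfl | rfl
    · rcases hu₂ with k | k | k
      exacts [(d1 k).elim, (d2 k).elim, k]
    · rcases hu₂ with k | k | k
      exacts [(d4 k).elim, (d5 k).elim, k]
    · rfl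

theorem IsFlipGraph.mem_path (h : IsFlipGraph X v conn R) (t : IsTriple X a b c)
    {x y z : α} (t' : IsTriple X x y z) :
    v x y z = v a b c ∨ v x y z ∈ upperPath v conn a b c ∨ v x y z ∈ lowerPath v conn a b c := by
  have s1 := h.swap t
  have s2 := h.swap t.swap₁₂
  have s3 := h.swap t.swap₂₃.swap₁₂
  have hx := t.eq ▸ t'.mem₁
  have hy := t.eq ▸ t'.mem₂
  have hz := t.eq ▸ t'.mem₃
  have h1 := t'.ne₁₂
  have h2 := t'.ne₁₃
  have h3 := t'.ne₂₃
  simp only [Finset.mem_insert, Finset.mem_singleton] at hx hy hz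
  simp only [upperPath, lowerPath]
  rcases hx with rfl | rfl | rfl <;> rcases hy with rfl | rfl | rfl <;>
    rcases hz with rfl | rfl | rfl <;> first | contradiction | grind

/-- An arrow always moves a greater letter in front of a smaller one, which the increasing word
cannot have as its result. The hypothesis `hne` excludes that `abc` and `acb` name the same vertex
although `b` and `c` are connected. -/
theorem IsFlipGraph.not_rel_source (h : IsFlipGraph X v conn R) (t : IsTriple X a b c)
    (hab : a < b) (hbc : b < c) (hne : conn a b c → v a b c ≠ v a c b) {x y z : α}
    (t' : IsTriple X x y z) : ¬ R (v x y z) (v a b c) := by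
  intro hR
  have hx := t.eq ▸ t'.mem₁
  have hy := t.eq ▸ t'.mem₂
  have hz := t.eq ▸ t'.mem₃
  have h1 := t'.ne₁₂
  have h2 := t'.ne₁₃
  have h3 := t'.ne₂₃
  simp only [Finset.mem_insert, Finset.mem_singleton] at hx hy hz
  rcases (h.rel_iff t' _).1 hR with ⟨l, e⟩ | ⟨l, _, e⟩ | ⟨l, k, e⟩
  · obtain rfl := h.root t t'.swap₁₂ e
    grind
  · obtain rfl := h.root t t'.swap₂₃.swap₁₂ e
    grind
  · obtain rfl := h.root t t'.swap₂₃ e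
    grind

end Paths

end Nestohedra

/-! ### Composition and comparison of substitutions -/

namespace TermRewriting

variable {Sg : Signature.{u}}

theorem Term.subst_subst (σ τ : Subst Sg) : ∀ {a : Sg.S} (t : Term Sg a),
    (t.subst σ).subst τ = t.subst (fun v => (σ v).subst τ)
  | _, .var _ => rfl
  | _, .app f ts => by
    simp only [Term.subst]
    exact congrArg _ (funext fun i => (ts i).subst_subst σ τ)

theorem Term.subst_congr_iff {σ τ : Subst Sg} : ∀ {a : Sg.S} {t : Term Sg a},
    t.subst σ = t.subst τ ↔ ∀ v ∈ t.vars, σ v = τ v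
  | _, .var v => by simp [Term.subst, Term.vars]
  | _, .app f ts => by
    simp only [Term.subst, Term.vars, Set.mem_iUnion, Term.app.injEq,
      funext_iff, Term.subst_congr_iff]
    exact ⟨fun h v ⟨i, hi⟩ => h i v hi, fun h i v hi => h v ⟨i, hi⟩⟩

end TermRewriting

namespace Nestohedra

variable {α : Type u} [LinearOrder α] {H : AtomicHypergraph α}

/-! ## Connected components -/

namespace AtomicHypergraph

theorem subset_of_mem_comps {D C : Finset α} (h : C ∈ H.comps D) : C ⊆ D := (H.mem_comps.1 h).1

theorem nonempty_of_mem_comps {D C : Finset α} (h : C ∈ H.comps D) : C.Nonempty :=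
  ((H.isConn_iff C).1 (H.isConn_of_mem_comps h)).2.1

theorem subset_comps {D C Z : Finset α} (h : C ∈ H.comps D) (hZ : H.IsConn Z) (hZD : Z ⊆ D)
    (hZC : (Z ∩ C).Nonempty) : Z ⊆ C := by
  rw [mem_comps] at h
  have := h.2.2 (Z ∪ C) (Finset.union_subset hZD h.1) (hZ.union H h.2.1 hZC)
    Finset.subset_union_right
  rw [← this]
  exact Finset.subset_union_left

theorem comps_eq_of_mem {D C C' : Finset α} (h : C ∈ H.comps D) (h' : C' ∈ H.comps D) {x : α}
    (hx : x ∈ C) (hx' : x ∈ C') : C = C' :=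
  Finset.Subset.antisymm
    (subset_comps h' (H.isConn_of_mem_comps h) (subset_of_mem_comps h)
      ⟨x, Finset.mem_inter.2 ⟨hx, hx'⟩⟩)
    (subset_comps h (H.isConn_of_mem_comps h') (subset_of_mem_comps h')
      ⟨x, Finset.mem_inter.2 ⟨hx', hx⟩⟩)

theorem exists_mem_comps {D : Finset α} {x : α} (hx : x ∈ D) (hD : D ⊆ H.verts) :
    ∃ C ∈ H.comps D, x ∈ C := by
  obtain ⟨C, hC, h⟩ := H.exists_comps (H.isConn_singleton (hD hx))
    (Finset.singleton_subset_iff.2 hx)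
  exact ⟨C, hC, Finset.singleton_subset_iff.1 h⟩

theorem notMem_of_mem_comps {D C : Finset α} {x : α} (h : C ∈ H.comps (D \ {x})) : x ∉ C :=
  fun hx => by simpa using subset_of_mem_comps h hx

theorem subset_of_mem_comps_sdiff {D C B : Finset α} (h : C ∈ H.comps (D \ B)) : C ⊆ D :=
  (subset_of_mem_comps h).trans Finset.sdiff_subset

end AtomicHypergraph

open AtomicHypergraph

/-- The component at an argument place of `(x, K)`, as a sort. -/
abbrev sortOf {D : Finset α} (C : H.comps D) : ConnSet H := ⟨C.1, H.isConn_of_mem_comps C.2⟩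

theorem ConnSet.exists_comp (K : ConnSet H) {x y : α} (hy : y ∈ K.1) (hxy : x ≠ y) :
    ∃ C : H.comps (K.1 \ {x}), y ∈ C.1 := by
  obtain ⟨C, hC, h⟩ := exists_mem_comps (H := H) (D := K.1 \ {x}) (x := y)
    (by simp [hy, hxy.symm]) (Finset.sdiff_subset.trans K.2.1)
  exact ⟨⟨C, hC⟩, h⟩

theorem comp_eq {D : Finset α} {C C' : H.comps D} {x : α} (hx : x ∈ C.1) (hx' : x ∈ C'.1) :
    C = C' :=
  Subtype.ext (comps_eq_of_mem C.2 C'.2 hx hx')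

/-! ## Terms over the constructions signature -/

theorem CTerm.eq_cvar_or_capp (K : ConnSet H) (t : CTerm H K) : t = cvar K ∨
    ∃ x hx ts, t = capp x K hx ts := by
  match K, t with
  | _, .var v => exact Or.inl rfl
  | _, .app f ts => exact Or.inr ⟨f.x, f.mem, ts, rfl⟩

theorem capp_inj {K : ConnSet H} {x : α} {hx : x ∈ K.1}
    {ts us : ∀ C : H.comps (K.1 \ {x}), CTerm H (sortOf C)} :
    capp x K hx ts = capp x K hx us ↔ ts = us := by
  constructor
  · intro h
    exact Term.app.inj h
  · rintro rfl
    rfl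

/-- The vertex in the root symbol of a term. -/
def rootLabel : ∀ {K : ConnSet H}, CTerm H K → Option α
  | _, .var _ => none
  | _, .app f _ => some f.x

theorem capp_root {K : ConnSet H} {x y : α} {hx : x ∈ K.1} {hy : y ∈ K.1}
    {ts : ∀ C : H.comps (K.1 \ {x}), CTerm H (sortOf C)}
    {us : ∀ C : H.comps (K.1 \ {y}), CTerm H (sortOf C)}
    (h : capp x K hx ts = capp y K hy us) : x = y := by
  exact Option.some.inj (congrArg rootLabel h)

theorem capp_ne_cvar {K : ConnSet H} {x : α} {hx : x ∈ K.1}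
    {ts : ∀ C : H.comps (K.1 \ {x}), CTerm H (sortOf C)} : capp x K hx ts ≠ cvar K := by
  intro h
  have : Term.IsVar (capp x K hx ts) := h ▸ trivial
  exact this

theorem subst_capp {K : ConnSet H} {x : α} {hx : x ∈ K.1}
    {ts : ∀ C : H.comps (K.1 \ {x}), CTerm H (sortOf C)} (σ : Subst (constructionsSig H)) :
    (capp x K hx ts).subst σ = capp x K hx fun C => (ts C).subst σ := rfl

theorem subst_cvar (K : ConnSet H) (σ : Subst (constructionsSig H)) :
    (cvar K).subst σ = σ K := rfl

theorem eq_cvar_of_isVar {K : ConnSet H} {t : CTerm H K} (h : t.IsVar) : t = cvar K := by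
  rcases CTerm.eq_cvar_or_capp K t with h' | ⟨x, hx, ts, rfl⟩
  · exact h'
  · exact h.elim

/-- The term obtained by making the first letter of the word that lies in `K` the root, and going
on with the rest of the word in the connected components. -/
noncomputable def wordTerm : List α → ∀ K : ConnSet H, CTerm H K
  | [], K => cvar K
  | x :: w, K =>
      if hx : x ∈ K.1 then capp x K hx fun C => wordTerm w (sortOf C) else wordTerm w K

theorem wordTerm_cons {x : α} {w : List α} {K : ConnSet H} (hx : x ∈ K.1) :
    wordTerm (x :: w) K = capp x K hx fun C => wordTerm w (sortOf C) := dif_pos hx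

theorem wordTerm_cons_of_notMem {x : α} {w : List α} {K : ConnSet H} (hx : x ∉ K.1) :
    wordTerm (x :: w) K = wordTerm w K := dif_neg hx

theorem pairTerm_eq_wordTerm (K : ConnSet H) (x y : α) (hx : x ∈ K.1) :
    pairTerm K x y hx = wordTerm [x, y] K := by
  rw [wordTerm_cons hx]
  refine capp_inj.2 (funext fun C => ?_)
  by_cases hy : y ∈ C.1
  · rw [dif_pos hy, wordTerm_cons hy]
    rfl
  · rw [dif_neg hy, wordTerm_cons_of_notMem hy]
    rfl

/-- Each sort has exactly one variable, so `wordTerm w'` is itself a substitution: it continues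
every variable with the letters of `w'`. -/
theorem subst_wordTerm (w w' : List α) (K : ConnSet H) :
    (wordTerm w K).subst (wordTerm w') = wordTerm (w ++ w') K := by
  induction w generalizing K with
  | nil => rfl
  | cons x w ih =>
    rw [List.cons_append]
    by_cases hx : x ∈ K.1
    · rw [wordTerm_cons hx, wordTerm_cons hx, subst_capp]
      exact capp_inj.2 (funext fun C => ih _)
    · rw [wordTerm_cons_of_notMem hx, wordTerm_cons_of_notMem hx, ih]

theorem wordTerm_root {x x' : α} {w w' : List α} {K : ConnSet H} (hx : x ∈ K.1) (hx' : x' ∈ K.1)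
    (h : wordTerm (x :: w) K = wordTerm (x' :: w') K) : x = x' := by
  rw [wordTerm_cons hx, wordTerm_cons hx'] at h
  exact capp_root h

theorem vars_wordTerm_pair {K : ConnSet H} {x y : α} (hx : x ∈ K.1) :
    Term.vars (wordTerm [x, y] K) = {U : ConnSet H | U.1 ∈ H.comps (K.1 \ {x, y})} := by
  rw [← pairTerm_eq_wordTerm K x y hx, vars_pairTerm]

/-- A letter outside `K` is skipped in `K` and in all components inside `K`, so its place in the
word is irrelevant. -/
theorem wordTerm_swap {w : List α} {K : ConnSet H} {y z : α} (h : ¬ (y ∈ K.1 ∧ z ∈ K.1)) :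
    wordTerm (y :: z :: w) K = wordTerm (z :: y :: w) K := by
  by_cases hy : y ∈ K.1 <;> by_cases hz : z ∈ K.1
  · exact absurd ⟨hy, hz⟩ h
  · rw [wordTerm_cons hy, wordTerm_cons_of_notMem hz, wordTerm_cons hy]
    refine capp_inj.2 (funext fun C => ?_)
    rw [wordTerm_cons_of_notMem fun h => hz (subset_of_mem_comps_sdiff C.2 h)]
  · rw [wordTerm_cons_of_notMem hy, wordTerm_cons hz, wordTerm_cons hz]
    refine capp_inj.2 (funext fun C => ?_)
    rw [wordTerm_cons_of_notMem fun h => hy (subset_of_mem_comps_sdiff C.2 h)]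
  · rw [wordTerm_cons_of_notMem hy, wordTerm_cons_of_notMem hz, wordTerm_cons_of_notMem hz,
      wordTerm_cons_of_notMem hy]

/-- `y` and `z` lie in the same connected component of `H_K \ x`. -/
def Joined (K : ConnSet H) (x y z : α) : Prop := ∃ C : H.comps (K.1 \ {x}), y ∈ C.1 ∧ z ∈ C.1

theorem wordTerm_swap_of_not_joined {w : List α} {K : ConnSet H} {x y z : α} (hx : x ∈ K.1)
    (h : ¬ Joined K x y z) : wordTerm (x :: y :: z :: w) K = wordTerm (x :: z :: y :: w) K := by
  rw [wordTerm_cons hx, wordTerm_cons hx]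
  exact capp_inj.2 (funext fun C => wordTerm_swap fun h' => h ⟨C, h'⟩)

/-- The vertices that occur in the function symbols of a term. -/
def labels : ∀ {K : ConnSet H}, CTerm H K → Set α
  | _, .var _ => ∅
  | _, .app f ts => {f.x} ∪ ⋃ C, labels (ts C)

theorem labels_capp {K : ConnSet H} {x : α} {hx : x ∈ K.1}
    {ts : ∀ C : H.comps (K.1 \ {x}), CTerm H (sortOf C)} :
    labels (capp x K hx ts) = {x} ∪ ⋃ C, labels (ts C) := rfl

theorem labels_cvar (K : ConnSet H) : labels (cvar K) = ∅ := rfl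

/-- Structural induction phrased with `cvar` and `capp`, with the sort kept as a free index. -/
theorem CTerm.induct {P : ∀ K : ConnSet H, CTerm H K → Prop} (var : ∀ K, P K (cvar K))
    (app : ∀ x K hx ts, (∀ C, P (sortOf C) (ts C)) → P K (capp x K hx ts)) :
    ∀ K t, P K t
  | _, .var v => var v
  | _, .app f ts => app f.x f.Y f.mem ts fun C => CTerm.induct var app _ (ts C)

theorem mem_labels_capp {K : ConnSet H} {x y : α} {hx : x ∈ K.1}
    {ts : ∀ C : H.comps (K.1 \ {x}), CTerm H (sortOf C)} :
    y ∈ labels (capp x K hx ts) ↔ y = x ∨ ∃ C, y ∈ labels (ts C) := by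
  simp [labels_capp]

theorem labels_subset (K : ConnSet H) (t : CTerm H K) : labels t ⊆ K.1 := by
  refine CTerm.induct (P := fun K t => labels t ⊆ K.1) ?_ ?_ K t
  · intro K
    simp [labels_cvar]
  · intro x K hx ts ih y hy
    rcases mem_labels_capp.1 hy with rfl | ⟨C, hC⟩
    · exact hx
    · exact subset_of_mem_comps_sdiff C.2 (ih C hC)

/-- Different argument places carry disjoint components, and the vertex of a symbol is removed from
all sorts below it. -/
theorem notMem_labels_of_mem_vars (K : ConnSet H) (t : CTerm H K) (U : ConnSet H)
    (hU : U ∈ t.vars) : U.1 ⊆ K.1 ∧ ∀ y ∈ U.1, y ∉ labels t := by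
  revert hU
  refine CTerm.induct (P := fun K t => U ∈ t.vars → U.1 ⊆ K.1 ∧ ∀ y ∈ U.1, y ∉ labels t)
    ?_ ?_ K t
  · rintro K rfl
    simp [labels_cvar]
  · intro x K hx ts ih hU
    rw [vars_capp, Set.mem_iUnion] at hU
    obtain ⟨C, hC⟩ := hU
    obtain ⟨h1, h2⟩ := ih C hC
    refine ⟨h1.trans (subset_of_mem_comps_sdiff C.2), fun y hy hy' => ?_⟩
    rcases mem_labels_capp.1 hy' with rfl | ⟨C', hC'⟩
    · exact notMem_of_mem_comps C.2 (h1 hy)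
    · obtain rfl := comp_eq (h1 hy) (labels_subset _ _ hC')
      exact h2 y hy hC'

theorem mem_labels_subst (σ : Subst (constructionsSig H)) (K : ConnSet H) (t : CTerm H K) (y : α) :
    y ∈ labels (t.subst σ : CTerm H K) ↔ y ∈ labels t ∨ ∃ U : ConnSet H, U ∈ t.vars ∧
      y ∈ labels (σ U : CTerm H U) := by
  refine CTerm.induct (P := fun K t => y ∈ labels (t.subst σ : CTerm H K) ↔ y ∈ labels t ∨
    ∃ U : ConnSet H, U ∈ t.vars ∧ y ∈ labels (σ U : CTerm H U)) ?_ ?_ K t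
  · intro K
    simp only [labels_cvar, vars_cvar, Set.mem_empty_iff_false, false_or, subst_cvar,
      Set.mem_singleton_iff, exists_eq_left]
  · intro x K hx ts ih
    rw [subst_capp, mem_labels_capp, mem_labels_capp, vars_capp]
    simp only [ih, Set.mem_iUnion]
    constructor
    · rintro (h | ⟨C, h | ⟨U, h1, h2⟩⟩)
      exacts [Or.inl (Or.inl h), Or.inl (Or.inr ⟨C, h⟩), Or.inr ⟨U, ⟨C, h1⟩, h2⟩]
    · rintro ((h | ⟨C, h⟩) | ⟨U, ⟨C, h1⟩, h2⟩)
      exacts [Or.inl h, Or.inr ⟨C, Or.inl h⟩, Or.inr ⟨C, Or.inr ⟨U, h1, h2⟩⟩]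

theorem mem_labels_wordTerm {w : List α} {K : ConnSet H} {y : α} :
    y ∈ labels (wordTerm w K) ↔ y ∈ w ∧ y ∈ K.1 := by
  induction w generalizing K with
  | nil => simp [wordTerm, labels_cvar]
  | cons x w ih =>
    by_cases hx : x ∈ K.1
    · rw [wordTerm_cons hx, mem_labels_capp]
      simp only [ih, List.mem_cons]
      constructor
      · rintro (rfl | ⟨C, h1, h2⟩)
        · exact ⟨Or.inl rfl, hx⟩
        · exact ⟨Or.inr h1, subset_of_mem_comps_sdiff C.2 h2⟩
      · rintro ⟨rfl | h1, h2⟩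
        · exact Or.inl rfl
        · by_cases hxy : x = y
          · exact Or.inl hxy.symm
          · obtain ⟨C, hC⟩ := K.exists_comp h2 hxy
            exact Or.inr ⟨C, h1, hC⟩
    · rw [wordTerm_cons_of_notMem hx, ih, List.mem_cons]
      refine and_congr_left fun hy => ⟨Or.inr, ?_⟩
      rintro (rfl | h)
      exacts [absurd hy hx, h]

/-! ## Rewriting steps -/

theorem rule_iff {K : ConnSet H} {l r : CTerm H K} : (constructionsTRS H).Rule l r ↔
    ∃ x y, x ∈ K.1 ∧ y ∈ K.1 ∧ x < y ∧ l = wordTerm [x, y] K ∧ r = wordTerm [y, x] K := by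
  constructor
  · rintro ⟨x, y, hx, hy, h⟩
    exact ⟨x, y, hx, hy, h, pairTerm_eq_wordTerm _ _ _ hx, pairTerm_eq_wordTerm _ _ _ hy⟩
  · rintro ⟨x, y, hx, hy, h, rfl, rfl⟩
    rw [← pairTerm_eq_wordTerm _ _ _ hx, ← pairTerm_eq_wordTerm _ _ _ hy]
    exact CRule.flip K x y hx hy h

/-- The context `(x, K)(…, C, …)` with the hole in the context `C` at one of the arguments. -/
def cctx {a : ConnSet H} (x : α) (K : ConnSet H) (hx : x ∈ K.1) (C : H.comps (K.1 \ {x}))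
    (ts : ∀ E : H.comps (K.1 \ {x}), E ≠ C → CTerm H (sortOf E))
    (D : Context (constructionsSig H) a (sortOf C)) : Context (constructionsSig H) a K :=
  Context.app (Sg := constructionsSig H) ⟨x, K, hx⟩ C ts D

/-- The argument place `C` of the symbol `(x, K)`. -/
def place (x : α) (K : ConnSet H) (hx : x ∈ K.1) (C : H.comps (K.1 \ {x})) :
    Σ f : (constructionsSig H).F, (constructionsSig H).Pos f := ⟨⟨x, K, hx⟩, C⟩

theorem context_cases {a : ConnSet H} (K : ConnSet H) (D : Context (constructionsSig H) a K) :
    (∃ h : a = K, D = h ▸ Context.hole) ∨ ∃ x hx C ts D', D = cctx x K hx C ts D' := by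
  match K, D with
  | _, .hole => exact Or.inl ⟨rfl, rfl⟩
  | _, .app f C ts D => exact Or.inr ⟨f.x, f.mem, C, ts, D, rfl⟩

/-- The same family `us` serves every filling `t`, so that the source and the target of a step
visibly differ only at the argument `C`. -/
theorem exists_fill_cctx {a : ConnSet H} {x : α} {K : ConnSet H} {hx : x ∈ K.1}
    {C : H.comps (K.1 \ {x})} {ts : ∀ E : H.comps (K.1 \ {x}), E ≠ C → CTerm H (sortOf E)}
    {D : Context (constructionsSig H) a (sortOf C)} (s : CTerm H a) :
    ∃ us : ∀ E : H.comps (K.1 \ {x}), CTerm H (sortOf E), us C = D.fill s ∧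
      ∀ t : CTerm H a, (cctx x K hx C ts D).fill t =
        capp x K hx (Function.update us C (D.fill t)) := by
  refine ⟨fun E => if h : E = C then h ▸ D.fill s else ts E h, by simp, fun t => ?_⟩
  rw [cctx, Context.fill]
  refine capp_inj.2 (funext fun E => ?_)
  by_cases h : E = C
  · subst h
    simp
  · simp [h]

theorem fill_cctx_self {a : ConnSet H} {x : α} {K : ConnSet H} {hx : x ∈ K.1}
    {C : H.comps (K.1 \ {x})} (ts : ∀ E : H.comps (K.1 \ {x}), CTerm H (sortOf E))
    {D : Context (constructionsSig H) a (sortOf C)} (t : CTerm H a) :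
    (cctx x K hx C (fun E _ => ts E) D).fill t =
      capp x K hx (Function.update ts C (D.fill t)) := by
  rw [cctx, Context.fill]
  refine capp_inj.2 (funext fun E => ?_)
  by_cases h : E = C
  · subst h
    simp
  · simp [h]

theorem not_step_cvar {K : ConnSet H} {t : CTerm H K} :
    ¬ (constructionsTRS H).Step (cvar K) t := by
  rintro ⟨⟨a, l, r, rule, D, σ, hs, -⟩⟩
  rcases context_cases _ D with ⟨rfl, rfl⟩ | ⟨x, hx, C, ts, D', rfl⟩
  · obtain ⟨x, y, hx, -, -, rfl, -⟩ := rule_iff.1 rule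
    have h : cvar a = (wordTerm [x, y] a).subst σ := hs
    rw [wordTerm_cons hx, subst_capp] at h
    exact capp_ne_cvar h.symm
  · obtain ⟨us, -, h⟩ := exists_fill_cctx (ts := ts) (D := D') (l.subst σ)
    exact capp_ne_cvar ((h _).symm.trans hs.symm)

/-- The alternatives correspond to an empty and a non-empty context. -/
theorem step_capp_iff {K : ConnSet H} {x : α} {hx : x ∈ K.1}
    {ts : ∀ C : H.comps (K.1 \ {x}), CTerm H (sortOf C)} {t : CTerm H K} :
    (constructionsTRS H).Step (capp x K hx ts) t ↔
      (∃ y ∈ K.1, ∃ σ, x < y ∧ capp x K hx ts = (wordTerm [x, y] K).subst σ ∧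
        t = (wordTerm [y, x] K).subst σ) ∨
      ∃ C u, (constructionsTRS H).Step (ts C) u ∧ t = capp x K hx (Function.update ts C u) := by
  constructor
  · rintro ⟨⟨a, l, r, rule, D, σ, hs, ht⟩⟩
    rcases context_cases _ D with ⟨rfl, rfl⟩ | ⟨x', hx', C, us, D', rfl⟩
    · obtain ⟨x', y, hx', hy, hxy, rfl, rfl⟩ := rule_iff.1 rule
      have h : capp x a hx ts = (wordTerm [x', y] a).subst σ := hs
      obtain rfl : x = x' := by
        rw [wordTerm_cons hx', subst_capp] at h
        exact capp_root h
      exact Or.inl ⟨y, hy, σ, hxy, h, ht⟩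
    · obtain ⟨vs, h1, h⟩ := exists_fill_cctx (hx := hx') (ts := us) (D := D') (l.subst σ)
      have hs := hs.trans (h _)
      have ht := ht.trans (h _)
      obtain rfl := capp_root hs
      obtain rfl := capp_inj.1 hs
      refine Or.inr ⟨C, _, ?_, ht.trans (by rw [Function.update_idem])⟩
      rw [Function.update_self]
      exact ⟨⟨a, l, r, rule, D', σ, rfl, rfl⟩⟩
  · rintro (⟨y, hy, σ, hxy, hs, ht⟩ | ⟨C, u, ⟨⟨a, l, r, rule, D, σ, hs, ht⟩⟩, rfl⟩)
    · exact ⟨⟨K, _, _, rule_iff.2 ⟨x, y, hx, hy, hxy, rfl, rfl⟩, .hole, σ, hs, ht⟩⟩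
    · refine ⟨⟨a, l, r, rule, cctx x K hx C (fun E _ => ts E) D, σ, ?_, ?_⟩⟩
      · rw [fill_cctx_self, ← hs, Function.update_eq_self]
      · rw [fill_cctx_self, ← ht]

theorem subst_wordTerm_pair {K : ConnSet H} {x y : α} (hx : x ∈ K.1)
    (σ : Subst (constructionsSig H)) : ((wordTerm [x, y] K).subst σ : CTerm H K) =
      capp x K hx fun C => (wordTerm [y] (sortOf C)).subst σ := by
  rw [wordTerm_cons hx, subst_capp]

/-- Both sides of a rule have the same variables, the components of `K \ {x, y}`. Hence the source
of a root step and the rule determine its target, whatever the substitution does elsewhere. -/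
theorem subst_wordTerm_swap {K : ConnSet H} {x y : α} (hx : x ∈ K.1) (hy : y ∈ K.1)
    {σ τ : Subst (constructionsSig H)}
    (h : ((wordTerm [x, y] K).subst σ : CTerm H K) = (wordTerm [x, y] K).subst τ) :
    ((wordTerm [y, x] K).subst σ : CTerm H K) = (wordTerm [y, x] K).subst τ := by
  rw [Term.subst_congr_iff, vars_wordTerm_pair hx] at h
  rw [Term.subst_congr_iff, vars_wordTerm_pair hy, Finset.pair_comm]
  exact h

theorem rootLabel_wordTerm_cons {K : ConnSet H} {x : α} {w : List α} (hx : x ∈ K.1) :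
    rootLabel (wordTerm (x :: w) K) = some x := by
  rw [wordTerm_cons hx]
  rfl

/-- Identifies the rule used in a root step: its second vertex can be read off the arguments of the
source. -/
theorem rootLabel_of_root {K : ConnSet H} {x y : α} {hx : x ∈ K.1} (hy : y ∈ K.1) (hxy : x ≠ y)
    {ts : ∀ C : H.comps (K.1 \ {x}), CTerm H (sortOf C)} {σ : Subst (constructionsSig H)}
    (h : capp x K hx ts = (wordTerm [x, y] K).subst σ) :
    ∃ C : H.comps (K.1 \ {x}), y ∈ C.1 ∧ rootLabel (ts C) = some y := by
  obtain ⟨C, hC⟩ := K.exists_comp hy hxy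
  refine ⟨C, hC, ?_⟩
  rw [subst_wordTerm_pair hx, capp_inj] at h
  rw [h]
  change rootLabel (Term.subst σ (wordTerm [y] (sortOf C))) = some y
  rw [wordTerm_cons (K := sortOf C) hC]
  rfl

theorem not_step_wordTerm_single {K : ConnSet H} {x : α} {t : CTerm H K} :
    ¬ (constructionsTRS H).Step (wordTerm [x] K) t := by
  by_cases hx : x ∈ K.1
  · rw [wordTerm_cons hx, step_capp_iff]
    rintro (⟨y, hy, σ, hxy, h, -⟩ | ⟨C, u, h, -⟩)
    · obtain ⟨C, -, hC⟩ := rootLabel_of_root hy hxy.ne h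
      cases hC
    · exact not_step_cvar h
  · rw [wordTerm_cons_of_notMem hx]
    exact not_step_cvar

theorem step_wordTerm_pair {K : ConnSet H} {x y : α} {t : CTerm H K}
    (h : (constructionsTRS H).Step (wordTerm [x, y] K) t) :
    x ∈ K.1 ∧ y ∈ K.1 ∧ x < y ∧ t = wordTerm [y, x] K := by
  by_cases hx : x ∈ K.1
  · by_cases hy : y ∈ K.1
    · refine ⟨hx, hy, ?_⟩
      rw [wordTerm_cons hx, step_capp_iff] at h
      rcases h with ⟨z, hz, σ, hxz, h, rfl⟩ | ⟨C, u, h, -⟩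
      · obtain ⟨C, h1, h2⟩ := rootLabel_of_root hz hxz.ne h
        obtain rfl : y = z := by
          by_cases hC : y ∈ C.1
          · rw [rootLabel_wordTerm_cons (K := sortOf C) hC] at h2
            exact Option.some.inj h2
          · rw [wordTerm_cons_of_notMem (K := sortOf C) hC] at h2
            cases h2
        refine ⟨hxz, ?_⟩
        have := subst_wordTerm (H := H) [y, x] [] K
        rw [List.append_nil] at this
        refine Eq.trans ?_ this
        refine subst_wordTerm_swap hx hy ?_
        rw [← h, subst_wordTerm, List.append_nil, wordTerm_cons hx]
      · exact (not_step_wordTerm_single h).elim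
    · rw [wordTerm_swap fun h => hy h.2, wordTerm_cons_of_notMem hy] at h
      exact (not_step_wordTerm_single h).elim
  · rw [wordTerm_cons_of_notMem hx] at h
    exact (not_step_wordTerm_single h).elim

/-- Outside the component of `y` the exchange of `y` and `z` is invisible. -/
theorem wordTerm_swap_eq_update {K : ConnSet H} {x y z : α} {w : List α} (hx : x ∈ K.1)
    {C : H.comps (K.1 \ {x})} (hy : y ∈ C.1) :
    wordTerm (x :: z :: y :: w) K = capp x K hx (Function.update
      (fun C => wordTerm (y :: z :: w) (sortOf C)) C (wordTerm (z :: y :: w) (sortOf C))) := by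
  rw [wordTerm_cons hx]
  refine capp_inj.2 (funext fun E => ?_)
  by_cases h : E = C
  · subst h
    rw [Function.update_self]
  · rw [Function.update_of_ne h]
    exact wordTerm_swap fun h' => h (comp_eq h'.2 hy)

/-- A root step exchanges `x` with a son. The son `y` is always present, and `z` is a son as well
exactly when it is not joined to `y`. A step below the root needs two vertices in one component, so
it exchanges joined `y` and `z`. -/
theorem step_wordTerm_triple {K : ConnSet H} {x y z : α} (hx : x ∈ K.1) (hy : y ∈ K.1)
    (hz : z ∈ K.1) {t : CTerm H K} :
    (constructionsTRS H).Step (wordTerm [x, y, z] K) t ↔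
      (x < y ∧ t = wordTerm [y, x, z] K) ∨
      (x < z ∧ ¬ Joined K x y z ∧ t = wordTerm [z, x, y] K) ∨
      (y < z ∧ Joined K x y z ∧ t = wordTerm [x, z, y] K) := by
  have root : ∀ {y z : α}, y ∈ K.1 → x < y → (constructionsTRS H).Step (wordTerm [x, y, z] K)
      (wordTerm [y, x, z] K) := by
    intro y z hy hxy
    rw [wordTerm_cons hx, step_capp_iff]
    refine Or.inl ⟨y, hy, wordTerm [z], hxy, ?_, ?_⟩
    · rw [← wordTerm_cons hx, subst_wordTerm]
      rfl
    · rw [subst_wordTerm]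
      rfl
  have target : ∀ {y z : α} {σ : Subst (constructionsSig H)}, y ∈ K.1 →
      wordTerm [x, y, z] K = (wordTerm [x, y] K).subst σ →
      (wordTerm [y, x] K).subst σ = wordTerm [y, x, z] K := by
    intro y z σ hy h
    have := subst_wordTerm (H := H) [y, x] [z] K
    rw [List.cons_append, List.cons_append, List.nil_append] at this
    rw [← this]
    refine subst_wordTerm_swap hx hy ?_
    rw [← h, subst_wordTerm]
    rfl
  constructor
  · intro h
    rw [wordTerm_cons hx, step_capp_iff, ← wordTerm_cons hx] at h
    rcases h with ⟨y', hy', σ, hxy', h, rfl⟩ | ⟨C, u, h, rfl⟩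
    · have h' := h
      rw [wordTerm_cons hx] at h'
      obtain ⟨C, h1, h2⟩ := rootLabel_of_root hy' hxy'.ne h'
      by_cases hC : y ∈ C.1
      · rw [rootLabel_wordTerm_cons (K := sortOf C) hC] at h2
        obtain rfl := Option.some.inj h2
        exact Or.inl ⟨hxy', target hy h⟩
      · rw [wordTerm_cons_of_notMem (K := sortOf C) hC] at h2
        by_cases hzC : z ∈ C.1
        · rw [rootLabel_wordTerm_cons (K := sortOf C) hzC] at h2
          obtain rfl := Option.some.inj h2
          have hj : ¬ Joined K x y z := by
            rintro ⟨C', h3, h4⟩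
            obtain rfl := comp_eq h4 h1
            exact hC h3
          rw [wordTerm_swap_of_not_joined hx hj] at h
          exact Or.inr (Or.inl ⟨hxy', hj, target hz h⟩)
        · rw [wordTerm_cons_of_notMem (K := sortOf C) hzC] at h2
          cases h2
    · obtain ⟨h1, h2, h3, rfl⟩ := step_wordTerm_pair h
      refine Or.inr (Or.inr ⟨h3, ⟨C, h1, h2⟩, ?_⟩)
      rw [wordTerm_swap_eq_update hx h1]
  · rintro (⟨h, rfl⟩ | ⟨h, hj, rfl⟩ | ⟨h, ⟨C, h1, h2⟩, rfl⟩)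
    · exact root hy h
    · rw [wordTerm_swap_of_not_joined hx hj]
      exact root hz h
    · rw [wordTerm_cons hx, step_capp_iff]
      refine Or.inr ⟨C, _, ?_, wordTerm_swap_eq_update hx h1⟩
      have : (constructionsTRS H).Step (wordTerm [y, z] (sortOf C)) (wordTerm [z, y] (sortOf C)) :=
        ⟨⟨sortOf C, _, _, rule_iff.2 ⟨y, z, h1, h2, h, rfl, rfl⟩, .hole, wordTerm [], by
          rw [subst_wordTerm]; rfl, by rw [subst_wordTerm]; rfl⟩⟩
      exact this

theorem isFlipGraph_wordTerm {Y : ConnSet H} {X : Finset α} (hXY : X ⊆ Y.1) :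
    IsFlipGraph X (fun x y z => wordTerm [x, y, z] Y) (Joined Y)
      (constructionsTRS H).Step where
  comm := fun _ ⟨C, h₁, h₂⟩ => ⟨C, h₂, h₁⟩
  swap t h := wordTerm_swap_of_not_joined (hXY t.mem₁) h
  root t t' h := wordTerm_root (hXY t.mem₁) (hXY t'.mem₁) h
  rel_iff t _ := step_wordTerm_triple (hXY t.mem₁) (hXY t.mem₂) (hXY t.mem₃)

/-! ## Critical pairs -/

theorem exists_labels_of_step (K : ConnSet H) (s : CTerm H K) :
    ∀ t, (constructionsTRS H).Step s t → ∃ y ∈ labels s, ∃ z ∈ labels s, y ≠ z := by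
  refine CTerm.induct (P := fun K s => ∀ t, (constructionsTRS H).Step s t →
    ∃ y ∈ labels s, ∃ z ∈ labels s, y ≠ z) ?_ ?_ K s
  · exact fun K t h => (not_step_cvar h).elim
  · intro x K hx ts ih t h
    rcases step_capp_iff.1 h with ⟨y, hy, σ, hxy, h, -⟩ | ⟨C, u, h, -⟩
    · refine ⟨x, mem_labels_capp.2 (Or.inl rfl), y, ?_, hxy.ne⟩
      rw [h, mem_labels_subst, mem_labels_wordTerm]
      exact Or.inl ⟨by simp, hy⟩
    · obtain ⟨y, hy, z, hz, hyz⟩ := ih C u h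
      exact ⟨y, mem_labels_capp.2 (Or.inr ⟨C, hy⟩), z, mem_labels_capp.2 (Or.inr ⟨C, hz⟩), hyz⟩

/-- A step inside an argument uses two vertices different from the root. Two root steps with
different targets exchange the root with different vertices, by `subst_wordTerm_swap`. -/
theorem exists_labels_of_steps {K : ConnSet H} {s t₁ t₂ : CTerm H K}
    (h₁ : (constructionsTRS H).Step s t₁) (h₂ : (constructionsTRS H).Step s t₂) (h : t₁ ≠ t₂) :
    ∃ x ∈ labels s, ∃ y ∈ labels s, ∃ z ∈ labels s, x ≠ y ∧ x ≠ z ∧ y ≠ z := by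
  rcases CTerm.eq_cvar_or_capp K s with rfl | ⟨x, hx, ts, rfl⟩
  · exact (not_step_cvar h₁).elim
  · have sub : ∀ C u, (constructionsTRS H).Step (ts C) u → ∃ x' ∈ labels (capp x K hx ts),
        ∃ y ∈ labels (capp x K hx ts), ∃ z ∈ labels (capp x K hx ts),
          x' ≠ y ∧ x' ≠ z ∧ y ≠ z := by
      intro C u h
      obtain ⟨y, hy, z, hz, hyz⟩ := exists_labels_of_step _ _ u h
      refine ⟨x, mem_labels_capp.2 (Or.inl rfl), y, mem_labels_capp.2 (Or.inr ⟨C, hy⟩), z,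
        mem_labels_capp.2 (Or.inr ⟨C, hz⟩), ?_, ?_, hyz⟩
      · rintro rfl
        exact notMem_of_mem_comps C.2 (labels_subset _ _ hy)
      · rintro rfl
        exact notMem_of_mem_comps C.2 (labels_subset _ _ hz)
    rcases step_capp_iff.1 h₁ with ⟨y, hy, σ, hxy, hs, rfl⟩ | ⟨C, u, h', -⟩
    · rcases step_capp_iff.1 h₂ with ⟨z, hz, τ, hxz, hs', rfl⟩ | ⟨C, u, h', -⟩
      · refine ⟨x, mem_labels_capp.2 (Or.inl rfl), y, ?_, z, ?_, hxy.ne, hxz.ne, ?_⟩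
        · rw [hs, mem_labels_subst, mem_labels_wordTerm]
          exact Or.inl ⟨by simp, hy⟩
        · rw [hs', mem_labels_subst, mem_labels_wordTerm]
          exact Or.inl ⟨by simp, hz⟩
        · rintro rfl
          exact h (subst_wordTerm_swap hx hy (hs.symm.trans hs'))
      · exact sub C u h'
    · exact sub C u h'

/-- Injectivity is automatic, because a variable is determined by its sort. -/
theorem isRenamingOn_of_isVar {σ : Subst (constructionsSig H)} {W : Set (ConnSet H)}
    (h : ∀ U ∈ W, (σ U).IsVar) : σ.IsRenamingOn W :=
  ⟨h, fun _ _ _ _ h => congrArg Sigma.fst h⟩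

/-- A non-trivial context would preserve the root symbol. If both steps come from `s'` by a
substitution, `s'` already has three vertices and thus all those of `s`. A value of the substitution
that is not a variable would contribute a vertex disjoint from these. -/
theorem isCriticalPair_of_labels {K : ConnSet H} {s t₁ t₂ : CTerm H K}
    {o₁ : (constructionsTRS H).Redex s t₁} {o₂ : (constructionsTRS H).Redex s t₂}
    (ho : o₁.Overlaps o₂) (hr : rootLabel s ≠ rootLabel t₁) (hne : t₁ ≠ t₂) {X : Finset α}
    (hX : X.card ≤ 3) (hs : labels s ⊆ X) : (constructionsTRS H).IsCriticalPair s t₁ t₂ := by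
  refine ⟨⟨o₁, o₂, ho⟩, ?_, ?_⟩
  · rintro ⟨a, D, s', t₁', t₂', hD, -, -, rfl, rfl, -⟩
    rcases context_cases _ D with ⟨rfl, rfl⟩ | ⟨x, hx, C, ts, D', rfl⟩
    · exact hD rfl
    · exact hr rfl
  · rintro ⟨σ, s', t₁', t₂', hσ, h₁, h₂, rfl, rfl, rfl⟩
    obtain ⟨x, hx, y, hy, z, hz, hxy, hxz, hyz⟩ :=
      exists_labels_of_steps h₁ h₂ fun h => hne (by rw [h])
    have hsub : labels s' ⊆ labels (s'.subst σ : CTerm H K) := fun u hu =>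
      (mem_labels_subst σ K s' u).2 (Or.inl hu)
    have hX' : ({x, y, z} : Finset α) = X := by
      refine Finset.eq_of_subset_of_card_le ?_ ?_
      · intro u hu
        simp only [Finset.mem_insert, Finset.mem_singleton] at hu
        rcases hu with rfl | rfl | rfl
        exacts [hs (hsub hx), hs (hsub hy), hs (hsub hz)]
      · rw [Finset.card_eq_three.2 ⟨x, y, z, hxy, hxz, hyz, rfl⟩]
        exact hX
    refine hσ (isRenamingOn_of_isVar fun U hU => ?_)
    rcases CTerm.eq_cvar_or_capp U (σ U) with h | ⟨v, hv, ts, h⟩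
    · rw [h]
      exact trivial
    · refine ((notMem_labels_of_mem_vars K s' U hU).2 v hv ?_).elim
      have : v ∈ X := hs ((mem_labels_subst σ K s' v).2 (Or.inr ⟨U, hU, by
        rw [h, mem_labels_capp]; exact Or.inl rfl⟩))
      rw [← hX'] at this
      simp only [Finset.mem_insert, Finset.mem_singleton] at this
      rcases this with rfl | rfl | rfl
      exacts [hx, hy, hz]

end Nestohedra

/-! ### Classification of the critical pairs -/

namespace TermRewriting

variable {Sg : Signature.{u}}

theorem TRS.IsCriticalPair.symm {R : TRS Sg} {b : Sg.S} {s t₁ t₂ : Term Sg b}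
    (h : R.IsCriticalPair s t₁ t₂) : R.IsCriticalPair s t₂ t₁ := by
  obtain ⟨⟨o₁, o₂, h₁, h₂⟩, h₃, h₄⟩ := h
  refine ⟨⟨o₂, o₁, Set.inter_comm _ _ ▸ h₁, fun h => h₂ ⟨h.1.symm, h.2.symm⟩⟩, ?_, ?_⟩
  · rintro ⟨a, C, s', t₁', t₂', h, k₁, k₂, e, e₁, e₂⟩
    exact h₃ ⟨a, C, s', t₂', t₁', h, k₂, k₁, e, e₂, e₁⟩
  · rintro ⟨σ, s', t₁', t₂', h, k₁, k₂, e, e₁, e₂⟩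
    exact h₄ ⟨σ, s', t₂', t₁', h, k₂, k₁, e, e₂, e₁⟩

theorem Term.subst_var : ∀ {a : Sg.S} (t : Term Sg a), t.subst Term.var = t
  | _, .var _ => rfl
  | _, .app f ts => by
    simp only [Term.subst]
    exact congrArg _ (funext fun i => (ts i).subst_var)

end TermRewriting

namespace Nestohedra

variable {α : Type u} [LinearOrder α] {H : AtomicHypergraph α}

open AtomicHypergraph

theorem nil_mem_symbolPos {K : ConnSet H} {x : α} {w : List α} (hx : x ∈ K.1) :
    [] ∈ (wordTerm (x :: w) K).symbolPos := by
  rw [wordTerm_cons hx]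
  exact Or.inl rfl

theorem mem_symbolPos_wordTerm_pair {K : ConnSet H} {x y : α} (hx : x ∈ K.1)
    {q : List (Σ f : (constructionsSig H).F, (constructionsSig H).Pos f)} :
    q ∈ (wordTerm [x, y] K).symbolPos ↔ q = [] ∨ ∃ C, y ∈ C.1 ∧ q = [place x K hx C] := by
  have h : q ∈ (wordTerm [x, y] K).symbolPos ↔ q = [] ∨ ∃ C : H.comps (K.1 \ {x}),
      ∃ q' ∈ (wordTerm [y] (sortOf C)).symbolPos, q = place x K hx C :: q' := by
    rw [wordTerm_cons hx]
    exact Iff.rfl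
  have h' : ∀ (C : H.comps (K.1 \ {x})) q', q' ∈ (wordTerm [y] (sortOf C)).symbolPos ↔
      y ∈ C.1 ∧ q' = [] := by
    intro C q'
    by_cases hy : y ∈ C.1
    · rw [wordTerm_cons (K := sortOf C) hy]
      constructor
      · rintro (rfl | ⟨E, q, hq, -⟩)
        · exact ⟨hy, rfl⟩
        · exact hq.elim
      · rintro ⟨-, rfl⟩
        exact Or.inl rfl
    · rw [wordTerm_cons_of_notMem (K := sortOf C) hy]
      exact ⟨fun h => h.elim, fun h => (hy h.1).elim⟩
  rw [h]
  simp only [h']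
  refine or_congr_right ⟨?_, ?_⟩
  · rintro ⟨C, _, ⟨hy, rfl⟩, rfl⟩
    exact ⟨C, hy, rfl⟩
  · rintro ⟨C, hy, rfl⟩
    exact ⟨C, _, ⟨hy, rfl⟩, rfl⟩

theorem labels_wordTerm_subset {K : ConnSet H} (x y z : α) :
    labels (wordTerm [x, y, z] K) ⊆ ({x, y, z} : Finset α) := by
  intro u hu
  simpa using (mem_labels_wordTerm.1 hu).1

/-- The instance of a rule in the empty context. -/
noncomputable def rootRedex {K : ConnSet H} {x y : α} (hx : x ∈ K.1) (hy : y ∈ K.1) (h : x < y)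
    {w : List α} {s : CTerm H K} (hs : s = wordTerm (x :: y :: w) K) :
    (constructionsTRS H).Redex s (wordTerm (y :: x :: w) K) where
  a := K
  l := wordTerm [x, y] K
  r := wordTerm [y, x] K
  rule := rule_iff.2 ⟨x, y, hx, hy, h, rfl, rfl⟩
  C := .hole
  σ := wordTerm w
  source_eq := hs.trans (subst_wordTerm [x, y] w K).symm
  target_eq := (subst_wordTerm [y, x] w K).symm

/-- The instance of a rule in a context with a single symbol. -/
noncomputable def childRedex {K : ConnSet H} {x y z : α} (hx : x ∈ K.1) {C : H.comps (K.1 \ {x})}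
    (hy : y ∈ C.1) (hz : z ∈ C.1) (h : y < z) (w : List α) :
    (constructionsTRS H).Redex (wordTerm (x :: y :: z :: w) K) (wordTerm (x :: z :: y :: w) K) where
  a := sortOf C
  l := wordTerm [y, z] (sortOf C)
  r := wordTerm [z, y] (sortOf C)
  rule := rule_iff.2 ⟨y, z, hy, hz, h, rfl, rfl⟩
  C := cctx x K hx C (fun E _ => wordTerm (y :: z :: w) (sortOf E)) .hole
  σ := wordTerm w
  source_eq := by
    rw [fill_cctx_self (ts := fun E => wordTerm (y :: z :: w) (sortOf E)), wordTerm_cons hx,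
      Context.fill, subst_wordTerm]
    exact capp_inj.2 (Function.update_eq_self (C : H.comps (K.1 \ {x}))
      (fun E => wordTerm (y :: z :: w) (sortOf E))).symm
  target_eq := by
    rw [fill_cctx_self (ts := fun E => wordTerm (y :: z :: w) (sortOf E)), Context.fill,
      subst_wordTerm, wordTerm_swap_eq_update hx hy]
    rfl

theorem isCriticalPair_of_not_joined {K : ConnSet H} {a b c : α} (ha : a ∈ K.1) (hb : b ∈ K.1)
    (hc : c ∈ K.1) (hab : a < b) (hac : a < c) (hbc : b ≠ c) (h : ¬ Joined K a b c) :
    (constructionsTRS H).IsCriticalPair (wordTerm [a, b, c] K) (wordTerm [b, a, c] K)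
      (wordTerm [c, a, b] K) := by
  have hs := wordTerm_swap_of_not_joined (w := []) ha h
  suffices ∃ o : (constructionsTRS H).Redex (wordTerm [a, b, c] K) (wordTerm [c, a, b] K),
      (rootRedex ha hb hab (w := [c]) rfl).Overlaps o by
    obtain ⟨o, ho⟩ := this
    refine isCriticalPair_of_labels ho ?_ ?_ Finset.card_le_three (labels_wordTerm_subset a b c)
    · rw [rootLabel_wordTerm_cons ha, rootLabel_wordTerm_cons hb]
      exact fun h => hab.ne (Option.some.inj h)
    · exact fun h => hbc (wordTerm_root hb hc h)
  refine ⟨rootRedex ha hc hac hs,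
    ⟨[], ⟨[], nil_mem_symbolPos ha, rfl⟩, ⟨[], nil_mem_symbolPos ha, rfl⟩⟩, ?_⟩
  -- Both redexes sit at the root, so the rules must be told apart: the left side for `a`, `b` does
  -- not contain `c`.
  rintro ⟨-, h⟩
  have h' : wordTerm [a, b] K = wordTerm [a, c] K :=
    congrArg Prod.fst (eq_of_heq (Sigma.mk.inj h).2)
  have : c ∈ labels (wordTerm [a, b] K) := by
    rw [h', mem_labels_wordTerm]
    exact ⟨by simp, hc⟩
  have := (mem_labels_wordTerm.1 this).1
  simp [hac.ne', hbc.symm] at this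

theorem isCriticalPair_of_joined {K : ConnSet H} {a b c : α} (ha : a ∈ K.1) (hb : b ∈ K.1)
    (hab : a < b) (hbc : b < c) (h : Joined K a b c) :
    (constructionsTRS H).IsCriticalPair (wordTerm [a, b, c] K) (wordTerm [b, a, c] K)
      (wordTerm [a, c, b] K) := by
  obtain ⟨C, h₁, h₂⟩ := h
  have ho : (rootRedex ha hb hab rfl).Overlaps (childRedex ha h₁ h₂ hbc []) := by
    refine ⟨⟨[place a K ha C], ⟨_, ?_, rfl⟩, ⟨[], nil_mem_symbolPos (K := sortOf C) h₁, rfl⟩⟩, ?_⟩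
    · exact (mem_symbolPos_wordTerm_pair ha).2 (Or.inr ⟨C, h₁, rfl⟩)
    · rintro ⟨h, -⟩
      cases h
  refine isCriticalPair_of_labels ho ?_ ?_ Finset.card_le_three (labels_wordTerm_subset a b c)
  · rw [rootLabel_wordTerm_cons ha, rootLabel_wordTerm_cons hb]
    exact fun h => hab.ne (Option.some.inj h)
  · exact fun h => hab.ne' (wordTerm_root hb ha h)

/-- In contrast to `step_capp_iff` this keeps track of the matched positions, which decide whether
two redexes overlap. -/
theorem redex_cases {K : ConnSet H} {s t : CTerm H K} (o : (constructionsTRS H).Redex s t) :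
    (∃ x y σ, ∃ hx : x ∈ K.1, y ∈ K.1 ∧ x < y ∧ s = (wordTerm [x, y] K).subst σ ∧
      t = (wordTerm [y, x] K).subst σ ∧ o.C.holePos = [] ∧
      (⟨o.a, o.l, o.r⟩ : Σ a : ConnSet H, CTerm H a × CTerm H a) =
        ⟨K, wordTerm [x, y] K, wordTerm [y, x] K⟩ ∧
      ∀ q ∈ o.pattern, q = [] ∨ ∃ C, y ∈ C.1 ∧ q = [place x K hx C]) ∨
    (∃ x hx C ts u, ∃ o' : (constructionsTRS H).Redex (ts C) u, s = capp x K hx ts ∧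
      t = capp x K hx (Function.update ts C u) ∧
      ∀ q ∈ o.pattern, ∃ q' ∈ o'.pattern, q = place x K hx C :: q') := by
  obtain ⟨a, l, r, rule, D, σ, hs, ht⟩ := o
  rcases context_cases _ D with ⟨rfl, rfl⟩ | ⟨x, hx, C, us, D', rfl⟩
  · obtain ⟨x, y, hx, hy, hxy, rfl, rfl⟩ := rule_iff.1 rule
    refine Or.inl ⟨x, y, σ, hx, hy, hxy, hs, ht, rfl, rfl, ?_⟩
    rintro _ ⟨q, hq, rfl⟩
    exact (mem_symbolPos_wordTerm_pair hx).1 hq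
  · obtain ⟨vs, h1, h⟩ := exists_fill_cctx (hx := hx) (ts := us) (D := D') (l.subst σ)
    refine Or.inr ⟨x, hx, C, Function.update vs C (D'.fill (l.subst σ)), D'.fill (r.subst σ),
      ⟨a, l, r, rule, D', σ, ?_, rfl⟩, hs.trans (h _), ?_, ?_⟩
    · exact Function.update_self _ _ _
    · rw [Function.update_idem]
      exact ht.trans (h _)
    · rintro _ ⟨q, hq, rfl⟩
      exact ⟨_, ⟨q, hq, rfl⟩, rfl⟩

/-- Moves the symbol `z` at the root of `σ U` from the substitution into the pattern. The new
substitution has the arguments of `σ U` as its values on the components of `U \ z`, and agrees with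
`σ` elsewhere. -/
theorem exists_subst_triple {K U : ConnSet H} {x y z : α} {σ : Subst (constructionsSig H)}
    (hx : x ∈ K.1) (hU : U ∈ Term.vars (wordTerm [x, y] K)) (hz : z ∈ U.1)
    (h : rootLabel (σ U : CTerm H U) = some z) :
    ∃ τ : Subst (constructionsSig H), ((wordTerm [x, y] K).subst σ : CTerm H K) =
      (wordTerm [x, y, z] K).subst τ := by
  rcases CTerm.eq_cvar_or_capp U (σ U) with h' | ⟨z', hz', ws, h'⟩
  · rw [h'] at h
    cases h
  obtain rfl : z' = z := by
    rw [h'] at h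
    exact Option.some.inj h
  classical
  let τ : Subst (constructionsSig H) := fun V =>
    if hV : V.1 ∈ H.comps (U.1 \ {z'}) then ws ⟨V.1, hV⟩ else σ V
  refine ⟨τ, ?_⟩
  rw [show [x, y, z'] = [x, y] ++ [z'] from rfl, ← subst_wordTerm, Term.subst_subst,
    Term.subst_congr_iff]
  intro V hV
  by_cases hVU : V = U
  · subst hVU
    rw [wordTerm_cons hz, subst_capp]
    refine h'.trans (capp_inj.2 (funext fun E => ?_))
    exact (dif_pos E.2 : τ (sortOf E) = ws E).symm
  · rw [vars_wordTerm_pair hx] at hU hV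
    have hd : ∀ u ∈ V.1, u ∉ U.1 := fun u h₁ h₂ =>
      hVU (Subtype.ext (comps_eq_of_mem hV hU h₁ h₂))
    rw [wordTerm_cons_of_notMem fun h => hd _ h hz]
    refine (dif_neg fun hV' => ?_ : τ V = σ V).symm
    obtain ⟨u, hu⟩ := nonempty_of_mem_comps hV'
    exact hd u hu (subset_of_mem_comps_sdiff hV' hu)

theorem subst_wordTerm_append {K : ConnSet H} (w w' : List α) (σ : Subst (constructionsSig H)) :
    ((wordTerm (w ++ w') K).subst σ : CTerm H K) =
      (wordTerm w K).subst fun V => (wordTerm w' V).subst σ := by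
  rw [← subst_wordTerm, Term.subst_subst]

theorem subst_wordTerm_triple_swap {K : ConnSet H} {x y z : α} (hx : x ∈ K.1) (hy : y ∈ K.1)
    {σ τ : Subst (constructionsSig H)}
    (h : ((wordTerm [x, y] K).subst σ : CTerm H K) = (wordTerm [x, y, z] K).subst τ) :
    ((wordTerm [y, x] K).subst σ : CTerm H K) = (wordTerm [y, x, z] K).subst τ :=
  (subst_wordTerm_swap hx hy (h.trans (subst_wordTerm_append [x, y] [z] τ))).trans
    (subst_wordTerm_append [y, x] [z] τ).symm

/-- Minimality makes `τ` a renaming, and with one variable per sort a renaming is the identity. -/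
theorem eq_of_isCriticalPair {K : ConnSet H} {x y z : α} {τ : Subst (constructionsSig H)}
    {s t₁ t₂ t₁' t₂' : CTerm H K}
    (h : (constructionsTRS H).IsCriticalPair s t₁ t₂) (hs : s = (wordTerm [x, y, z] K).subst τ)
    (h₁ : (constructionsTRS H).Step (wordTerm [x, y, z] K) t₁')
    (h₂ : (constructionsTRS H).Step (wordTerm [x, y, z] K) t₂')
    (e₁ : t₁ = t₁'.subst τ) (e₂ : t₂ = t₂'.subst τ) :
    s = wordTerm [x, y, z] K ∧ ∀ U ∈ Term.vars (wordTerm [x, y, z] K), τ U = cvar U := by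
  have hτ : ∀ U ∈ Term.vars (wordTerm [x, y, z] K), τ U = cvar U := by
    by_contra hn
    refine h.2.2 ⟨τ, _, t₁', t₂', fun hr => hn fun U hU => ?_, h₁, h₂, hs, e₁, e₂⟩
    exact eq_cvar_of_isVar (hr.1 U hU)
  refine ⟨?_, hτ⟩
  rw [hs]
  exact ((Term.subst_congr_iff (τ := Term.var)).2 hτ).trans (Term.subst_var _)

theorem mem_vars_capp {K U : ConnSet H} {x : α} {hx : x ∈ K.1}
    {ts : ∀ C : H.comps (K.1 \ {x}), CTerm H (sortOf C)} :
    U ∈ Term.vars (capp x K hx ts) ↔ ∃ C, U ∈ Term.vars (ts C) := by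
  rw [vars_capp, Set.mem_iUnion]

/-- If `y` and `z` lay in one component of `K \ x`, both would be the root of the argument there. So
`z` has a component of its own, in which the pattern of the first rule has a variable; `σ` must
begin with `z` on it, and this makes `s` an instance of `xyz`. -/
theorem triple_of_root_root {K : ConnSet H} {x y z : α} {s t₁ t₂ : CTerm H K}
    {σ σ' : Subst (constructionsSig H)} (h : (constructionsTRS H).IsCriticalPair s t₁ t₂)
    (hx : x ∈ K.1) (hy : y ∈ K.1) (hz : z ∈ K.1) (hxy : x < y) (hxz : x < z) (hyz : y ≠ z)
    (hs : s = (wordTerm [x, y] K).subst σ) (hs' : s = (wordTerm [x, z] K).subst σ')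
    (h₁ : t₁ = (wordTerm [y, x] K).subst σ) (h₂ : t₂ = (wordTerm [z, x] K).subst σ') :
    ¬ Joined K x y z ∧ s = wordTerm [x, y, z] K ∧ t₁ = wordTerm [y, x, z] K ∧
      t₂ = wordTerm [z, x, y] K := by
  have e := hs.symm.trans hs'
  rw [subst_wordTerm_pair hx, subst_wordTerm_pair hx, capp_inj] at e
  have root : ∀ {y : α} {σ : Subst (constructionsSig H)} {C : H.comps (K.1 \ {x})}, y ∈ C.1 →
      rootLabel ((wordTerm [y] (sortOf C)).subst σ : CTerm H (sortOf C)) = some y := by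
    intro y σ C hy
    rw [wordTerm_cons (K := sortOf C) hy]
    rfl
  have hj : ¬ Joined K x y z := by
    rintro ⟨C, h₁, h₂⟩
    have := congrArg rootLabel (congrFun e C)
    rw [root h₁, root h₂] at this
    exact hyz (Option.some.inj this)
  obtain ⟨C, hC⟩ := K.exists_comp hz hxz.ne
  have hyC : y ∉ C.1 := fun h => hj ⟨C, h, hC⟩
  have eC := congrFun e C
  rw [wordTerm_cons_of_notMem (K := sortOf C) hyC] at eC
  have hσ : rootLabel (σ (sortOf C) : CTerm H (sortOf C)) = some z :=
    (congrArg rootLabel eC).trans (root hC)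
  have hU : sortOf C ∈ Term.vars (wordTerm [x, y] K) := by
    rw [wordTerm_cons hx]
    refine mem_vars_capp.2 ⟨C, ?_⟩
    rw [wordTerm_cons_of_notMem (K := sortOf C) hyC]
    exact rfl
  obtain ⟨τ, hτ⟩ := exists_subst_triple hx hU hC hσ
  have e₁ := subst_wordTerm_triple_swap hx hy hτ
  have sw := wordTerm_swap_of_not_joined (w := []) hx hj
  have e₂ := subst_wordTerm_triple_swap hx hz
    ((hs'.symm.trans (hs.trans hτ)).trans (congrArg (Term.subst τ) sw))
  have k₁ : (constructionsTRS H).Step (wordTerm [x, y, z] K) (wordTerm [y, x, z] K) :=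
    (step_wordTerm_triple hx hy hz).2 (Or.inl ⟨hxy, rfl⟩)
  have k₂ : (constructionsTRS H).Step (wordTerm [x, y, z] K) (wordTerm [z, x, y] K) :=
    (step_wordTerm_triple hx hy hz).2 (Or.inr (Or.inl ⟨hxz, hj, rfl⟩))
  obtain ⟨f, hv⟩ := eq_of_isCriticalPair h (hs.trans hτ) k₁ k₂ (h₁.trans e₁) (h₂.trans e₂)
  -- Since `τ` fixes `xyz`, it also fixes the two targets, which involve the same variables.
  have g : ((wordTerm [x, y, z] K).subst τ : CTerm H K) =
      (wordTerm [x, y, z] K).subst Term.var := (Term.subst_congr_iff (τ := Term.var)).2 hv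
  have g₁ := subst_wordTerm_triple_swap hx hy ((subst_wordTerm_append [x, y] [z] τ).symm.trans g)
  rw [← subst_wordTerm_append [y, x] [z] τ, Term.subst_var] at g₁
  rw [sw] at g
  have g₂ := subst_wordTerm_triple_swap hx hz ((subst_wordTerm_append [x, z] [y] τ).symm.trans g)
  rw [← subst_wordTerm_append [z, x] [y] τ, Term.subst_var] at g₂
  exact ⟨hj, f, h₁.trans (e₁.trans g₁), h₂.trans (e₂.trans g₂)⟩

theorem subst_wordTerm_triple_swap_child {K : ConnSet H} {x y z : α} (hx : x ∈ K.1)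
    {C : H.comps (K.1 \ {x})} (hy : y ∈ C.1) (hz : z ∈ C.1)
    {ts : ∀ C : H.comps (K.1 \ {x}), CTerm H (sortOf C)} {σ τ : Subst (constructionsSig H)}
    (h : capp x K hx ts = (wordTerm [x, y, z] K).subst τ)
    (hC : ts C = (wordTerm [y, z] (sortOf C)).subst σ) :
    capp x K hx (Function.update ts C ((wordTerm [z, y] (sortOf C)).subst σ)) =
      (wordTerm [x, z, y] K).subst τ := by
  rw [wordTerm_cons hx, subst_capp, capp_inj] at h
  rw [wordTerm_swap_eq_update hx hy, subst_capp]
  refine capp_inj.2 (funext fun E => ?_)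
  by_cases hE : E = C
  · subst hE
    rw [Function.update_self, Function.update_self]
    exact subst_wordTerm_swap (K := sortOf E) hy hz (hC.symm.trans (congrFun h E))
  · rw [Function.update_of_ne hE, Function.update_of_ne hE, h]

/-- The root of the argument at `C` is `y` by the first redex and `y'` by the second. Below it the
second rule prescribes `z`, where the first has only a variable, so `s` is again an instance of
`xyz`. -/
theorem triple_of_root_child {K : ConnSet H} {x y y' z : α} {s t₁ t₂ : CTerm H K}
    {σ σ' : Subst (constructionsSig H)} (h : (constructionsTRS H).IsCriticalPair s t₁ t₂)
    (hx : x ∈ K.1) (hy : y ∈ K.1) (hxy : x < y)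
    (hs : s = (wordTerm [x, y] K).subst σ) (h₁ : t₁ = (wordTerm [y, x] K).subst σ)
    {C : H.comps (K.1 \ {x})} {ts : ∀ C : H.comps (K.1 \ {x}), CTerm H (sortOf C)}
    (hs' : s = capp x K hx ts) (hyC : y ∈ C.1) (hy' : y' ∈ C.1) (hz : z ∈ C.1) (hyz : y' < z)
    (hC : ts C = (wordTerm [y', z] (sortOf C)).subst σ')
    (h₂ : t₂ = capp x K hx (Function.update ts C ((wordTerm [z, y'] (sortOf C)).subst σ'))) :
    y' = y ∧ s = wordTerm [x, y, z] K ∧ t₁ = wordTerm [y, x, z] K ∧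
      t₂ = wordTerm [x, z, y] K := by
  have e := hs'.symm.trans hs
  rw [subst_wordTerm_pair hx, capp_inj] at e
  have eC := hC.symm.trans (congrFun e C)
  rw [subst_wordTerm_pair (K := sortOf C) hy', wordTerm_cons (K := sortOf C) hyC] at eC
  obtain rfl := capp_root eC
  refine ⟨rfl, ?_⟩
  obtain ⟨E, hE⟩ := (sortOf C).exists_comp hz hyz.ne
  have eE := congrFun (capp_inj.1 eC) E
  have hσ : rootLabel (σ (sortOf E) : CTerm H (sortOf E)) = some z := by
    refine (congrArg rootLabel eE).symm.trans ?_
    rw [wordTerm_cons (K := sortOf E) hE]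
    rfl
  have hU : sortOf E ∈ Term.vars (wordTerm [x, y'] K) := by
    rw [wordTerm_cons hx]
    refine mem_vars_capp.2 ⟨C, ?_⟩
    rw [wordTerm_cons (K := sortOf C) hyC]
    exact mem_vars_capp.2 ⟨E, rfl⟩
  obtain ⟨τ, hτ⟩ := exists_subst_triple hx hU hE hσ
  have hzK : z ∈ K.1 := subset_of_mem_comps_sdiff C.2 hz
  have e₁ := subst_wordTerm_triple_swap hx hy hτ
  have e₂ := subst_wordTerm_triple_swap_child hx hyC hz (hs'.symm.trans (hs.trans hτ)) hC
  have k₁ : (constructionsTRS H).Step (wordTerm [x, y', z] K) (wordTerm [y', x, z] K) :=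
    (step_wordTerm_triple hx hy hzK).2 (Or.inl ⟨hxy, rfl⟩)
  have k₂ : (constructionsTRS H).Step (wordTerm [x, y', z] K) (wordTerm [x, z, y'] K) :=
    (step_wordTerm_triple hx hy hzK).2 (Or.inr (Or.inr ⟨hyz, ⟨C, hyC, hz⟩, rfl⟩))
  obtain ⟨f, hv⟩ := eq_of_isCriticalPair h (hs.trans hτ) k₁ k₂ (h₁.trans e₁) (h₂.trans e₂)
  have g : ((wordTerm [x, y', z] K).subst τ : CTerm H K) =
      (wordTerm [x, y', z] K).subst Term.var := (Term.subst_congr_iff (τ := Term.var)).2 hv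
  have g₁ := subst_wordTerm_triple_swap hx hy ((subst_wordTerm_append [x, y'] [z] τ).symm.trans g)
  rw [← subst_wordTerm_append [y', x] [z] τ, Term.subst_var] at g₁
  have g₂ := subst_wordTerm_triple_swap_child hx hyC hz (hs'.symm.trans (f.trans
    (Term.subst_var (Sg := constructionsSig H) (wordTerm [x, y', z] K)).symm)) hC
  rw [Term.subst_var] at g₂
  exact ⟨f, h₁.trans (e₁.trans g₁), h₂.trans g₂⟩

theorem not_isCriticalPair_capp {K : ConnSet H} {x : α} {hx : x ∈ K.1} {C : H.comps (K.1 \ {x})}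
    {ts : ∀ C : H.comps (K.1 \ {x}), CTerm H (sortOf C)} {u₁ u₂ : CTerm H (sortOf C)}
    (h₁ : (constructionsTRS H).Step (ts C) u₁) (h₂ : (constructionsTRS H).Step (ts C) u₂) :
    ¬ (constructionsTRS H).IsCriticalPair (capp x K hx ts)
      (capp x K hx (Function.update ts C u₁)) (capp x K hx (Function.update ts C u₂)) := by
  intro h
  refine h.2.1 ⟨sortOf C, cctx x K hx C (fun E _ => ts E) .hole, ts C, u₁, u₂,
    List.cons_ne_nil _ _, h₁, h₂, ?_, ?_, ?_⟩
  · rw [fill_cctx_self, Context.fill, Function.update_eq_self]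
  · rw [fill_cctx_self, Context.fill]
  · rw [fill_cctx_self, Context.fill]

theorem place_inj {K : ConnSet H} {x : α} {hx : x ∈ K.1} {C C' : H.comps (K.1 \ {x})}
    (h : place x K hx C = place x K hx C') : C = C' :=
  eq_of_heq (Sigma.mk.inj h).2

/-- A root redex matches only the root and the symbol of `y` directly below it. A redex inside an
argument can meet it only in the latter, so it is applied at the root of that argument. -/
theorem triple_of_redexes {K : ConnSet H} {x y : α} {s t₁ t₂ : CTerm H K}
    {σ : Subst (constructionsSig H)} (h : (constructionsTRS H).IsCriticalPair s t₁ t₂)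
    (hx : x ∈ K.1) (hy : y ∈ K.1) (hxy : x < y)
    (hs : s = (wordTerm [x, y] K).subst σ) (h₁ : t₁ = (wordTerm [y, x] K).subst σ)
    {x' : α} {hx' : x' ∈ K.1}
    {C : H.comps (K.1 \ {x'})} {ts : ∀ C : H.comps (K.1 \ {x'}), CTerm H (sortOf C)}
    {u : CTerm H (sortOf C)} (o : (constructionsTRS H).Redex (ts C) u)
    (hs' : s = capp x' K hx' ts) (h₂ : t₂ = capp x' K hx' (Function.update ts C u))
    {q} (hq : q ∈ o.pattern)
    (hp : place x' K hx' C :: q = [] ∨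
      ∃ E : H.comps (K.1 \ {x}), y ∈ E.1 ∧ place x' K hx' C :: q = [place x K hx E]) :
    ∃ z, Joined K x y z ∧ y < z ∧ z ∈ K.1 ∧ s = wordTerm [x, y, z] K ∧
      t₁ = wordTerm [y, x, z] K ∧ t₂ = wordTerm [x, z, y] K := by
  have e := hs'.symm.trans hs
  rw [subst_wordTerm_pair hx] at e
  obtain rfl := capp_root e
  rcases hp with hp | ⟨C', hyC, hp⟩
  · cases hp
  obtain ⟨hp', rfl⟩ := List.cons.inj hp
  obtain rfl := place_inj hp'
  rcases redex_cases o with ⟨y', z, σ', hy', hz, hyz, hC, rfl, -, -, -⟩ |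
    ⟨_, _, _, _, _, _, -, -, hn⟩
  · obtain ⟨rfl, k⟩ := triple_of_root_child h hx hy hxy hs h₁ hs' hyC hy' hz hyz hC h₂
    exact ⟨z, ⟨C, hyC, hz⟩, hyz, subset_of_mem_comps_sdiff C.2 hz, k⟩
  · obtain ⟨_, _, hn⟩ := hn _ hq
    cases hn

/-- The critical pairs are the pairs of steps from the source of a polygon. -/
theorem exists_triple_of_isCriticalPair {K : ConnSet H} {s t₁ t₂ : CTerm H K}
    (h : (constructionsTRS H).IsCriticalPair s t₁ t₂) :
    ∃ a b c u, a ∈ K.1 ∧ b ∈ K.1 ∧ c ∈ K.1 ∧ a < b ∧ b < c ∧ s = wordTerm [a, b, c] K ∧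
      ((Joined K a b c ∧ u = wordTerm [a, c, b] K) ∨
        (¬ Joined K a b c ∧ u = wordTerm [c, a, b] K)) ∧
      ((t₁ = u ∧ t₂ = wordTerm [b, a, c] K) ∨ (t₁ = wordTerm [b, a, c] K ∧ t₂ = u)) := by
  obtain ⟨o₁, o₂, ⟨p, hp₁, hp₂⟩, hne⟩ := h.1
  rcases redex_cases o₁ with ⟨x, y, σ, hx, hy, hxy, hs, h₁, k₁, l₁, m₁⟩ |
      ⟨x, hx, C, ts, u, o₁', hs, h₁, m₁⟩ <;>
    rcases redex_cases o₂ with ⟨x', z, σ', hx', hz, hxz, hs', h₂, k₂, l₂, m₂⟩ |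
      ⟨x', hx', C', ts', u', o₂', hs', h₂, m₂⟩
  · have e := hs.symm.trans hs'
    rw [subst_wordTerm_pair hx, subst_wordTerm_pair hx'] at e
    obtain rfl := capp_root e
    have hyz : y ≠ z := by
      rintro rfl
      exact hne ⟨k₁.trans k₂.symm, l₁.trans l₂.symm⟩
    obtain ⟨hj, r₀, r₁, r₂⟩ := triple_of_root_root h hx hy hz hxy hxz hyz hs hs' h₁ h₂
    rcases hyz.lt_or_gt with hlt | hlt
    · exact ⟨x, y, z, _, hx, hy, hz, hxy, hlt, r₀, Or.inr ⟨hj, rfl⟩, Or.inr ⟨r₁, r₂⟩⟩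
    · rw [wordTerm_swap_of_not_joined hx hj] at r₀
      exact ⟨x, z, y, _, hx, hz, hy, hxz, hlt, r₀,
        Or.inr ⟨fun ⟨C, a, b⟩ => hj ⟨C, b, a⟩, rfl⟩, Or.inl ⟨r₁, r₂⟩⟩
  · obtain ⟨q, hq, rfl⟩ := m₂ p hp₂
    obtain ⟨z, hj, hyz, hz, r₀, r₁, r₂⟩ :=
      triple_of_redexes h hx hy hxy hs h₁ o₂' hs' h₂ hq (m₁ _ hp₁)
    exact ⟨x, y, z, _, hx, hy, hz, hxy, hyz, r₀, Or.inl ⟨hj, rfl⟩, Or.inr ⟨r₁, r₂⟩⟩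
  · obtain ⟨q, hq, rfl⟩ := m₁ p hp₁
    obtain ⟨w, hj, hyz, hw, r₀, r₁, r₂⟩ :=
      triple_of_redexes h.symm hx' hz hxz hs' h₂ o₁' hs h₁ hq (m₂ _ hp₂)
    exact ⟨x', z, w, _, hx', hz, hw, hxz, hyz, r₀, Or.inl ⟨hj, rfl⟩, Or.inl ⟨r₂, r₁⟩⟩
  -- Both redexes lie below the root. A common position puts them into the same argument, and the
  -- root symbol is a context that can be removed.
  · obtain ⟨q, hq, rfl⟩ := m₁ p hp₁
    obtain ⟨q', hq', e⟩ := m₂ _ hp₂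
    obtain rfl := capp_root (hs.symm.trans hs')
    obtain rfl := capp_inj.1 (hs.symm.trans hs')
    obtain rfl := place_inj (List.cons.inj e).1
    rw [hs, h₁, h₂] at h
    exact (not_isCriticalPair_capp ⟨o₁'⟩ ⟨o₂'⟩ h).elim

end Nestohedra

namespace Nestohedra

variable {α : Type u} [LinearOrder α] {L : AtomicHypergraph α}

open AtomicHypergraph

/-! ## Constructs of small sets -/

theorem notMem_comps_self (D C : Finset α) : C ∉ L.comps (D \ D) := by
  rw [L.comps_self_sdiff]
  exact Finset.notMem_empty _

theorem Construct.node_inj {D X : Finset α} {hX : X.Nonempty} {hXD : X ⊆ D}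
    {ts us : ∀ C : L.comps (D \ X), Construct L C.1} :
    Construct.node X hX hXD ts = .node X hX hXD us ↔ ts = us := by
  constructor
  · intro h
    injection h with _ _ h
  · rintro rfl
    rfl

theorem Construction.node_inj {D : Finset α} {x : α} {hx : x ∈ D}
    {ts us : ∀ C : L.comps (D \ {x}), Construction L C.1} :
    Construction.node x hx ts = .node x hx us ↔ ts = us := by
  constructor
  · intro h
    injection h with _ _ h
  · rintro rfl
    rfl

theorem Construct.root_nonempty {D : Finset α} (S : Construct L D) : S.root.Nonempty := by
  cases S
  assumption

theorem Construct.root_subset {D : Finset α} (S : Construct L D) : S.root ⊆ D := by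
  cases S
  assumption

theorem Construct.eq_maxFace_of_root {D : Finset α} (hD : D.Nonempty) {S : Construct L D}
    (h : S.root = D) : S = Construct.maxFace L D hD := by
  cases S with
  | node X hX hXD ts =>
    obtain rfl : X = D := h
    refine Construct.node_inj.2 (funext fun C => ?_)
    exact absurd C.2 (notMem_comps_self _ _)

theorem Construct.eq_of_card_le_one {D : Finset α} (h : D.card ≤ 1) (S T : Construct L D) :
    S = T := by
  have hD : D.Nonempty := S.root_nonempty.mono S.root_subset
  have key : ∀ S : Construct L D, S.root = D := fun S =>
    Finset.eq_of_subset_of_card_le S.root_subset (h.trans S.root_nonempty.card_pos)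
  rw [Construct.eq_maxFace_of_root hD (key S), Construct.eq_maxFace_of_root hD (key T)]

theorem Construction.toConstruct_injective {D : Finset α} (S T : Construction L D)
    (h : S.toConstruct = T.toConstruct) : S = T := by
  induction S with
  | node x hx ts ih =>
    cases T with
    | node y hy us =>
      obtain rfl : x = y := Finset.singleton_injective (congrArg Construct.root h)
      refine Construction.node_inj.2 (funext fun C => ih C _ ?_)
      exact congrFun (Construct.node_inj.1 h) C

theorem Construction.eq_of_card_le_one {D : Finset α} (h : D.card ≤ 1) (S T : Construction L D) :
    S = T :=
  S.toConstruct_injective T (Construct.eq_of_card_le_one h _ _)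

theorem Construct.son_subset {D : Finset α} {S : Construct L D} {A B : Finset α}
    (h : S.Son A B) : B ⊆ D \ S.root := by
  induction S with
  | node X hX hXD ts ih =>
    rcases h with ⟨-, C, rfl⟩ | ⟨C, h⟩
    · exact (ts C).root_subset.trans (subset_of_mem_comps C.2)
    · exact (ih C h).trans (Finset.sdiff_subset.trans (subset_of_mem_comps C.2))

theorem Construct.Covers.two_le_card {D : Finset α} {S T : Construct L D} (h : S.Covers T) :
    2 ≤ D.card := by
  induction h with
  | @contract D X Y Z hX hXD hZ hZD ts us C hY hYC vs hC hZXY h₁ h₂ =>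
    obtain ⟨x, hx⟩ := hX
    obtain ⟨y, hy⟩ := hY
    have hy' := Finset.mem_sdiff.1 (subset_of_mem_comps C.2 (hYC hy))
    refine Finset.one_lt_card.2 ⟨x, hXD hx, y, hy'.1, ?_⟩
    rintro rfl
    exact hy'.2 hx
  | sub C hC h ih => exact ih.trans (Finset.card_le_card (subset_of_mem_comps_sdiff C.2))

/-- For a contraction only the new root is recorded; in small sets the subtrees below it are
determined by their size. -/
theorem Construct.covers_node {D X : Finset α} {hX : X.Nonempty} {hXD : X ⊆ D}
    {ts : ∀ C : L.comps (D \ X), Construct L C.1} {E : Construct L D}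
    (h : (Construct.node X hX hXD ts).Covers E) :
    (∃ C, E.root = X ∪ (ts C).root) ∨
      ∃ C us, (ts C).Covers (us C) ∧ E = .node X hX hXD us := by
  cases h with
  | contract C hC hZXY h₁ h₂ =>
    refine Or.inl ⟨C, ?_⟩
    rw [hC]
    exact hZXY
  | sub C hC h => exact Or.inr ⟨C, _, hC, rfl⟩

/-- The construct with root `Z` and one-node constructs below it. -/
def IsCoatom {D : Finset α} (E : Construct L D) (Z : Finset α) : Prop :=
  ∃ (hZ : Z.Nonempty) (hZD : Z ⊆ D), E = .node Z hZ hZD fun C =>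
    Construct.maxFace L C.1 (nonempty_of_mem_comps C.2)

theorem IsCoatom.root_eq {D Z : Finset α} {E : Construct L D} (h : IsCoatom E Z) : E.root = Z := by
  obtain ⟨_, _, rfl⟩ := h
  rfl

theorem exists_isCoatom {D Z : Finset α} (hZ : Z.Nonempty) (hZD : Z ⊆ D) :
    ∃ E : Construct L D, IsCoatom E Z := ⟨_, hZ, hZD, rfl⟩

theorem isCoatom_of_card_le_one {D Z : Finset α} {E : Construct L D} (hE : E.root = Z)
    (h : ∀ C ∈ L.comps (D \ Z), C.card ≤ 1) : IsCoatom E Z := by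
  cases E with
  | node X hX hXD ts =>
    obtain rfl : X = Z := hE
    exact ⟨hX, hXD, Construct.node_inj.2 (funext fun C =>
      Construct.eq_of_card_le_one (h _ C.2) _ _)⟩

theorem covers_maxFace {D X : Finset α} {hX : X.Nonempty} {hXD : X ⊆ D} (hD : D.Nonempty)
    {ts : ∀ C : L.comps (D \ X), Construct L C.1} (C : L.comps (D \ X))
    (hC : (ts C).root = C.1) (h : D = X ∪ C.1) :
    (Construct.node X hX hXD ts).Covers (Construct.maxFace L D hD) := by
  have key : ∀ T : Construct L C.1, T.root = C.1 → ts C = T →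
      (Construct.node X hX hXD ts).Covers (Construct.maxFace L D hD) := by
    rintro ⟨Y, hY, hYC, vs⟩ hr hT
    refine .contract C hT (h.trans ?_) ?_ ?_
    · rw [← hr, Construct.root]
    · exact fun E _ h' => absurd h' (notMem_comps_self D E)
    · exact fun E _ h' => absurd h' (notMem_comps_self D E)
  exact key _ hC rfl

theorem dim_maxFace {D : Finset α} (hD : D.Nonempty) :
    (Construct.maxFace L D hD).dim = D.card - 1 := by
  rw [Construct.maxFace, Construct.dim]
  have : IsEmpty (L.comps (D \ D)) := by
    rw [L.comps_self_sdiff]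
    infer_instance
  rw [Finset.univ_eq_empty, Finset.sum_empty, add_zero]

theorem dim_eq_zero_of_card_le_one {D : Finset α} (h : D.card ≤ 1) (S : Construct L D) :
    S.dim = 0 := by
  have hD : D.Nonempty := S.root_nonempty.mono S.root_subset
  rw [Construct.eq_of_card_le_one h S (Construct.maxFace L D hD), dim_maxFace]
  omega

theorem exists_construction (L : AtomicHypergraph α) (D : Finset α) (hD : D.Nonempty) :
    Nonempty (Construction L D) := by
  induction h : D.card using Nat.strong_induction_on generalizing D with
  | _ n ih =>
    obtain ⟨x, hx⟩ := hD
    refine ⟨.node x hx fun C =>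
      Classical.choice (ih C.1.card ?_ C.1 (nonempty_of_mem_comps C.2) rfl)⟩
    rw [← h]
    exact Finset.card_lt_card ⟨subset_of_mem_comps_sdiff C.2,
      fun h => notMem_of_mem_comps C.2 (h hx)⟩

/-- The construction obtained by making the first letter of the word that lies in `D` the root,
and going on with the rest of the word in the connected components. -/
noncomputable def ofWord : List α → ∀ D : Finset α, D.Nonempty → Construction L D
  -- An arbitrary value, not reached when all elements of `D` occur in the initial word.
  | [], D, hD => Classical.choice (exists_construction L D hD)
  | x :: w, D, hD =>
      if hx : x ∈ D then .node x hx fun C => ofWord w C.1 (nonempty_of_mem_comps C.2)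
      else ofWord w D hD

theorem ofWord_cons {x : α} {w : List α} {D : Finset α} (hD : D.Nonempty) (hx : x ∈ D) :
    ofWord (L := L) (x :: w) D hD =
      .node x hx fun C => ofWord w C.1 (nonempty_of_mem_comps C.2) := dif_pos hx

theorem ofWord_cons_of_notMem {x : α} {w : List α} {D : Finset α} (hD : D.Nonempty) (hx : x ∉ D) :
    ofWord (L := L) (x :: w) D hD = ofWord w D hD := dif_neg hx

theorem toConstruct_ofWord_cons {x : α} {w : List α} {D : Finset α} (hD : D.Nonempty)
    (hx : x ∈ D) : (ofWord (L := L) (x :: w) D hD).toConstruct =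
      .node {x} (Finset.singleton_nonempty x) (Finset.singleton_subset_iff.2 hx) fun C =>
        (ofWord w C.1 (nonempty_of_mem_comps C.2)).toConstruct := by
  rw [ofWord_cons hD hx, Construction.toConstruct]

theorem root_ofWord_cons {x : α} {w : List α} {D : Finset α} (hD : D.Nonempty)
    (hx : x ∈ D) : (ofWord (L := L) (x :: w) D hD).toConstruct.root = {x} := by
  rw [toConstruct_ofWord_cons hD hx, Construct.root]

namespace IsTriple

variable {X : Finset α} {x y z : α}

theorem exists_of_mem (hX : X.card = 3) (hx : x ∈ X) : ∃ y z, IsTriple X x y z := by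
  obtain ⟨a, b, c, h₁, h₂, h₃, rfl⟩ := Finset.card_eq_three.1 hX
  have h : IsTriple {a, b, c} a b c := ⟨h₁, h₂, h₃, rfl⟩
  simp only [Finset.mem_insert, Finset.mem_singleton] at hx
  rcases hx with rfl | rfl | rfl
  exacts [⟨_, _, h⟩, ⟨_, _, h.swap₁₂⟩, ⟨_, _, h.swap₂₃.swap₁₂⟩]

theorem exists_of_ne (hX : X.card = 3) (hx : x ∈ X) (hy : y ∈ X) (hxy : x ≠ y) :
    ∃ z, IsTriple X x y z := by
  obtain ⟨b, c, h⟩ := exists_of_mem hX hx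
  have := h.eq ▸ hy
  simp only [Finset.mem_insert, Finset.mem_singleton] at this
  rcases this with rfl | rfl | rfl
  exacts [absurd rfl hxy, ⟨_, h⟩, ⟨_, h.swap₂₃⟩]

theorem unique₃ {z' : α} (h : IsTriple X x y z) (h' : IsTriple X x y z') : z = z' := by
  have := h'.eq ▸ h.mem₃
  simp only [Finset.mem_insert, Finset.mem_singleton] at this
  rcases this with rfl | rfl | rfl
  exacts [absurd rfl h.ne₁₃, absurd rfl h.ne₂₃, rfl]

theorem sdiff_one (h : IsTriple X x y z) : X \ {x} = {y, z} := by
  have := h.ne₁₂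
  have := h.ne₁₃
  rw [h.eq]
  ext u
  simp only [Finset.mem_sdiff, Finset.mem_insert, Finset.mem_singleton]
  grind

theorem sdiff_two (h : IsTriple X x y z) : X \ {x, y} = {z} := by
  have := h.ne₁₃
  have := h.ne₂₃
  rw [h.eq]
  ext u
  simp only [Finset.mem_sdiff, Finset.mem_insert, Finset.mem_singleton]
  grind

theorem comp_two (h : IsTriple X x y z) {C : Finset α} (hC : C ∈ L.comps (X \ {x, y})) :
    C = {z} := by
  have h₁ := subset_of_mem_comps hC
  rw [h.sdiff_two] at h₁
  exact (Finset.Nonempty.subset_singleton_iff (nonempty_of_mem_comps hC)).1 h₁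

theorem card_comp_two (h : IsTriple X x y z) {C : Finset α} (hC : C ∈ L.comps (X \ {x, y})) :
    C.card ≤ 1 := by
  rw [h.comp_two hC, Finset.card_singleton]

theorem mem_comps_two (h : IsTriple X x y z) (hL : L.verts = X) :
    {z} ∈ L.comps (X \ {x, y}) := by
  obtain ⟨C, hC, -⟩ := exists_mem_comps (H := L) (D := X \ {x, y}) (x := z)
    (by rw [h.sdiff_two]; simp) (by rw [hL]; exact Finset.sdiff_subset)
  rwa [h.comp_two hC] at hC

theorem mem_comps_one (h : IsTriple X x y z) (hc : L.IsConn {y, z}) :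
    {y, z} ∈ L.comps (X \ {x}) := by
  rw [mem_comps, h.sdiff_one]
  exact ⟨Finset.Subset.refl _, hc, fun C h₁ _ h₂ => h₁.antisymm h₂⟩

theorem comp_one (h : IsTriple X x y z) (hc : L.IsConn {y, z}) {C : Finset α}
    (hC : C ∈ L.comps (X \ {x})) : C = {y, z} := by
  obtain ⟨u, hu⟩ := nonempty_of_mem_comps hC
  exact comps_eq_of_mem hC (h.mem_comps_one hc) hu (h.sdiff_one ▸ subset_of_mem_comps hC hu)

theorem comp_one_cases (h : IsTriple X x y z) {C : Finset α} (hC : C ∈ L.comps (X \ {x})) :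
    C.card ≤ 1 ∨ (L.IsConn {y, z} ∧ C = {y, z}) := by
  have h₁ := subset_of_mem_comps hC
  rw [h.sdiff_one] at h₁
  by_cases h₂ : C.card ≤ 1
  · exact Or.inl h₂
  · have : C = {y, z} := Finset.eq_of_subset_of_card_le h₁
      (Finset.card_le_two.trans (by omega))
    exact Or.inr ⟨this ▸ L.isConn_of_mem_comps hC, this⟩

theorem card_comp_one (h : IsTriple X x y z) (hc : ¬ L.IsConn {y, z}) {C : Finset α}
    (hC : C ∈ L.comps (X \ {x})) : C.card ≤ 1 :=
  (h.comp_one_cases hC).resolve_right fun h => hc h.1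

end IsTriple

theorem card_comp_pair {D C : Finset α} {y z : α} (hD : D = {y, z}) (hC : C ∈ L.comps (D \ {y})) :
    C.card ≤ 1 := by
  subst hD
  refine (Finset.card_le_card (t := {z}) ((subset_of_mem_comps hC).trans ?_)).trans
    (Finset.card_singleton z).le
  intro u
  simp only [Finset.mem_sdiff, Finset.mem_insert, Finset.mem_singleton]
  tauto

end Nestohedra

namespace Nestohedra

variable {α : Type u} [LinearOrder α] {L : AtomicHypergraph α}

open AtomicHypergraph

/-! ## Constructs of three-element sets -/

variable {X : Finset α} {x y z : α}

theorem ofWord_swap (t : IsTriple X x y z) (hX : X.Nonempty) (h : ¬ L.IsConn {y, z}) :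
    ofWord (L := L) [x, y, z] X hX = ofWord [x, z, y] X hX := by
  rw [ofWord_cons hX t.mem₁, ofWord_cons hX t.mem₁]
  exact Construction.node_inj.2 (funext fun C =>
    Construction.eq_of_card_le_one (t.card_comp_one h C.2) _ _)

theorem ofWord_root {x' y' z' : α} (t : IsTriple X x y z) (t' : IsTriple X x' y' z')
    (hX : X.Nonempty) (h : ofWord (L := L) [x, y, z] X hX = ofWord [x', y', z'] X hX) :
    x = x' := by
  have := congrArg (fun S => S.toConstruct.root) h
  simp only [root_ofWord_cons hX t.mem₁, root_ofWord_cons hX t'.mem₁] at this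
  exact Finset.singleton_injective this

theorem ofWord_ne (t : IsTriple X x y z) (hX : X.Nonempty) (h : L.IsConn {y, z}) :
    ofWord (L := L) [x, y, z] X hX ≠ ofWord [x, z, y] X hX := by
  rw [ofWord_cons hX t.mem₁, ofWord_cons hX t.mem₁, Ne, Construction.node_inj]
  intro e
  have := congrArg (fun S => S.toConstruct.root) (congrFun e ⟨_, t.mem_comps_one h⟩)
  simp only [root_ofWord_cons (D := {y, z}) (x := y) _ (by simp),
    root_ofWord_cons (D := {y, z}) (x := z) _ (by simp)] at this
  exact t.ne₂₃ (Finset.singleton_injective this)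

theorem ofWord_inj {x' y' z' : α} (t : IsTriple X x y z) (t' : IsTriple X x' y' z')
    (hX : X.Nonempty) (h : ofWord (L := L) [x, y, z] X hX = ofWord [x', y', z'] X hX) :
    x = x' ∧ ((y = y' ∧ z = z') ∨ (y = z' ∧ z = y' ∧ ¬ L.IsConn {y, z})) := by
  obtain rfl := ofWord_root t t' hX h
  refine ⟨rfl, ?_⟩
  have := t'.eq ▸ t.mem₂
  simp only [Finset.mem_insert, Finset.mem_singleton] at this
  rcases this with rfl | rfl | rfl
  · exact absurd rfl t.ne₁₂
  · exact Or.inl ⟨rfl, t.unique₃ t'⟩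
  · obtain rfl := t.unique₃ t'.swap₂₃
    exact Or.inr ⟨rfl, rfl, fun hc => ofWord_ne t hX hc h⟩

/-- A construction whose root `x` has the son `y`. -/
theorem eq_ofWord_of_son (t : IsTriple X x y z) (hX : X.Nonempty) (hx : x ∈ X)
    (ts : ∀ C : L.comps (X \ {x}), Construction L C.1) (C : L.comps (X \ {x}))
    (hC : (ts C).toConstruct.root = {y}) :
    Construction.node x hx ts = ofWord [x, y, z] X hX := by
  rw [ofWord_cons hX t.mem₁]
  refine Construction.node_inj.2 (funext fun E => ?_)
  rcases t.comp_one_cases E.2 with h | ⟨hc, h⟩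
  · exact Construction.eq_of_card_le_one h _ _
  · obtain rfl : C = E := Subtype.ext ((t.comp_one hc C.2).trans h.symm)
    have hy : y ∈ C.1 := by simp [h]
    rw [ofWord_cons _ hy]
    have key : ∀ S : Construction L C.1, S.toConstruct.root = {y} →
        S = .node y hy fun E => ofWord [z] E.1 (nonempty_of_mem_comps E.2) := by
      rintro ⟨y', hy', us⟩ hS
      obtain rfl : y' = y := Finset.singleton_injective hS
      refine Construction.node_inj.2 (funext fun F => Construction.eq_of_card_le_one ?_ _ _)
      exact card_comp_pair h F.2
    exact key _ hC

theorem Construction.root_eq {D : Finset α} (S : Construction L D) :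
    ∃ y ∈ D, S.toConstruct.root = {y} := by
  cases S with
  | node y hy us => exact ⟨y, hy, rfl⟩

/-- The word consists of the root, one of its sons, and the remaining vertex. -/
theorem exists_eq_ofWord (hL : L.verts = X) (hX : X.Nonempty) (h3 : X.card = 3)
    (S : Construction L X) :
    ∃ x y z, IsTriple X x y z ∧ S = ofWord [x, y, z] X hX := by
  cases S with
  | node x hx ts =>
    obtain ⟨y, z, t⟩ := IsTriple.exists_of_mem h3 hx
    obtain ⟨C, hC, hy⟩ := exists_mem_comps (H := L) (D := X \ {x}) (x := y)
      (by simp [t.mem₂, t.ne₁₂.symm]) (by rw [hL]; exact Finset.sdiff_subset)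
    obtain ⟨u, hu, hr⟩ := (ts ⟨C, hC⟩).root_eq
    have hu' := t.sdiff_one ▸ subset_of_mem_comps hC hu
    simp only [Finset.mem_insert, Finset.mem_singleton] at hu'
    rcases hu' with rfl | rfl
    · exact ⟨x, _, z, t, eq_ofWord_of_son t hX hx ts _ hr⟩
    · exact ⟨x, _, y, t.swap₂₃, eq_ofWord_of_son t.swap₂₃ hX hx ts _ hr⟩

theorem isNode_maxFace {D Z : Finset α} (hD : D.Nonempty)
    (h : (Construct.maxFace L D hD).IsNode Z) : Z = D := by
  rcases h with h | ⟨C, -⟩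
  · exact h
  · exact absurd C.2 (notMem_comps_self _ _)

theorem isNode_coatom {D Z W : Finset α} {E : Construct L D} (hE : IsCoatom E Z)
    (h : E.IsNode W) : W = Z ∨ W ∈ L.comps (D \ Z) := by
  obtain ⟨hZ, hZD, rfl⟩ := hE
  rcases h with h | ⟨C, h⟩
  · exact Or.inl h
  · exact Or.inr (isNode_maxFace _ h ▸ C.2)

/-- The constructs that cover a construction of a three-element set. -/
theorem coatom_of_covers (hX : X.Nonempty) (h3 : X.card = 3)
    {S : Construction L X} {E : Construct L X} (h : S.toConstruct.Covers E) :
    ∃ x y z, IsTriple X x y z ∧ S = ofWord [x, y, z] X hX ∧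
      (IsCoatom E {x, y} ∨ (L.IsConn {y, z} ∧ IsCoatom E {x})) := by
  cases S with
  | node x hx ts =>
    rcases Construct.covers_node h with ⟨C, hr⟩ | ⟨C, us, hC, hE⟩
    · obtain ⟨y, hy, hs⟩ := (ts C).root_eq
      have hy' := Finset.mem_sdiff.1 (subset_of_mem_comps C.2 hy)
      obtain ⟨z, t⟩ := IsTriple.exists_of_ne h3 hx hy'.1 fun h => hy'.2 (by simp [h])
      refine ⟨x, y, z, t, eq_ofWord_of_son t hX hx ts C hs, Or.inl ?_⟩
      refine isCoatom_of_card_le_one (hr.trans ?_) fun C hC => t.card_comp_two hC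
      rw [hs]
      rfl
    · obtain ⟨y, hy, hs⟩ := (ts C).root_eq
      have hy' := Finset.mem_sdiff.1 (subset_of_mem_comps C.2 hy)
      obtain ⟨z, t⟩ := IsTriple.exists_of_ne h3 hx hy'.1 fun h => hy'.2 (by simp [h])
      refine ⟨x, y, z, t, eq_ofWord_of_son t hX hx ts C hs, Or.inr ?_⟩
      have h2 := hC.two_le_card
      rcases t.comp_one_cases C.2 with h' | ⟨hc, hC'⟩
      · omega
      refine ⟨hc, Finset.singleton_nonempty x, Finset.singleton_subset_iff.2 hx, ?_⟩
      rw [hE]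
      refine Construct.node_inj.2 (funext fun F => ?_)
      obtain rfl : C = F := Subtype.ext (hC'.trans (t.comp_one hc F.2).symm)
      refine Construct.eq_maxFace_of_root _ ?_
      have key : ∀ (D : Finset α) (_ : D = {y, z}) (S : Construction L D) (U : Construct L D),
          S.toConstruct.root = {y} → S.toConstruct.Covers U → U.root = D := by
        rintro D rfl ⟨y', hy', ts'⟩ U hS hU
        obtain rfl : y' = y := Finset.singleton_injective hS
        rcases Construct.covers_node hU with ⟨F, hF⟩ | ⟨F, us, hF, -⟩
        · obtain ⟨u, hu, hu'⟩ := (ts' F).root_eq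
          have hu := Finset.mem_sdiff.1 (subset_of_mem_comps F.2 hu)
          have hu₁ : u = y' ∨ u = z := by simpa using hu.1
          have : u = z := hu₁.resolve_left (by simpa using hu.2)
          rw [hF, hu', this]
          rfl
        · have := hF.two_le_card
          have := card_comp_pair rfl F.2
          omega
      exact key _ hC' _ _ hs hC

/-- The condition on one end of an oriented edge. The two-element node is either the root of `E` or
the component below its root, and the son relation fixes the order of `p` and `q` in the word. -/
theorem half_edge (hX : X.Nonempty) (h3 : X.card = 3) {p q : α} (hpq : p ≠ q)
    {S : Construction L X} {E : Construct L X} (h : S.toConstruct.Covers E)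
    (hE : E.IsNode {p, q}) (hS : S.toConstruct.Son {p} {q}) :
    ∃ r, IsTriple X p q r ∧ ((IsCoatom E {p, q} ∧ S = ofWord [p, q, r] X hX) ∨
      (L.IsConn {p, q} ∧ IsCoatom E {r} ∧ S = ofWord [r, p, q] X hX)) := by
  obtain ⟨x, y, z, t, rfl, hc⟩ := coatom_of_covers hX h3 h
  have hcard : ({p, q} : Finset α).card = 2 := Finset.card_pair hpq
  have hxq : x ≠ q := by
    have := Construct.son_subset hS
    rw [root_ofWord_cons hX t.mem₁] at this
    rintro rfl
    simpa using this (Finset.mem_singleton_self x)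
  have pair : ∀ {a b : α}, ({p, q} : Finset α) = {a, b} → a ≠ q → a = p ∧ b = q := by
    intro a b e ha
    have h₁ : a ∈ ({p, q} : Finset α) := by simp [e]
    have h₂ : q ∈ ({a, b} : Finset α) := by simp [← e]
    simp only [Finset.mem_insert, Finset.mem_singleton] at h₁ h₂
    exact ⟨h₁.resolve_right ha, (h₂.resolve_left ha.symm).symm⟩
  rcases hc with hc | ⟨hyz, hc⟩
  · rcases isNode_coatom hc hE with e | e
    · obtain ⟨rfl, rfl⟩ := pair e hxq
      exact ⟨z, t, Or.inl ⟨hc, rfl⟩⟩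
    · have := t.card_comp_two e
      omega
  · rcases isNode_coatom hc hE with e | e
    · rw [e, Finset.card_singleton] at hcard
      omega
    · have e := t.comp_one hyz e
      -- Inside the component `y` is the root, hence not a son there, and the root `x` is not in
      -- `{p, q}`.
      have hyq : y ≠ q := by
        rintro rfl
        rw [toConstruct_ofWord_cons hX t.mem₁] at hS
        have hxp : p ≠ x := by
          have := e ▸ Finset.mem_insert_self p {y}
          simp only [Finset.mem_insert, Finset.mem_singleton] at this
          rcases this with rfl | rfl
          exacts [t.ne₁₂.symm, t.ne₁₃.symm]
        rcases hS with ⟨h, -⟩ | ⟨C, h⟩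
        · exact hxp (Finset.singleton_injective h)
        · have h := Construct.son_subset h
          have hy : y ∈ C.1 := by
            rw [t.comp_one hyz C.2]
            simp
          rw [root_ofWord_cons _ hy] at h
          simpa using h (Finset.mem_singleton_self y)
      obtain ⟨rfl, rfl⟩ := pair e hyq
      exact ⟨x, t.swap₁₂.swap₂₃, Or.inr ⟨hyz, hc, rfl⟩⟩

theorem covers_top (hL : L.verts = X) (hX : X.Nonempty) (t : IsTriple X x y z) {E : Construct L X}
    (hE : IsCoatom E {x, y}) : (ofWord [x, y, z] X hX).toConstruct.Covers E ∧
      (ofWord (L := L) [x, y, z] X hX).toConstruct.Son {x} {y} := by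
  obtain ⟨hZ, hZD, rfl⟩ := hE
  obtain ⟨C, hC, hy⟩ := exists_mem_comps (H := L) (D := X \ {x}) (x := y)
    (by simp [t.mem₂, t.ne₁₂.symm]) (by rw [hL]; exact Finset.sdiff_subset)
  rw [toConstruct_ofWord_cons hX t.mem₁]
  constructor
  · refine .contract ⟨C, hC⟩ (toConstruct_ofWord_cons _ hy) rfl ?_ ?_
    · exact fun F _ h' => Construct.eq_of_card_le_one (t.card_comp_two h') _ _
    · exact fun F _ h' _ => Construct.eq_of_card_le_one (t.card_comp_two h') _ _
  · exact Or.inl ⟨rfl, ⟨C, hC⟩, (root_ofWord_cons _ hy).symm⟩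

theorem covers_bot (hL : L.verts = X) (hX : X.Nonempty) (t : IsTriple X x y z)
    (hc : L.IsConn {y, z}) {E : Construct L X} (hE : IsCoatom E {x}) :
    (ofWord [x, y, z] X hX).toConstruct.Covers E ∧
      (ofWord (L := L) [x, y, z] X hX).toConstruct.Son {y} {z} := by
  obtain ⟨hZ, hZD, rfl⟩ := hE
  have hC := t.mem_comps_one hc
  have hy : y ∈ ({y, z} : Finset α) := by simp
  have hz : {y, z} \ {y} = ({z} : Finset α) := by
    have := t.ne₂₃
    ext u
    simp only [Finset.mem_sdiff, Finset.mem_insert, Finset.mem_singleton]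
    grind
  have hzm : {z} ∈ L.comps ({y, z} \ {y}) := by
    rw [mem_comps, hz]
    refine ⟨Finset.Subset.refl _, L.isConn_singleton (hL ▸ t.mem₃), fun C' h₁ _ h₂ => ?_⟩
    exact h₁.antisymm h₂
  rw [toConstruct_ofWord_cons hX t.mem₁]
  constructor
  · refine .sub ⟨_, hC⟩ ?_ fun F hF => absurd (Subtype.ext (t.comp_one hc F.2)) hF
    rw [toConstruct_ofWord_cons _ hy]
    refine covers_maxFace _ ⟨{z}, hzm⟩ (root_ofWord_cons _ (Finset.mem_singleton_self z)) rfl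
  · refine Or.inr ⟨⟨_, hC⟩, ?_⟩
    change (ofWord (L := L) [y, z] {y, z} (nonempty_of_mem_comps hC)).toConstruct.Son {y} {z}
    rw [toConstruct_ofWord_cons _ hy]
    exact Or.inl ⟨rfl, ⟨{z}, hzm⟩, (root_ofWord_cons _ (Finset.mem_singleton_self z)).symm⟩

theorem isOrientedEdge_iff (hL : L.verts = X) (hX : X.Nonempty) (h3 : X.card = 3)
    {E : Construct L X} {S T : Construction L X} :
    IsOrientedEdge E S T ↔ ∃ p q r, IsTriple X p q r ∧ p < q ∧
      ((IsCoatom E {p, q} ∧ S = ofWord [p, q, r] X hX ∧ T = ofWord [q, p, r] X hX) ∨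
        (L.IsConn {p, q} ∧ IsCoatom E {r} ∧ S = ofWord [r, p, q] X hX ∧
          T = ofWord [r, q, p] X hX)) := by
  constructor
  · rintro ⟨p, q, hpq, hE, hS, hT, sS, sT⟩
    obtain ⟨r, t, h₁⟩ := half_edge hX h3 hpq.ne hS hE sS
    rw [Finset.pair_comm] at hE
    obtain ⟨r', t', h₂⟩ := half_edge hX h3 hpq.ne' hT hE sT
    obtain rfl := t.unique₃ t'.swap₁₂
    have hne : ¬ (IsCoatom E {p, q} ∧ IsCoatom E {r}) := by
      rintro ⟨h, h'⟩
      have := congrArg Finset.card (h.root_eq.symm.trans h'.root_eq)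
      rw [Finset.card_pair hpq.ne, Finset.card_singleton] at this
      omega
    rw [Finset.pair_comm q p] at h₂
    refine ⟨p, q, r, t, hpq, ?_⟩
    tauto
  · rintro ⟨p, q, r, t, hpq, ⟨hE, rfl, rfl⟩ | ⟨hc, hE, rfl, rfl⟩⟩
    · have h₁ := covers_top hL hX t hE
      have h₂ := covers_top hL hX t.swap₁₂ (Finset.pair_comm p q ▸ hE)
      refine ⟨p, q, hpq, ?_, h₁.1, h₂.1, h₁.2, h₂.2⟩
      obtain ⟨_, _, rfl⟩ := hE
      exact Or.inl rfl
    · have t' := t.swap₂₃.swap₁₂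
      have h₁ := covers_bot hL hX t' hc hE
      have h₂ := covers_bot hL hX t'.swap₂₃ (Finset.pair_comm p q ▸ hc) hE
      refine ⟨p, q, hpq, ?_, h₁.1, h₂.1, h₁.2, h₂.2⟩
      obtain ⟨_, _, rfl⟩ := hE
      exact Or.inr ⟨⟨_, t'.mem_comps_one hc⟩, Or.inl rfl⟩

theorem isFace_of_isCoatom_pair (hL : L.verts = X) (hX : X.Nonempty) (t : IsTriple X x y z)
    {E : Construct L X} (hE : IsCoatom E {x, y}) :
    E.IsFace (Construct.maxFace L X hX) ∧ E.dim = 1 := by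
  obtain ⟨_, _, rfl⟩ := hE
  constructor
  · refine .single (covers_maxFace hX ⟨_, t.mem_comps_two hL⟩ rfl (t.eq.trans ?_))
    rw [Finset.insert_union, ← Finset.insert_eq]
  · rw [Construct.dim, Finset.card_pair t.ne₁₂, Finset.sum_eq_zero fun C _ =>
      dim_eq_zero_of_card_le_one (t.card_comp_two C.2) _]
    rfl

theorem isFace_of_isCoatom_singleton (hX : X.Nonempty) (t : IsTriple X x y z)
    (hc : L.IsConn {y, z}) {E : Construct L X} (hE : IsCoatom E {x}) :
    E.IsFace (Construct.maxFace L X hX) ∧ E.dim = 1 := by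
  obtain ⟨_, _, rfl⟩ := hE
  constructor
  · refine .single (covers_maxFace hX ⟨_, t.mem_comps_one hc⟩ rfl (t.eq.trans rfl))
  · rw [Construct.dim, Finset.card_singleton, Fintype.sum_eq_single ⟨_, t.mem_comps_one hc⟩]
    · rw [dim_maxFace, Finset.card_pair t.ne₂₃]
    · exact fun C hC => absurd (Subtype.ext (t.comp_one hc C.2)) hC

theorem isFace_and_dim_of_isOrientedEdge (hL : L.verts = X) (hX : X.Nonempty) (h3 : X.card = 3)
    {E : Construct L X} {S T : Construction L X} (h : IsOrientedEdge E S T) :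
    E.IsFace (Construct.maxFace L X hX) ∧ E.dim = 1 := by
  obtain ⟨p, q, r, t, -, ⟨hE, -⟩ | ⟨hc, hE, -⟩⟩ := (isOrientedEdge_iff hL hX h3).1 h
  · exact isFace_of_isCoatom_pair hL hX t hE
  · exact isFace_of_isCoatom_singleton hX t.swap₂₃.swap₁₂ hc hE

/-- By dimension the root has one or two elements. Two elements leave a single vertex below. One
element requires a component with two elements, and dimension one makes the construct on it a single
node. -/
theorem exists_isOrientedEdge (hL : L.verts = X) (hX : X.Nonempty) (h3 : X.card = 3)
    {E : Construct L X} (h : E.dim = 1) : ∃ S T, IsOrientedEdge E S T := by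
  suffices ∃ p q r, IsTriple X p q r ∧ (IsCoatom E {p, q} ∨
      (L.IsConn {p, q} ∧ IsCoatom E {r})) by
    have main : ∀ p q r, IsTriple X p q r → p < q → (IsCoatom E {p, q} ∨
        (L.IsConn {p, q} ∧ IsCoatom E {r})) → ∃ S T, IsOrientedEdge E S T := by
      intro p q r t hpq hE
      rcases hE with hE | ⟨hc, hE⟩
      · exact ⟨_, _, (isOrientedEdge_iff hL hX h3).2
          ⟨p, q, r, t, hpq, Or.inl ⟨hE, rfl, rfl⟩⟩⟩
      · exact ⟨_, _, (isOrientedEdge_iff hL hX h3).2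
          ⟨p, q, r, t, hpq, Or.inr ⟨hc, hE, rfl, rfl⟩⟩⟩
    obtain ⟨p, q, r, t, hE⟩ := this
    rcases t.ne₁₂.lt_or_gt with hlt | hlt
    · exact main p q r t hlt hE
    · rw [Finset.pair_comm] at hE
      exact main q p r t.swap₁₂ hlt hE
  cases E with
  | node Z hZ hZX ts =>
    rw [Construct.dim] at h
    have h1 := hZ.card_pos
    rcases (by omega : Z.card = 1 ∨ Z.card = 2) with hc | hc
    · obtain ⟨x, rfl⟩ := Finset.card_eq_one.1 hc
      obtain ⟨y, z, t⟩ := IsTriple.exists_of_mem h3 (Finset.singleton_subset_iff.1 hZX)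
      by_cases hyz : L.IsConn {y, z}
      · refine ⟨y, z, x, t.swap₁₂.swap₂₃, Or.inr ⟨hyz, hZ, hZX, ?_⟩⟩
        refine Construct.node_inj.2 (funext fun F => ?_)
        refine Construct.eq_maxFace_of_root _ ?_
        have hF := t.comp_one hyz F.2
        have hd : (ts F).dim = 1 := by
          rw [hc, Fintype.sum_eq_single F] at h
          · omega
          · exact fun C hC => absurd (Subtype.ext ((t.comp_one hyz C.2).trans hF.symm)) hC
        have key : ∀ (D : Finset α) (_ : D.card = 2) (U : Construct L D), U.dim = 1 →
            U.root = D := by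
          intro D hD U hU
          by_contra hne
          have hr : U.root.card = 1 := by
            have := U.root_nonempty.card_pos
            have := Finset.card_lt_card (lt_of_le_of_ne U.root_subset hne)
            omega
          cases U with
          | node W hW hWD us =>
            rw [Construct.root] at hr
            rw [Construct.dim, hr, Finset.sum_eq_zero] at hU
            · omega
            · intro C _
              refine dim_eq_zero_of_card_le_one ?_ _
              have := Finset.card_le_card (subset_of_mem_comps C.2)
              rw [Finset.card_sdiff_of_subset hWD] at this
              omega
        exact key _ (by rw [hF, Finset.card_pair t.ne₂₃]) _ hd
      · rw [hc, Finset.sum_eq_zero] at h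
        · omega
        · exact fun C _ => dim_eq_zero_of_card_le_one (t.card_comp_one hyz C.2) _
    · obtain ⟨x, y, hxy, rfl⟩ := Finset.card_eq_two.1 hc
      obtain ⟨z, t⟩ := IsTriple.exists_of_ne h3 (hZX (by simp)) (hZX (by simp)) hxy
      exact ⟨x, y, z, t, Or.inl (isCoatom_of_card_le_one rfl fun C hC => t.card_comp_two hC)⟩

/-- The root of the edge determines the pair to be exchanged, and the order of the vertices
determines the direction. -/
theorem isOrientedEdge_unique (hL : L.verts = X) (hX : X.Nonempty) (h3 : X.card = 3)
    {E : Construct L X} {S T S' T' : Construction L X} (h : IsOrientedEdge E S T)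
    (h' : IsOrientedEdge E S' T') : S = S' ∧ T = T' := by
  have key : ∀ {p q p' q' : α}, ({p, q} : Finset α) = {p', q'} → p < q → p' < q' →
      p = p' ∧ q = q' := by
    intro p q p' q' e h h'
    have h₁ : p ∈ ({p', q'} : Finset α) := by simp [← e]
    have h₂ : q ∈ ({p', q'} : Finset α) := by simp [← e]
    simp only [Finset.mem_insert, Finset.mem_singleton] at h₁ h₂
    rcases h₁ with rfl | rfl <;> rcases h₂ with rfl | rfl
    exacts [absurd h (lt_irrefl _), ⟨rfl, rfl⟩, absurd h h'.asymm, absurd h (lt_irrefl _)]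
  obtain ⟨p, q, r, t, hpq, H⟩ := (isOrientedEdge_iff hL hX h3).1 h
  obtain ⟨p', q', r', t', hpq', H'⟩ := (isOrientedEdge_iff hL hX h3).1 h'
  rcases H with ⟨hE, rfl, rfl⟩ | ⟨hc, hE, rfl, rfl⟩ <;>
    rcases H' with ⟨hE', rfl, rfl⟩ | ⟨hc', hE', rfl, rfl⟩
  · obtain ⟨rfl, rfl⟩ := key (hE.root_eq.symm.trans hE'.root_eq) hpq hpq'
    obtain rfl := t.unique₃ t'
    exact ⟨rfl, rfl⟩
  · have := congrArg Finset.card (hE.root_eq.symm.trans hE'.root_eq)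
    rw [Finset.card_pair hpq.ne, Finset.card_singleton] at this
    omega
  · have := congrArg Finset.card (hE.root_eq.symm.trans hE'.root_eq)
    rw [Finset.card_pair hpq'.ne, Finset.card_singleton] at this
    omega
  · obtain rfl := Finset.singleton_injective (hE.root_eq.symm.trans hE'.root_eq)
    have e : ({p, q} : Finset α) = {p', q'} := by
      rw [← t.swap₂₃.swap₁₂.sdiff_one, t'.swap₂₃.swap₁₂.sdiff_one]
    obtain ⟨rfl, rfl⟩ := key e hpq hpq'
    exact ⟨rfl, rfl⟩

/-- The graph of the oriented edges of a construct. -/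
def EdgeRel {D : Finset α} (F : Construct L D) (S T : Construction L D) : Prop :=
  ∃ E : Construct L D, E.IsFace F ∧ IsOrientedEdge E S T

theorem isFlipGraph_ofWord (hL : L.verts = X) (hX : X.Nonempty) (h3 : X.card = 3) :
    IsFlipGraph X (fun x y z => ofWord (L := L) [x, y, z] X hX)
      (fun _ y z => L.IsConn {y, z}) (EdgeRel (Construct.maxFace L X hX)) where
  comm {_ y z} _ h := by rwa [Finset.pair_comm z y]
  swap t h := ofWord_swap t hX h
  root t t' h := ofWord_root t t' hX h
  rel_iff := by
    intro x y z t T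
    have mk : ∀ {E S T}, IsOrientedEdge E S T → EdgeRel (Construct.maxFace L X hX) S T :=
      fun h => ⟨_, (isFace_and_dim_of_isOrientedEdge hL hX h3 h).1, h⟩
    have top : ∀ {x y z}, IsTriple X x y z → x < y →
        EdgeRel (Construct.maxFace L X hX) (ofWord [x, y, z] X hX) (ofWord [y, x, z] X hX) := by
      intro x y z t h
      obtain ⟨E, hE⟩ := exists_isCoatom (L := L) (D := X) (Z := {x, y}) (by simp)
        (Finset.insert_subset t.mem₁ (Finset.singleton_subset_iff.2 t.mem₂))
      exact mk ((isOrientedEdge_iff hL hX h3).2 ⟨x, y, z, t, h, Or.inl ⟨hE, rfl, rfl⟩⟩)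
    constructor
    · rintro ⟨E, -, hE⟩
      obtain ⟨p, q, r, t', hpq, ⟨-, e, rfl⟩ | ⟨hc, -, e, rfl⟩⟩ :=
        (isOrientedEdge_iff hL hX h3).1 hE
      · obtain ⟨rfl, ⟨rfl, rfl⟩ | ⟨rfl, rfl, hn⟩⟩ := ofWord_inj t t' hX e
        · exact Or.inl ⟨hpq, rfl⟩
        · exact Or.inr (Or.inl ⟨hpq, hn, rfl⟩)
      · obtain ⟨rfl, ⟨rfl, rfl⟩ | ⟨rfl, rfl, hn⟩⟩ := ofWord_inj t t'.swap₂₃.swap₁₂ hX e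
        · exact Or.inr (Or.inr ⟨hpq, hc, rfl⟩)
        · rw [Finset.pair_comm] at hc
          exact absurd hc hn
    · rintro (⟨h, rfl⟩ | ⟨h, hn, rfl⟩ | ⟨h, hc, rfl⟩)
      · exact top t h
      · simp only [ofWord_swap t hX hn]
        exact top t.swap₂₃ h
      · obtain ⟨E, hE⟩ := exists_isCoatom (L := L) (D := X) (Z := {x}) (by simp)
          (Finset.singleton_subset_iff.2 t.mem₁)
        exact mk ((isOrientedEdge_iff hL hX h3).2
          ⟨y, z, x, t.swap₁₂.swap₂₃, h, Or.inr ⟨hc, hE, rfl, rfl⟩⟩)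

end Nestohedra

namespace Nestohedra

variable {α : Type u} [LinearOrder α]

open AtomicHypergraph

/-! ## The oriented boundary of a polygon -/

section Boundary

variable {L : AtomicHypergraph α} {X : Finset α} {a b c : α}

/-- The path on the boundary of the maximal face through the constructions with root `c`. -/
noncomputable def upperBoundary (L : AtomicHypergraph α) (X : Finset α) (hX : X.Nonempty)
    (a b c : α) : List (Construction L X) :=
  ofWord [a, b, c] X hX :: upperPath (fun x y z => ofWord [x, y, z] X hX)
    (fun _ y z => L.IsConn {y, z}) a b c

/-- The path on the boundary of the maximal face through the constructions with root `b`. -/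
noncomputable def lowerBoundary (L : AtomicHypergraph α) (X : Finset α) (hX : X.Nonempty)
    (a b c : α) : List (Construction L X) :=
  ofWord [a, b, c] X hX :: lowerPath (fun x y z => ofWord [x, y, z] X hX)
    (fun _ y z => L.IsConn {y, z}) a b c

theorem IsBoundary.symm {D : Finset α} {F : Construct L D} {P Q : List (Construction L D)}
    (h : IsBoundary F P Q) : IsBoundary F Q P := by
  obtain ⟨⟨S, T, h₁, h₂, h₃, h₄⟩, hP, hQ, hx⟩ := h
  exact ⟨⟨S, T, h₂, h₁, h₄, h₃⟩, hQ, hP, fun E h h' => (hx E h h').symm⟩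

theorem traverses_iff (hL : L.verts = X) (hX : X.Nonempty) (h3 : X.card = 3)
    {P : List (Construction L X)} {E : Construct L X} {S T : Construction L X}
    (h : IsOrientedEdge E S T) : Traverses P E ↔ [S, T] <:+: P := by
  constructor
  · rintro ⟨S', T', h₁, h₂⟩
    obtain ⟨rfl, rfl⟩ := isOrientedEdge_unique hL hX h3 h h₂
    exact h₁
  · exact fun h' => ⟨S, T, h', h⟩

/-- The maximal face is the whole polygon: every construction is one of its vertices and every
construct of dimension one is one of its edges. -/
theorem isBoundary_maxFace_iff (hL : L.verts = X) (hX : X.Nonempty) (t : IsTriple X a b c)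
    (hab : a < b) (hbc : b < c) {P Q : List (Construction L X)} :
    IsBoundary (Construct.maxFace L X hX) P Q ↔
      (P = upperBoundary L X hX a b c ∧ Q = lowerBoundary L X hX a b c) ∨
      (P = lowerBoundary L X hX a b c ∧ Q = upperBoundary L X hX a b c) := by
  have h3 := t.card_eq
  have g := isFlipGraph_ofWord hL hX h3
  have B := g.isBigon t hab hbc
  have hs : ∀ S, ¬ EdgeRel (Construct.maxFace L X hX) S (ofWord [a, b, c] X hX) := by
    intro S
    obtain ⟨x, y, z, t', rfl⟩ := exists_eq_ofWord hL hX h3 S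
    exact g.not_rel_source t hab hbc (ofWord_ne t hX) t'
  constructor
  · rintro ⟨⟨S, T, h₁, h₂, h₃, h₄⟩, hP, hQ, hx⟩
    have key : ∀ T, EdgeRel (Construct.maxFace L X hX) (ofWord [a, b, c] X hX) T →
        Xor ([ofWord [a, b, c] X hX, T] <:+: P) ([ofWord [a, b, c] X hX, T] <:+: Q) := by
      rintro T ⟨E, hE, hE'⟩
      rw [← traverses_iff hL hX h3 hE', ← traverses_iff hL hX h3 hE']
      exact hx E (isFace_and_dim_of_isOrientedEdge hL hX h3 hE').2 hE
    have hd : ∃ u, (upperPath (fun x y z => ofWord (L := L) [x, y, z] X hX)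
        (fun _ y z => L.IsConn {y, z}) a b c).head? = some u := by
      by_cases hc : L.IsConn {b, c}
      · exact ⟨_, upperPath_head_of_conn hc⟩
      · exact ⟨_, g.upperPath_head t hc⟩
    obtain ⟨u, hu⟩ := hd
    have hl := g.lowerPath_head t
    exact B.eq_or_eq_of_xor hs hu hl hP hQ (h₃.trans h₄.symm)
      (key _ ((B.succ_iff _).2 (Or.inl hu))) (key _ ((B.succ_iff _).2 (Or.inr hl)))
  · have main : IsBoundary (Construct.maxFace L X hX) (upperBoundary L X hX a b c)
        (lowerBoundary L X hX a b c) := by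
      refine ⟨⟨ofWord [a, b, c] X hX, ofWord [c, b, a] X hX, rfl, rfl, ?_, ?_⟩, B.isChain,
        B.symm.isChain, ?_⟩
      · rw [upperBoundary, List.getLast?_cons, B.last₁]
        rfl
      · rw [lowerBoundary, List.getLast?_cons, B.last₂]
        rfl
      · intro E hE hF
        obtain ⟨S, T, h⟩ := exists_isOrientedEdge hL hX h3 hE
        rw [traverses_iff hL hX h3 h, traverses_iff hL hX h3 h]
        refine B.xor_infix hs ?_ ⟨E, hF, h⟩
        intro S T _
        obtain ⟨x, y, z, t', rfl⟩ := exists_eq_ofWord hL hX h3 S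
        exact g.mem_path t t'
    rintro (⟨rfl, rfl⟩ | ⟨rfl, rfl⟩)
    exacts [main, main.symm]

end Boundary

/-! ## Reconnected restrictions -/

variable {H : AtomicHypergraph α} {Y : ConnSet H} {X : Finset α}

theorem isConn_restrict {B Z : Finset α} :
    (H.restrict B).IsConn Z ↔ H.IsConn Z ∧ Z ⊆ B := by
  rw [isConn_iff, isConn_iff]
  simp only [restrict, Finset.subset_inter_iff, Finset.mem_filter]
  constructor
  · rintro ⟨⟨h₁, h₂⟩, h₃, h₄⟩
    exact ⟨⟨h₁, h₃, fun A B hAB hd h => h₄ A B hAB hd fun Z hZ => h Z hZ.1⟩, h₂⟩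
  · rintro ⟨⟨h₁, h₃, h₄⟩, h₂⟩
    exact ⟨⟨h₁, h₂⟩, h₃, fun A B hAB hd h => h₄ A B hAB hd fun Z hZ hZX =>
      h Z ⟨hZ, hZX.trans h₂⟩ hZX⟩

theorem mem_edges_shape {A : Finset α} : A ∈ (shape Y X).edges ↔
    A.Nonempty ∧ ∃ Z, H.IsConn Z ∧ Z ⊆ Y.1 ∧ A = Z ∩ X := by
  simp only [shape, reconnected, Finset.mem_filter, Finset.mem_image, mem_sat, isConn_restrict]
  constructor
  · rintro ⟨⟨Z, ⟨h₁, h₂⟩, rfl⟩, h⟩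
    exact ⟨h, Z, h₁, h₂, rfl⟩
  · rintro ⟨h, Z, h₁, h₂, rfl⟩
    exact ⟨⟨Z, ⟨h₁, h₂⟩, rfl⟩, h⟩

theorem verts_shape (hXY : X ⊆ Y.1) : (shape Y X).verts = X := by
  have : (shape Y X).verts = H.verts ∩ Y.1 ∩ X := rfl
  rw [this, Finset.inter_eq_right.2 Y.2.1]
  exact Finset.inter_eq_right.2 hXY

/-- The hyperedges of a reconnected restriction are closed under unions of intersecting pairs. A
maximal hyperedge `E` inside `A` therefore absorbs every hyperedge inside `A` that meets it, and `A`
would split into `E` and `A \ E`. -/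
theorem isConn_shape {A : Finset α} : (shape Y X).IsConn A ↔
    A.Nonempty ∧ ∃ Z, H.IsConn Z ∧ Z ⊆ Y.1 ∧ A = Z ∩ X := by
  rw [← mem_edges_shape, isConn_iff]
  constructor
  · rintro ⟨hA, ⟨x, hx⟩, h⟩
    obtain ⟨E, hE, hm⟩ := Finset.exists_le_maximal ((shape Y X).edges.filter (· ⊆ A))
      (Finset.mem_filter.2 ⟨(shape Y X).atomic x (hA hx), Finset.singleton_subset_iff.2 hx⟩)
    have hE' := Finset.mem_filter.1 hm.1
    have hn : A \ E = ∅ := by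
      refine (h E (A \ E) ?_ Finset.disjoint_sdiff ?_).resolve_left ?_
      · exact Finset.union_sdiff_of_subset hE'.2
      · intro Z hZ hZA
        by_cases hd : (Z ∩ E).Nonempty
        · left
          obtain ⟨h₁, W, hW, hWY, rfl⟩ := mem_edges_shape.1 hZ
          obtain ⟨h₂, W', hW', hWY', e⟩ := mem_edges_shape.1 hE'.1
          have hu : (W ∩ X) ∪ E ∈ (shape Y X).edges.filter (· ⊆ A) := by
            refine Finset.mem_filter.2 ⟨mem_edges_shape.2 ⟨h₁.mono Finset.subset_union_left,
              W ∪ W', hW.union H hW' ?_, Finset.union_subset hWY hWY', ?_⟩,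
              Finset.union_subset hZA hE'.2⟩
            · rw [e] at hd
              exact hd.mono (Finset.inter_subset_inter Finset.inter_subset_left
                Finset.inter_subset_left)
            · rw [e, Finset.union_inter_distrib_right]
          exact Finset.subset_union_left.trans (hm.2 hu Finset.subset_union_right)
        · right
          intro u hu
          exact Finset.mem_sdiff.2 ⟨hZA hu, fun hE => hd ⟨u, Finset.mem_inter.2 ⟨hu, hE⟩⟩⟩
      · rintro rfl
        simpa using hE (Finset.mem_singleton_self x)
    rw [(Finset.sdiff_eq_empty_iff_subset.1 hn).antisymm hE'.2]
    exact hE'.1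
  · intro hA
    refine ⟨(shape Y X).subset_of_mem A hA, (shape Y X).nonempty_of_mem A hA, ?_⟩
    rintro P Q rfl hd h
    rcases h _ hA (Finset.Subset.refl _) with h | h
    · right
      have := Finset.union_subset_right h
      exact Finset.disjoint_self_iff_empty _ |>.1 (hd.mono_left this)
    · left
      have := Finset.union_subset_left h
      exact Finset.disjoint_self_iff_empty _ |>.1 (hd.mono_right this)

/-- A connected set with trace `{y, z}` avoids `x`, so it lies in one component of `Y \ x`.
Conversely, a component containing `y` and `z` has this trace. -/
theorem isConn_shape_iff_joined {x y z : α} (t : IsTriple X x y z) :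
    (shape Y X).IsConn {y, z} ↔ Joined Y x y z := by
  rw [isConn_shape]
  constructor
  · rintro ⟨-, Z, hZ, hZY, e⟩
    have hx : x ∉ Z := by
      intro hx
      have : x ∈ ({y, z} : Finset α) := by
        rw [e]
        exact Finset.mem_inter.2 ⟨hx, t.mem₁⟩
      simp [t.ne₁₂, t.ne₁₃] at this
    have hyz : ({y, z} : Finset α) ⊆ Z := e ▸ Finset.inter_subset_left
    obtain ⟨C, hC, h⟩ := H.exists_comps hZ
      (fun u hu => Finset.mem_sdiff.2 ⟨hZY hu, fun hux => hx (Finset.mem_singleton.1 hux ▸ hu)⟩ :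
        Z ⊆ Y.1 \ {x})
    exact ⟨⟨C, hC⟩, h (hyz (by simp)), h (hyz (by simp))⟩
  · rintro ⟨C, hy, hz⟩
    refine ⟨by simp, C.1, H.isConn_of_mem_comps C.2, subset_of_mem_comps_sdiff C.2, ?_⟩
    have hx := notMem_of_mem_comps C.2
    ext u
    rw [t.eq]
    simp only [Finset.mem_insert, Finset.mem_singleton, Finset.mem_inter]
    constructor
    · rintro (rfl | rfl)
      · exact ⟨hy, Or.inr (Or.inl rfl)⟩
      · exact ⟨hz, Or.inr (Or.inr rfl)⟩
    · rintro ⟨hu, rfl | h⟩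
      exacts [absurd hu hx, h]

/-- `K` contains the connected subsets of `Y` with a non-empty trace on `X` inside `K`. -/
def IsSaturated (Y : ConnSet H) (X K : Finset α) : Prop :=
  K ⊆ Y.1 ∧ ∀ Z, H.IsConn Z → Z ⊆ Y.1 → (Z ∩ X).Nonempty → Z ∩ X ⊆ K → Z ⊆ K

theorem IsSaturated.subset_comp {K Z : Finset α} (hK : IsSaturated Y X K) {x : α} (hx : x ∈ X)
    {C : Finset α} (hC : C ∈ H.comps (K \ {x})) (hZ : H.IsConn Z) (hZY : Z ⊆ Y.1)
    (h : (Z ∩ X ∩ C).Nonempty) (h' : Z ∩ X ⊆ K \ {x}) : Z ⊆ C := by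
  have h₁ := hK.2 Z hZ hZY (h.mono Finset.inter_subset_left) (h'.trans Finset.sdiff_subset)
  refine subset_comps hC hZ ?_ (h.mono (Finset.inter_subset_inter_right Finset.inter_subset_left))
  intro u hu
  refine Finset.mem_sdiff.2 ⟨h₁ hu, fun hux => ?_⟩
  obtain rfl := Finset.mem_singleton.1 hux
  exact (Finset.mem_sdiff.1 (h' (Finset.mem_inter.2 ⟨hu, hx⟩))).2 hux

theorem IsSaturated.comp {K : Finset α} (hK : IsSaturated Y X K) {x : α} (hx : x ∈ X)
    {C : Finset α} (hC : C ∈ H.comps (K \ {x})) : IsSaturated Y X C := by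
  refine ⟨(subset_of_mem_comps_sdiff hC).trans hK.1, fun Z hZ hZY hn h => ?_⟩
  refine hK.subset_comp hx hC hZ hZY ?_ (h.trans (subset_of_mem_comps hC))
  rwa [Finset.inter_eq_left.2 h]

/-- For maximality: a larger connected trace comes from a connected `Z ⊆ Y`. Saturation puts `Z`
into `K`, and as it avoids `x` and meets `C`, it lies in `C`. -/
theorem IsSaturated.mem_comps_shape {K : Finset α} (hK : IsSaturated Y X K) {x : α}
    (hx : x ∈ X) {C : Finset α} (hC : C ∈ H.comps (K \ {x})) (hn : (C ∩ X).Nonempty) :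
    C ∩ X ∈ (shape Y X).comps ((K ∩ X) \ {x}) := by
  have hCK := subset_of_mem_comps hC
  rw [mem_comps]
  refine ⟨?_, ?_, ?_⟩
  · intro u hu
    have hu := Finset.mem_inter.1 hu
    have hu' := Finset.mem_sdiff.1 (hCK hu.1)
    exact Finset.mem_sdiff.2 ⟨Finset.mem_inter.2 ⟨hu'.1, hu.2⟩, hu'.2⟩
  · exact isConn_shape.2 ⟨hn, C, H.isConn_of_mem_comps hC,
      (subset_of_mem_comps_sdiff hC).trans hK.1, rfl⟩
  · intro C' h₁ h₂ h₃
    obtain ⟨-, Z, hZ, hZY, rfl⟩ := isConn_shape.1 h₂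
    refine Finset.Subset.antisymm (Finset.inter_subset_inter_right ?_) h₃
    refine hK.subset_comp hx hC hZ hZY ?_ (h₁.trans ?_)
    · obtain ⟨u, hu⟩ := hn
      exact ⟨u, Finset.mem_inter.2 ⟨h₃ hu, (Finset.mem_inter.1 hu).1⟩⟩
    · exact Finset.sdiff_subset_sdiff Finset.inter_subset_left (Finset.Subset.refl _)

theorem wordTerm_eq_cvar {w : List α} {K : ConnSet H} (h : ∀ x ∈ w, x ∉ K.1) :
    wordTerm w K = cvar K := by
  induction w with
  | nil => rfl
  | cons x w ih =>
    rw [wordTerm_cons_of_notMem (h x List.mem_cons_self)]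
    exact ih fun y hy => h y (List.mem_cons_of_mem _ hy)

/-- The recursions run in parallel: the set `D` is always the trace of the sort `K`, and saturation
of `K` is the invariant that makes traces of components components of the trace. -/
theorem toTerm_ofWord (hXY : X ⊆ Y.1) {w : List α} (hw : ∀ x ∈ w, x ∈ X) {D : Finset α}
    (hD : D.Nonempty) (hDw : ∀ x ∈ D, x ∈ w) {K : ConnSet H} (hK : IsSaturated Y X K.1)
    (hDK : D = K.1 ∩ X) (h : D ⊆ K.1) :
    (ofWord (L := shape Y X) w D hD).toTerm K h = wordTerm w K := by
  induction w generalizing D K with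
  | nil =>
    obtain ⟨x, hx⟩ := hD
    exact absurd (hDw x hx) List.not_mem_nil
  | cons x w ih =>
    have hxX := hw x List.mem_cons_self
    have hw' := fun y hy => hw y (List.mem_cons_of_mem _ hy)
    by_cases hx : x ∈ D
    · rw [ofWord_cons hD hx, Construction.toTerm, wordTerm_cons (h hx)]
      refine capp_inj.2 (funext fun C => ?_)
      by_cases hC : C.1 ∩ (shape Y X).verts ∈ (shape Y X).comps (D \ {x})
      · rw [dif_pos hC]
        refine ih hw' _ ?_ (hK.comp hxX C.2) (congrArg (C.1 ∩ ·) (verts_shape hXY)) _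
        intro y hy
        have hy' := Finset.mem_sdiff.1 (subset_of_mem_comps hC hy)
        exact (List.mem_cons.1 (hDw y hy'.1)).resolve_left fun e =>
          hy'.2 (Finset.mem_singleton.2 e)
      · rw [dif_neg hC]
        -- A remaining letter in `C` would make the trace of `C` a component, so here the word
        -- leaves the variable `C`.
        refine (wordTerm_eq_cvar fun y hy hyC => hC ?_).symm
        rw [verts_shape hXY, hDK]
        exact hK.mem_comps_shape hxX C.2 ⟨y, Finset.mem_inter.2 ⟨hyC, hw' y hy⟩⟩
    · have hxK : x ∉ K.1 := fun hxK => hx (hDK ▸ Finset.mem_inter.2 ⟨hxK, hxX⟩)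
      rw [wordTerm_cons_of_notMem hxK]
      simp only [ofWord_cons_of_notMem hD hx]
      refine ih hw' hD (fun y hy => ?_) hK hDK h
      refine (List.mem_cons.1 (hDw y hy)).resolve_left ?_
      rintro rfl
      exact hx hy

theorem toTerm_triple (hXY : X ⊆ Y.1) {x y z : α} (t : IsTriple X x y z) (hX : X.Nonempty) :
    (ofWord (L := shape Y X) [x, y, z] X hX).toTerm Y hXY = wordTerm [x, y, z] Y := by
  refine toTerm_ofWord hXY ?_ hX ?_ ⟨Finset.Subset.refl _, fun _ _ h _ _ => h⟩
    (Finset.inter_eq_right.2 hXY).symm hXY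
  · intro u hu
    rw [t.eq]
    simpa using hu
  · intro u hu
    rw [t.eq] at hu
    simpa using hu

variable {a b c : α}

theorem map_toTerm_upperBoundary (hXY : X ⊆ Y.1) (t : IsTriple X a b c) (hX : X.Nonempty) :
    (upperBoundary (shape Y X) X hX a b c).map (fun S => S.toTerm Y hXY) =
      wordTerm [a, b, c] Y ::
        upperPath (fun x y z => wordTerm [x, y, z] Y) (Joined Y) a b c := by
  simp only [upperBoundary, upperPath, List.map_cons, List.map_append, apply_ite (List.map _),
    List.map_nil, toTerm_triple hXY t, toTerm_triple hXY t.swap₂₃,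
    toTerm_triple hXY t.swap₂₃.swap₁₂,
    toTerm_triple hXY t.swap₂₃.swap₁₂.swap₂₃]
  classical
  rw [if_congr (isConn_shape_iff_joined t) rfl rfl,
    if_congr (isConn_shape_iff_joined t.swap₂₃.swap₁₂) rfl rfl]

theorem map_toTerm_lowerBoundary (hXY : X ⊆ Y.1) (t : IsTriple X a b c) (hX : X.Nonempty) :
    (lowerBoundary (shape Y X) X hX a b c).map (fun S => S.toTerm Y hXY) =
      wordTerm [a, b, c] Y ::
        lowerPath (fun x y z => wordTerm [x, y, z] Y) (Joined Y) a b c := by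
  simp only [lowerBoundary, lowerPath, List.map_cons, List.map_append, apply_ite (List.map _),
    List.map_nil, toTerm_triple hXY t, toTerm_triple hXY t.swap₁₂,
    toTerm_triple hXY t.swap₁₂.swap₂₃,
    toTerm_triple hXY t.swap₂₃.swap₁₂.swap₂₃]
  classical
  rw [if_congr (isConn_shape_iff_joined t.swap₁₂) rfl rfl]

end Nestohedra

/-! ### Confluence diagrams of critical pairs -/

namespace TermRewriting

variable {Sg : Signature.{u}}

theorem TRS.IsLocalConfluenceDiagram.symm {R : TRS Sg} {b : Sg.S} {s t₁ t₂ : Term Sg b}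
    {p q : List (Term Sg b)} (h : R.IsLocalConfluenceDiagram s t₁ t₂ p q) :
    R.IsLocalConfluenceDiagram s t₂ t₁ q p :=
  ⟨h.2.1, h.1, h.2.2.2.1, h.2.2.1, h.2.2.2.2.symm⟩

theorem TRS.IsCriticalConfluenceDiagram.symm {R : TRS Sg} {b : Sg.S}
    {p q : List (Term Sg b)} (h : R.IsCriticalConfluenceDiagram p q) :
    R.IsCriticalConfluenceDiagram q p := by
  obtain ⟨s, t₁, t₂, h₁, h₂⟩ := h
  exact ⟨s, t₂, t₁, h₁.symm, h₂.symm⟩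

end TermRewriting

namespace Nestohedra

variable {α : Type u} [LinearOrder α] {H : AtomicHypergraph α} {Y : ConnSet H} {X : Finset α}
  {a b c : α}

theorem isLocalConfluenceDiagram_iff (hXY : X ⊆ Y.1) (t : IsTriple X a b c) (hab : a < b)
    (hbc : b < c) {u : CTerm H Y}
    (hu : (upperPath (fun x y z => wordTerm [x, y, z] Y) (Joined Y) a b c).head? = some u)
    {p q : List (CTerm H Y)} :
    (constructionsTRS H).IsLocalConfluenceDiagram (wordTerm [a, b, c] Y) u (wordTerm [b, a, c] Y)
      p q ↔
    p = wordTerm [a, b, c] Y ::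
        upperPath (fun x y z => wordTerm [x, y, z] Y) (Joined Y) a b c ∧
      q = wordTerm [a, b, c] Y ::
        lowerPath (fun x y z => wordTerm [x, y, z] Y) (Joined Y) a b c := by
  have g := isFlipGraph_wordTerm hXY
  have B := g.isBigon t hab hbc
  have hl := g.lowerPath_head t
  constructor
  · rintro ⟨hp, hq, cp, cq, h⟩
    exact B.eq_of_prefix hu hl hp hq cp cq h
  · rintro ⟨rfl, rfl⟩
    refine ⟨?_, ?_, B.isChain, B.symm.isChain, ?_⟩
    · obtain ⟨l, hl⟩ := List.head?_eq_some_iff.1 hu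
      exact ⟨l, by rw [hl]; rfl⟩
    · obtain ⟨l, hl⟩ := List.head?_eq_some_iff.1 hl
      exact ⟨l, by rw [hl]; rfl⟩
    · rw [List.getLast?_cons, List.getLast?_cons, B.last₁, B.last₂]

theorem exists_isCriticalPair (hXY : X ⊆ Y.1) (t : IsTriple X a b c) (hab : a < b)
    (hbc : b < c) : ∃ u,
    (upperPath (fun x y z => wordTerm [x, y, z] Y) (Joined Y) a b c).head? = some u ∧
    (constructionsTRS H).IsCriticalPair (wordTerm [a, b, c] Y) u (wordTerm [b, a, c] Y) := by
  have ha := hXY t.mem₁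
  have hb := hXY t.mem₂
  have hc := hXY t.mem₃
  by_cases hj : Joined Y a b c
  · exact ⟨_, upperPath_head_of_conn hj, (isCriticalPair_of_joined ha hb hab hbc hj).symm⟩
  · exact ⟨_, (isFlipGraph_wordTerm hXY).upperPath_head t hj,
      (isCriticalPair_of_not_joined ha hb hc hab (hab.trans hbc) hbc.ne hj).symm⟩

/-- A critical pair comes from a three-element set, and its confluence diagrams are known. -/
theorem isLocalConfluenceDiagram_of_isCriticalPair {s t₁ t₂ : CTerm H Y}
    (h : (constructionsTRS H).IsCriticalPair s t₁ t₂) : ∃ X a b c, X ⊆ Y.1 ∧ IsTriple X a b c ∧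
      a < b ∧ b < c ∧ ∃ p q : List (CTerm H Y),
      ((p = wordTerm [a, b, c] Y ::
          upperPath (fun x y z => wordTerm [x, y, z] Y) (Joined Y) a b c ∧
        q = wordTerm [a, b, c] Y ::
          lowerPath (fun x y z => wordTerm [x, y, z] Y) (Joined Y) a b c) ∨
      (q = wordTerm [a, b, c] Y ::
          upperPath (fun x y z => wordTerm [x, y, z] Y) (Joined Y) a b c ∧
        p = wordTerm [a, b, c] Y ::
          lowerPath (fun x y z => wordTerm [x, y, z] Y) (Joined Y) a b c)) ∧
      ∀ p' q', (constructionsTRS H).IsLocalConfluenceDiagram s t₁ t₂ p' q' ↔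
        p' = p ∧ q' = q := by
  obtain ⟨a, b, c, u, ha, hb, hc, hab, hbc, rfl, hu, ht⟩ := exists_triple_of_isCriticalPair h
  have t : IsTriple {a, b, c} a b c := ⟨hab.ne, (hab.trans hbc).ne, hbc.ne, rfl⟩
  have hXY : {a, b, c} ⊆ Y.1 := by
    intro u hu
    simp only [Finset.mem_insert, Finset.mem_singleton] at hu
    rcases hu with rfl | rfl | rfl <;> assumption
  have hu' : (upperPath (fun x y z => wordTerm [x, y, z] Y) (Joined Y) a b c).head? = some u := by
    rcases hu with ⟨hj, rfl⟩ | ⟨hj, rfl⟩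
    · exact upperPath_head_of_conn hj
    · exact (isFlipGraph_wordTerm hXY).upperPath_head t hj
  have key := fun p q => isLocalConfluenceDiagram_iff hXY t hab hbc hu' (p := p) (q := q)
  refine ⟨_, a, b, c, hXY, t, hab, hbc, ?_⟩
  rcases ht with ⟨rfl, rfl⟩ | ⟨rfl, rfl⟩
  · exact ⟨_, _, Or.inl ⟨rfl, rfl⟩, key⟩
  · refine ⟨_, _, Or.inr ⟨rfl, rfl⟩, fun p q => ?_⟩
    rw [and_comm, ← key]
    exact ⟨fun h => h.symm, fun h => h.symm⟩

/-- The set is recovered as the set of vertices in the function symbols. -/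
theorem eq_of_wordTerm_eq {a' b' c' : α} {X' : Finset α} (hXY : X ⊆ Y.1) (hXY' : X' ⊆ Y.1)
    (t : IsTriple X a b c) (t' : IsTriple X' a' b' c')
    (h : wordTerm [a, b, c] Y = wordTerm [a', b', c'] Y) : X = X' := by
  have key : ∀ {X : Finset α} {a b c : α}, X ⊆ Y.1 → IsTriple X a b c → ∀ u, u ∈ X ↔
      u ∈ labels (wordTerm [a, b, c] Y) := by
    intro X a b c hXY t u
    rw [mem_labels_wordTerm]
    constructor
    · intro hu
      refine ⟨?_, hXY hu⟩
      rw [t.eq] at hu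
      simpa using hu
    · rintro ⟨hu, -⟩
      rw [t.eq]
      simpa using hu
  ext u
  rw [key hXY t, key hXY' t', h]

end Nestohedra

theorem mainTheorem5 {α : Type u} [LinearOrder α] (H : AtomicHypergraph α) (hH : H.Connected) :
    -- every maximal face has an oriented boundary, unique up to exchanging the two paths,
    -- and its image is a critical confluence diagram
    (∀ (Y : ConnSet H) (X : Finset α) (hXY : X ⊆ Y.1), X.card = 3 →
      ∃ P Q : List (Construction (shape Y X) X), IsMaxFaceBoundary Y X P Q ∧
        (∀ P' Q', IsMaxFaceBoundary Y X P' Q' → (P' = P ∧ Q' = Q) ∨ (P' = Q ∧ Q' = P))) ∧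
    (∀ (Y : ConnSet H) (X : Finset α) (hXY : X ⊆ Y.1), X.card = 3 →
      ∀ P Q : List (Construction (shape Y X) X), IsMaxFaceBoundary Y X P Q →
        (constructionsTRS H).IsCriticalConfluenceDiagram
          (P.map fun S => S.toTerm Y hXY) (Q.map fun S => S.toTerm Y hXY)) ∧
    -- every critical confluence diagram arises in this way, from exactly one maximal face
    (∀ (Y : ConnSet H) (p q : List (CTerm H Y)),
      (constructionsTRS H).IsCriticalConfluenceDiagram p q →
        ∃! X : Finset α, ∃ hXY : X ⊆ Y.1, X.card = 3 ∧
          ∃ P Q : List (Construction (shape Y X) X), IsMaxFaceBoundary Y X P Q ∧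
            p = (P.map fun S => S.toTerm Y hXY) ∧ q = (Q.map fun S => S.toTerm Y hXY)) ∧
    -- every critical pair has exactly one critical confluence diagram
    (∀ (Y : ConnSet H) (s t₁ t₂ : CTerm H Y), (constructionsTRS H).IsCriticalPair s t₁ t₂ →
      ∃! d : List (CTerm H Y) × List (CTerm H Y),
        (constructionsTRS H).IsLocalConfluenceDiagram s t₁ t₂ d.1 d.2) := by
  refine ⟨?_, ?_, ?_, ?_⟩
  · intro Y X hXY h3
    obtain ⟨a, b, c, t, hab, hbc⟩ := IsTriple.exists_lt h3
    have hX : X.Nonempty := ⟨a, t.mem₁⟩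
    have key := fun P Q => isBoundary_maxFace_iff (verts_shape hXY) hX t hab hbc (P := P) (Q := Q)
    exact ⟨_, _, ⟨hX, (key _ _).2 (Or.inl ⟨rfl, rfl⟩)⟩, fun P' Q' ⟨_, h⟩ => (key P' Q').1 h⟩
  · rintro Y X hXY h3 P Q ⟨hX, h⟩
    obtain ⟨a, b, c, t, hab, hbc⟩ := IsTriple.exists_lt h3
    have main : (constructionsTRS H).IsCriticalConfluenceDiagram
        ((upperBoundary (shape Y X) X hX a b c).map fun S => S.toTerm Y hXY)
        ((lowerBoundary (shape Y X) X hX a b c).map fun S => S.toTerm Y hXY) := by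
      rw [map_toTerm_upperBoundary hXY t, map_toTerm_lowerBoundary hXY t]
      obtain ⟨u, hu, hc⟩ := exists_isCriticalPair hXY t hab hbc
      exact ⟨_, u, _, hc, (isLocalConfluenceDiagram_iff hXY t hab hbc hu).2 ⟨rfl, rfl⟩⟩
    rcases (isBoundary_maxFace_iff (verts_shape hXY) hX t hab hbc).1 h with
      ⟨rfl, rfl⟩ | ⟨rfl, rfl⟩
    exacts [main, main.symm]
  · rintro Y p q ⟨s, t₁, t₂, hc, hd⟩
    obtain ⟨X, a, b, c, hXY, t, hab, hbc, p', q', hpq, key⟩ :=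
      isLocalConfluenceDiagram_of_isCriticalPair hc
    obtain ⟨rfl, rfl⟩ := (key p q).1 hd
    have hX : X.Nonempty := ⟨a, t.mem₁⟩
    have bd := fun P Q => isBoundary_maxFace_iff (verts_shape hXY) hX t hab hbc (P := P) (Q := Q)
    refine ⟨X, ⟨hXY, t.card_eq, ?_⟩, ?_⟩
    · rcases hpq with ⟨hp, hq⟩ | ⟨hq, hp⟩ <;>
        rw [← map_toTerm_upperBoundary hXY t hX, ← map_toTerm_lowerBoundary hXY t hX] at *
      · exact ⟨_, _, ⟨hX, (bd _ _).2 (Or.inl ⟨rfl, rfl⟩)⟩, hp, hq⟩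
      · exact ⟨_, _, ⟨hX, (bd _ _).2 (Or.inr ⟨rfl, rfl⟩)⟩, hp, hq⟩
    -- Either boundary path begins with the source, so the first term of `p` alone determines the
    -- three-element set.
    · rintro X' ⟨hXY', h3', P, Q, ⟨hX', hb⟩, hp, -⟩
      obtain ⟨a', b', c', t', hab', hbc'⟩ := IsTriple.exists_lt h3'
      have h₁ : p.head? = some (wordTerm [a, b, c] Y) := by
        rcases hpq with ⟨rfl, -⟩ | ⟨-, rfl⟩ <;> rfl
      have h₂ : p.head? = some (wordTerm [a', b', c'] Y) := by
        rcases (isBoundary_maxFace_iff (verts_shape hXY') hX' t' hab' hbc').1 hb with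
          ⟨rfl, -⟩ | ⟨rfl, -⟩
        · rw [hp, map_toTerm_upperBoundary hXY' t']
          rfl
        · rw [hp, map_toTerm_lowerBoundary hXY' t']
          rfl
      exact (eq_of_wordTerm_eq hXY hXY' t t' (Option.some.inj (h₁.symm.trans h₂))).symm
  · intro Y s t₁ t₂ h
    obtain ⟨-, -, -, -, -, -, -, -, p, q, -, key⟩ := isLocalConfluenceDiagram_of_isCriticalPair h
    exact ⟨(p, q), (key p q).2 ⟨rfl, rfl⟩, fun d hd =>
      Prod.ext_iff.2 ((key d.1 d.2).1 hd)⟩
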